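/- **Conventions.** Let $\Bbbk$ be a field. All categories, functors and bifunctors are $\Bbbk$-linear (bilinear), and $\mathbf S$, $\mathbf M$, $\mathcal A$ denote small categories (all of one fixed size). $[\mathcal A^{\mathrm{op}},\mathbf{Vec}_\Bbbk]$ is the category of $\Bbbk$-linear presheaves. * A *semigroup category* $(\mathbf S,\boxtimes,\mathsf a)$ is a category with a tensor product and a natural associator $\mathsf a_{X,Y,Z}:(X\boxtimes Y)\boxtimes Z\cong X\boxtimes(Y\boxtimes Z)$ satisfying the pentagon axiom; no unit is required. It is *monoidal* if it has a unit object with natural unit isomorphisms satisfying the triangle axiom. * A *(semigroup) $\mathbf S$-module category* is a category $\mathbf M$ with an action $\star:\mathbf S\otimes_\Bbbk\mathbf M\to\mathbf M$ and natural isomorphisms $\mathsf m_{G,H;X}:(G\boxtimes H)\star X\cong G\star(H\star X)$ satisfying the pentagon axiom; no unitality is required. If $\mathbf S$ is monoidal with unit $\mathbb 1$, the module category is *monoidal* if there is a natural isomorphism $\mathbb 1\star-\cong\mathrm{Id}$ satisfying the triangle axiom. Right module categories are defined symmetrically; $\mathbf S$ is a left and a right module category over itself. A module functor is a functor $\Phi$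 with natural isomorphisms $\Phi(G\star X)\cong G\star\Phi(X)$ compatible with $\mathsf m$; two module categories are equivalent, $\simeq$, if there is a module functor between them which is an equivalence of categories. * An *adjunction* in $\mathbf S$ is a tuple $(F,F^\diamond,\eta^l,\eta^r,\varepsilon^l,\varepsilon^r)$ where $F,F^\diamond\in\mathbf S$, where $\eta^l:\mathrm{Id}\to-\boxtimes(F^\diamond\boxtimes F)$ and $\varepsilon^l:-\boxtimes(F\boxtimes F^\diamond)\to\mathrm{Id}$ are left $\mathbf S$-module transformations, and $\eta^r:\mathrm{Id}\to(F^\diamond\boxtimes F)\boxtimes-$ and $\varepsilon^r:(F\boxtimes F^\diamond)\boxtimes-\to\mathrm{Id}$ are right $\mathbf S$-module transformations, such that, with associators inserted: (I) $(-\boxtimes F^\diamond)\dashv(-\boxtimes F)$ with unit $\eta^l$ and counit $\varepsilon^l$; (II) $(F\boxtimes-)\dashv(F^\diamond\boxtimes-)$ with unit $\eta^r$ and counit $\varepsilon^r$; (III) $\varepsilon^r_F\circ\mathsf a^{-1}_{F,F^\diamond,F}\circ\eta^l_F=\mathrm{id}_F$ and $\varepsilon^l_{F^\diamond}\circ\mathsf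 a_{F^\diamond,F,F^\diamond}\circ\eta^r_{F^\diamond}=\mathrm{id}_{F^\diamond}$; (IV) $\mathsf a^{-1}_{H,F^\diamond\boxtimes F,K}\circ(H\boxtimes\eta^r_K)=\eta^l_H\boxtimes K$ and $(H\boxtimes\varepsilon^r_K)\circ\mathsf a_{H,F\boxtimes F^\diamond,K}=\varepsilon^l_H\boxtimes K$ for all $H,K\in\mathbf S$. Then $F^\diamond$ is a right dual of $F$, and $F$ a left dual of $F^\diamond$. $\mathbf S$ is *rigid* if every object has a right dual and a left dual. * A functor $T:\mathcal A\to\mathcal B$ is *liberal* if every object of $\mathcal B$ is a direct summand of a finite direct sum of objects of the form $T(X)$. One writes $\mathbf S\star\mathbf M=\mathbf M$ if every object of $\mathbf M$ is a direct summand of a finite direct sum of objects of the form $H\star Y$ with $H\in\mathbf S$, $Y\in\mathbf M$. (If direct sums are missing, "$Y$ is a direct summand of $\bigoplus_{i=1}^nX_i$" means that there are $f_i:Y\to X_i$ and $g_i:X_i\to Y$ with $\sum_i g_if_i=\mathrm{id}_Y$.) * The adjunction is *respected* in $\mathbf M$ if there is an adjunction $(F\star-)\dashv(F^\diamond\star-)$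 with unit $\eta^{\mathbf M}$ and counit $\varepsilon^{\mathbf M}$ such that $H\star\eta^{\mathbf M}_X=\eta^l_H\star X$ and $H\star\varepsilon^{\mathbf M}_X=\varepsilon^l_H\star X$, up to the module associators, for all $H\in\mathbf S$, $X\in\mathbf M$. * $[\mathbf S^{\mathrm{op}},\mathbf{Vec}_\Bbbk]$ is a semigroup category under Day convolution, and it acts on $[\mathbf M^{\mathrm{op}},\mathbf{Vec}_\Bbbk]$ by the cocontinuous extension of the action of $\mathbf S$ on $\mathbf M$, $$(P\star R)(X)=\int^{H\in\mathbf S,\,Y\in\mathbf M}\operatorname{Hom}(X,H\star Y)\otimes_\Bbbk P(H)\otimes_\Bbbk R(Y);$$ Day convolution is the case $\mathbf M=\mathbf S$. * A *module presheaf category* is a module category over $[\mathbf S^{\mathrm{op}},\mathbf{Vec}_\Bbbk]$ whose underlying category is $[\mathcal A^{\mathrm{op}},\mathbf{Vec}_\Bbbk]$ for a small $\mathcal A$ and whose action is cocontinuous in both variables. For such an $\mathbf N$, $\mathbf N\text{-f.g.proj}$ is its full subcategory of finitely generated projective objects. * A category is *Cauchy complete* if it has finite direct sums and all idempotents split. **Theorem.**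 Let $\mathbf S$ be a rigid semigroup category, and let $(F,F^\diamond,\eta^l,\eta^r,\varepsilon^l,\varepsilon^r)$ be an adjunction in $\mathbf S$ such that $F\boxtimes-$ is liberal. Then $[\mathbf S^{\mathrm{op}},\mathbf{Vec}_\Bbbk]$ with Day convolution is monoidal, and, for any choice of its unit structure: 1. If $\mathbf M$ is a semigroup $\mathbf S$-module category such that $\mathbf S\star\mathbf M=\mathbf M$ and in which the adjunction is respected, then $[\mathbf M^{\mathrm{op}},\mathbf{Vec}_\Bbbk]$ is a monoidal $[\mathbf S^{\mathrm{op}},\mathbf{Vec}_\Bbbk]$-module category. 2. There is a bijection $$\left\{\begin{array}{c}\text{Cauchy complete semigroup }\mathbf S\text{-module categories }\mathbf M\\ \text{respecting the adjunction, with }\mathbf S\star\mathbf M=\mathbf M\end{array}\right\}\Big/\simeq\ \longleftrightarrow\ \left\{\begin{array}{c}\text{monoidal }[\mathbf S^{\mathrm{op}},\mathbf{Vec}_\Bbbk]\text{-module presheaf categories }\mathbf N\\ \text{on which }\operatorname{Hom}(-,F^\diamond)\text{ acts faithfully}\end{array}\right\}\Big/\simeq$$ given by $\mathbf M\mapsto[\mathbf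 M^{\mathrm{op}},\mathbf{Vec}_\Bbbk]$, which in particular lies in the right-hand set. Its inverse is $\mathbf N\mapsto\mathbf N\text{-f.g.proj}$: the full subcategory $\mathbf N\text{-f.g.proj}$ is closed under the action of all representable presheaves $\operatorname{Hom}(-,G)$, $G\in\mathbf S$, so that $\mathbf S$ acts on it by restriction along the Yoneda embedding, and the inverse sends the class of $\mathbf N$ to the class of those $\mathbf M$ in the left-hand set which are equivalent to $\mathbf N\text{-f.g.proj}$ as $\mathbf S$-module categories. -/

import Mathlib

open CategoryTheory Opposite TensorProduct

universe u v₁ v₂ v₃ v₄ u₁ u₂ u₃ u₄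

noncomputable section

namespace SemigroupModule

section Presheaves

variable (k : Type u) [Field k]

/-- A presheaf of `k`-vector spaces on a `k`-linear category is `k`-linear if its action on
morphisms is `k`-linear. -/
def linearPresheaf (A : Type u) [SmallCategory A] [Preadditive A] [Linear k A] :
    ObjectProperty (Aᵒᵖ ⥤ ModuleCat.{u} k) := fun P =>
  (∀ (X Y : A) (f g : X ⟶ Y), P.map (f + g).op = P.map f.op + P.map g.op) ∧
    ∀ (X Y : A) (c : k) (f : X ⟶ Y), P.map (c • f).op = c • P.map f.op

/-- The category `[Aᵒᵖ, Vec_k]` of `k`-linear presheaves on a small `k`-linear category `A`. -/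
abbrev PSh (A : Type u) [SmallCategory A] [Preadditive A] [Linear k A] : Type (u + 1) :=
  (linearPresheaf k A).FullSubcategory

variable {k}
variable {A : Type u} [SmallCategory A] [Preadditive A] [Linear k A]

namespace PSh

/-- The vector space `P(X)`. -/
abbrev val (P : PSh k A) (X : A) : Type u := P.obj.obj (op X)

/-- The restriction map `P(f) : P(Y) → P(X)` of `f : X ⟶ Y`. -/
def res (P : PSh k A) {X Y : A} (f : X ⟶ Y) : P.val Y →ₗ[k] P.val X := (P.obj.map f.op).hom

/-- The component `P(X) → Q(X)` of a morphism of presheaves. -/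
def app {P Q : PSh k A} (φ : P ⟶ Q) (X : A) : P.val X →ₗ[k] Q.val X := (φ.hom.app (op X)).hom

@[simp] lemma res_id (P : PSh k A) (X : A) (p : P.val X) : P.res (𝟙 X) p = p := by
  simp [res]

lemma res_comp (P : PSh k A) {X Y Z : A} (f : X ⟶ Y) (g : Y ⟶ Z) (p : P.val Z) :
    P.res (f ≫ g) p = P.res f (P.res g p) := by
  simp [res]

lemma res_add (P : PSh k A) {X Y : A} (f g : X ⟶ Y) (p : P.val Y) :
    P.res (f + g) p = P.res f p + P.res g p := by
  exact congrArg (fun t => t.hom p) (P.property.1 _ _ f g)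

lemma res_smul (P : PSh k A) {X Y : A} (c : k) (f : X ⟶ Y) (p : P.val Y) :
    P.res (c • f) p = c • P.res f p := by
  exact congrArg (fun t => t.hom p) (P.property.2 _ _ c f)

@[simp] lemma app_id (P : PSh k A) (X : A) (p : P.val X) : app (𝟙 P) X p = p := rfl

@[simp] lemma app_comp {P Q R : PSh k A} (φ : P ⟶ Q) (ψ : Q ⟶ R) (X : A) (p : P.val X) :
    app (φ ≫ ψ) X p = app ψ X (app φ X p) := rfl

@[simp] lemma app_add {P Q : PSh k A} (φ ψ : P ⟶ Q) (X : A) (p : P.val X) :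
    app (φ + ψ) X p = app φ X p + app ψ X p := rfl

@[simp] lemma app_smul {P Q : PSh k A} (c : k) (φ : P ⟶ Q) (X : A) (p : P.val X) :
    app (c • φ) X p = c • app φ X p := rfl

lemma app_res {P Q : PSh k A} (φ : P ⟶ Q) {X Y : A} (f : X ⟶ Y) (p : P.val Y) :
    app φ X (P.res f p) = Q.res f (app φ Y p) := by
  have := φ.hom.naturality f.op
  exact congrArg (fun t => t.hom p) this

lemma hom_ext {P Q : PSh k A} {φ ψ : P ⟶ Q} (h : ∀ X (p : P.val X), app φ X p = app ψ X p) :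
    φ = ψ := by
  apply ObjectProperty.hom_ext
  ext X p
  exact h X.unop p

/-- A linear presheaf from its values and restriction maps. -/
def mk' (V : A → Type u) [∀ X, AddCommGroup (V X)] [∀ X, Module k (V X)]
    (r : ∀ {X Y : A}, (X ⟶ Y) → (V Y →ₗ[k] V X))
    (h1 : ∀ X (p : V X), r (𝟙 X) p = p)
    (h2 : ∀ {X Y Z : A} (f : X ⟶ Y) (g : Y ⟶ Z) (p : V Z), r (f ≫ g) p = r f (r g p))
    (h3 : ∀ {X Y : A} (f g : X ⟶ Y) (p : V Y), r (f + g) p = r f p + r g p)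
    (h4 : ∀ {X Y : A} (c : k) (f : X ⟶ Y) (p : V Y), r (c • f) p = c • r f p) : PSh k A where
  obj :=
    { obj := fun X => ModuleCat.of k (V X.unop)
      map := fun f => ModuleCat.ofHom (r f.unop)
      map_id := fun X => by ext p; exact h1 _ p
      map_comp := fun f g => by ext p; exact h2 _ _ p }
  property := ⟨fun X Y f g => by ext p; exact h3 f g p, fun X Y c f => by ext p; exact h4 c f p⟩

/-- A morphism of presheaves from its components. -/
def homMk' {P Q : PSh k A} (a : ∀ X, P.val X →ₗ[k] Q.val X)
    (h : ∀ {X Y : A} (f : X ⟶ Y) (p : P.val Y), a X (P.res f p) = Q.res f (a Y p)) : P ⟶ Q :=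
  ObjectProperty.homMk
    { app := fun X => ModuleCat.ofHom (a X.unop)
      naturality := fun X Y f => by ext p; exact h f.unop p }

@[simp] lemma app_homMk' {P Q : PSh k A} (a : ∀ X, P.val X →ₗ[k] Q.val X)
    (h : ∀ {X Y : A} (f : X ⟶ Y) (p : P.val Y), a X (P.res f p) = Q.res f (a Y p)) (X : A)
    (p : P.val X) : app (homMk' a h) X p = a X p := rfl

/-- An isomorphism of presheaves from mutually inverse morphisms, checked on elements. -/
def isoMk' {P Q : PSh k A} (φ : P ⟶ Q) (ψ : Q ⟶ P)
    (h : ∀ X (p : P.val X), app ψ X (app φ X p) = p)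
    (h' : ∀ X (q : Q.val X), app φ X (app ψ X q) = q) : P ≅ Q where
  hom := φ
  inv := ψ
  hom_inv_id := hom_ext h
  inv_hom_id := hom_ext h'

end PSh

/-- The `k`-linear Yoneda embedding `X ↦ Hom(-, X)`. -/
def yo : A ⥤ PSh k A where
  obj X := PSh.mk' (fun Y => (Y ⟶ X)) (fun f => Linear.leftComp k X f) (by simp) (by simp)
    (by simp) (by simp)
  map f := PSh.homMk' (fun Y => Linear.rightComp k Y f) (fun g p => Category.assoc g p f)
  map_id X := PSh.hom_ext (fun Y p => Category.comp_id p)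
  map_comp f g := PSh.hom_ext (fun Y p => (Category.assoc p f g).symm)

lemma yo_res (G : A) {X Y : A} (f : X ⟶ Y) (p : Y ⟶ G) : (yo (k := k).obj G).res f p = f ≫ p :=
  rfl

lemma yo_app {G H : A} (g : G ⟶ H) {X : A} (p : X ⟶ G) :
    PSh.app (yo (k := k).map g) X p = p ≫ g := rfl

end Presheaves

section Bifunctors

variable (k : Type u) [Field k]

/-- A bifunctor between `k`-linear categories is bilinear: equivalently, it is a `k`-linear functor
from the tensor product category `A ⊗ₖ B` to `C`. -/
structure IsBilinear {A : Type u₁} {B : Type u₂} {C : Type u₃} [Category.{v₁} A]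
    [Category.{v₂} B] [Category.{v₃} C] [Preadditive A] [Preadditive B] [Preadditive C]
    [Linear k A] [Linear k B] [Linear k C] (T : A ⥤ B ⥤ C) : Prop where
  add_left : ∀ {X X' : A} (f g : X ⟶ X') (Y : B),
    (T.map (f + g)).app Y = (T.map f).app Y + (T.map g).app Y
  smul_left : ∀ {X X' : A} (c : k) (f : X ⟶ X') (Y : B),
    (T.map (c • f)).app Y = c • (T.map f).app Y
  add_right : ∀ (X : A) {Y Y' : B} (f g : Y ⟶ Y'),
    (T.obj X).map (f + g) = (T.obj X).map f + (T.obj X).map g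
  smul_right : ∀ (X : A) {Y Y' : B} (c : k) (f : Y ⟶ Y'),
    (T.obj X).map (c • f) = c • (T.obj X).map f

/-- The structure of a semigroup category on a `k`-linear category `S`: a bilinear tensor product
with a natural associator satisfying the pentagon axiom. No unit object is required. -/
structure SemigroupStr (S : Type u₁) [Category.{v₁} S] [Preadditive S] [Linear k S] where
  tensor : S ⥤ S ⥤ S
  bilinear : IsBilinear k tensor
  assoc : ∀ X Y Z : S, (tensor.obj ((tensor.obj X).obj Y)).obj Z ≅
    (tensor.obj X).obj ((tensor.obj Y).obj Z)
  assoc_nat_left : ∀ {X X' : S} (f : X ⟶ X') (Y Z : S),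
    (tensor.map ((tensor.map f).app Y)).app Z ≫ (assoc X' Y Z).hom =
      (assoc X Y Z).hom ≫ (tensor.map f).app ((tensor.obj Y).obj Z)
  assoc_nat_mid : ∀ (X : S) {Y Y' : S} (f : Y ⟶ Y') (Z : S),
    (tensor.map ((tensor.obj X).map f)).app Z ≫ (assoc X Y' Z).hom =
      (assoc X Y Z).hom ≫ (tensor.obj X).map ((tensor.map f).app Z)
  assoc_nat_right : ∀ (X Y : S) {Z Z' : S} (f : Z ⟶ Z'),
    (tensor.obj ((tensor.obj X).obj Y)).map f ≫ (assoc X Y Z').hom =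
      (assoc X Y Z).hom ≫ (tensor.obj X).map ((tensor.obj Y).map f)
  pentagon : ∀ W X Y Z : S,
    (tensor.map (assoc W X Y).hom).app Z ≫ (assoc W ((tensor.obj X).obj Y) Z).hom ≫
        (tensor.obj W).map (assoc X Y Z).hom =
      (assoc ((tensor.obj W).obj X) Y Z).hom ≫ (assoc W X ((tensor.obj Y).obj Z)).hom

variable {k}

/-- The structure of a (left, semigroup) module category over a semigroup category: a bilinear
action with a natural module associator satisfying the pentagon axiom. No unitality is required. -/
structure ModuleStr {S : Type u₁} [Category.{v₁} S] [Preadditive S] [Linear k S]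
    (σ : SemigroupStr k S) (M : Type u₂) [Category.{v₂} M] [Preadditive M] [Linear k M] where
  act : S ⥤ M ⥤ M
  bilinear : IsBilinear k act
  assoc : ∀ (G H : S) (X : M), (act.obj ((σ.tensor.obj G).obj H)).obj X ≅
    (act.obj G).obj ((act.obj H).obj X)
  assoc_nat_left : ∀ {G G' : S} (f : G ⟶ G') (H : S) (X : M),
    (act.map ((σ.tensor.map f).app H)).app X ≫ (assoc G' H X).hom =
      (assoc G H X).hom ≫ (act.map f).app ((act.obj H).obj X)
  assoc_nat_mid : ∀ (G : S) {H H' : S} (f : H ⟶ H') (X : M),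
    (act.map ((σ.tensor.obj G).map f)).app X ≫ (assoc G H' X).hom =
      (assoc G H X).hom ≫ (act.obj G).map ((act.map f).app X)
  assoc_nat_right : ∀ (G H : S) {X X' : M} (f : X ⟶ X'),
    (act.obj ((σ.tensor.obj G).obj H)).map f ≫ (assoc G H X').hom =
      (assoc G H X).hom ≫ (act.obj G).map ((act.obj H).map f)
  pentagon : ∀ (G H K : S) (X : M),
    (act.map (σ.assoc G H K).hom).app X ≫ (assoc G ((σ.tensor.obj H).obj K) X).hom ≫
        (act.obj G).map (assoc H K X).hom =
      (assoc ((σ.tensor.obj G).obj H) K X).hom ≫ (assoc G H ((act.obj K).obj X)).hom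

/-- A semigroup category is a module category over itself. -/
def SemigroupStr.regular {S : Type u₁} [Category.{v₁} S] [Preadditive S] [Linear k S]
    (σ : SemigroupStr k S) : ModuleStr σ S where
  act := σ.tensor
  bilinear := σ.bilinear
  assoc := σ.assoc
  assoc_nat_left := σ.assoc_nat_left
  assoc_nat_mid := σ.assoc_nat_mid
  assoc_nat_right := σ.assoc_nat_right
  pentagon := σ.pentagon

end Bifunctors

section Day

variable {k : Type u} [Field k]
variable {A B C : Type u} [SmallCategory A] [SmallCategory B] [SmallCategory C]
  [Preadditive A] [Preadditive B] [Preadditive C] [Linear k A] [Linear k B] [Linear k C]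

/-- The direct sum of the spaces `Hom(X, T(H, K)) ⊗ P(H) ⊗ Q(K)`, of which the coend defining the
convolution is a quotient. -/
def DaySum (T : A ⥤ B ⥤ C) (P : PSh k A) (Q : PSh k B) (X : C) : Type u :=
  DirectSum (A × B) fun i => ((X ⟶ (T.obj i.1).obj i.2) ⊗[k] P.val i.1) ⊗[k] Q.val i.2

instance (T : A ⥤ B ⥤ C) (P : PSh k A) (Q : PSh k B) (X : C) : AddCommGroup (DaySum T P Q X) :=
  inferInstanceAs (AddCommGroup (DirectSum (A × B) fun i =>
    ((X ⟶ (T.obj i.1).obj i.2) ⊗[k] P.val i.1) ⊗[k] Q.val i.2))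

instance (T : A ⥤ B ⥤ C) (P : PSh k A) (Q : PSh k B) (X : C) : Module k (DaySum T P Q X) :=
  inferInstanceAs (Module k (DirectSum (A × B) fun i =>
    ((X ⟶ (T.obj i.1).obj i.2) ⊗[k] P.val i.1) ⊗[k] Q.val i.2))

namespace DaySum

variable {T : A ⥤ B ⥤ C} {P : PSh k A} {Q : PSh k B} {X : C}

open Classical in
/-- The inclusion of the summand of index `(H, K)`. -/
def incl (H : A) (K : B) :
    ((X ⟶ (T.obj H).obj K) ⊗[k] P.val H) ⊗[k] Q.val K →ₗ[k] DaySum T P Q X :=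
  DirectSum.lof k (A × B) (fun i => ((X ⟶ (T.obj i.1).obj i.2) ⊗[k] P.val i.1) ⊗[k] Q.val i.2)
    (H, K)

open Classical in
/-- The linear map out of the direct sum given by a family of linear maps. -/
def desc {V : Type v₁} [AddCommGroup V] [Module k V]
    (t : ∀ (H : A) (K : B), ((X ⟶ (T.obj H).obj K) ⊗[k] P.val H) ⊗[k] Q.val K →ₗ[k] V) :
    DaySum T P Q X →ₗ[k] V :=
  DirectSum.toModule k (A × B) V fun i => t i.1 i.2

@[simp] lemma desc_incl {V : Type v₁} [AddCommGroup V] [Module k V]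
    (t : ∀ (H : A) (K : B), ((X ⟶ (T.obj H).obj K) ⊗[k] P.val H) ⊗[k] Q.val K →ₗ[k] V)
    (H : A) (K : B) (x) : desc (T := T) t (incl H K x) = t H K x := by
  classical
  exact DirectSum.toModule_lof k (M := fun i : A × B =>
    ((X ⟶ (T.obj i.1).obj i.2) ⊗[k] P.val i.1) ⊗[k] Q.val i.2) (H, K) x

lemma ext {V : Type v₁} [AddCommGroup V] [Module k V] {a b : DaySum T P Q X →ₗ[k] V}
    (h : ∀ H K x, a (incl H K x) = b (incl H K x)) : a = b := by
  classical
  refine DirectSum.linearMap_ext (M := fun i : A × B =>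
    ((X ⟶ (T.obj i.1).obj i.2) ⊗[k] P.val i.1) ⊗[k] Q.val i.2) k ?_
  rintro ⟨H, K⟩
  exact LinearMap.ext (h H K)

/-- The pure tensor `f ⊗ p ⊗ q` in the summand of index `(H, K)`. -/
def pure (H : A) (K : B) (f : X ⟶ (T.obj H).obj K) (p : P.val H) (q : Q.val K) :
    DaySum T P Q X :=
  incl H K ((f ⊗ₜ p) ⊗ₜ q)

end DaySum

/-- The relations of the coend: `(f ≫ T(h, l)) ⊗ p ⊗ q` is identified with
`f ⊗ P(h)(p) ⊗ Q(l)(q)`. -/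
def dayRel (T : A ⥤ B ⥤ C) (P : PSh k A) (Q : PSh k B) (X : C) :
    Submodule k (DaySum T P Q X) :=
  Submodule.span k {r | ∃ (H H' : A) (K K' : B) (h : H ⟶ H') (l : K ⟶ K')
    (f : X ⟶ (T.obj H).obj K) (p : P.val H') (q : Q.val K'),
    r = DaySum.pure H' K' (f ≫ (T.map h).app K ≫ (T.obj H').map l) p q -
      DaySum.pure H K f (P.res h p) (Q.res l q)}

/-- The coend `∫^{H,K} Hom(X, T(H, K)) ⊗ P(H) ⊗ Q(K)`. -/
def Day (T : A ⥤ B ⥤ C) (P : PSh k A) (Q : PSh k B) (X : C) : Type u :=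
  DaySum T P Q X ⧸ dayRel T P Q X

instance (T : A ⥤ B ⥤ C) (P : PSh k A) (Q : PSh k B) (X : C) : AddCommGroup (Day T P Q X) :=
  inferInstanceAs (AddCommGroup (DaySum T P Q X ⧸ dayRel T P Q X))

instance (T : A ⥤ B ⥤ C) (P : PSh k A) (Q : PSh k B) (X : C) : Module k (Day T P Q X) :=
  inferInstanceAs (Module k (DaySum T P Q X ⧸ dayRel T P Q X))

namespace Day

variable {T : A ⥤ B ⥤ C} {P : PSh k A} {Q : PSh k B} {X : C}

/-- The quotient map. -/
def proj (T : A ⥤ B ⥤ C) (P : PSh k A) (Q : PSh k B) (X : C) :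
    DaySum T P Q X →ₗ[k] Day T P Q X :=
  (dayRel T P Q X).mkQ

/-- The class of `f ⊗ p ⊗ q` in the coend. -/
def mk {H : A} {K : B} (f : X ⟶ (T.obj H).obj K) (p : P.val H) (q : Q.val K) : Day T P Q X :=
  proj T P Q X (DaySum.pure H K f p q)

lemma mk_add_left {H : A} {K : B} (f f' : X ⟶ (T.obj H).obj K) (p : P.val H) (q : Q.val K) :
    mk (f + f') p q = mk f p q + mk f' p q := by
  simp [mk, DaySum.pure, TensorProduct.add_tmul]

lemma mk_smul_left {H : A} {K : B} (c : k) (f : X ⟶ (T.obj H).obj K) (p : P.val H)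
    (q : Q.val K) : mk (c • f) p q = c • mk f p q := by
  simp [mk, DaySum.pure, ← TensorProduct.smul_tmul']

lemma mk_add_mid {H : A} {K : B} (f : X ⟶ (T.obj H).obj K) (p p' : P.val H) (q : Q.val K) :
    mk f (p + p') q = mk f p q + mk f p' q := by
  simp [mk, DaySum.pure, TensorProduct.add_tmul, TensorProduct.tmul_add]

lemma mk_smul_mid {H : A} {K : B} (c : k) (f : X ⟶ (T.obj H).obj K) (p : P.val H)
    (q : Q.val K) : mk f (c • p) q = c • mk f p q := by
  simp [mk, DaySum.pure, ← TensorProduct.smul_tmul']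

lemma mk_add_right {H : A} {K : B} (f : X ⟶ (T.obj H).obj K) (p : P.val H) (q q' : Q.val K) :
    mk f p (q + q') = mk f p q + mk f p q' := by
  simp [mk, DaySum.pure, TensorProduct.tmul_add]

lemma mk_smul_right {H : A} {K : B} (c : k) (f : X ⟶ (T.obj H).obj K) (p : P.val H)
    (q : Q.val K) : mk f p (c • q) = c • mk f p q := by
  simp [mk, DaySum.pure]

lemma mk_comp {H H' : A} {K K' : B} (h : H ⟶ H') (l : K ⟶ K') (f : X ⟶ (T.obj H).obj K)
    (p : P.val H') (q : Q.val K') :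
    mk (f ≫ (T.map h).app K ≫ (T.obj H').map l) p q = mk f (P.res h p) (Q.res l q) := by
  rw [← sub_eq_zero]
  rw [mk, mk, ← map_sub]
  exact (Submodule.Quotient.mk_eq_zero _).2
    (Submodule.subset_span ⟨H, H', K, K', h, l, f, p, q, rfl⟩)

lemma mk_comp_left {H H' : A} {K : B} (h : H ⟶ H') (f : X ⟶ (T.obj H).obj K)
    (p : P.val H') (q : Q.val K) :
    mk (f ≫ (T.map h).app K) p q = mk f (P.res h p) q := by
  simpa using mk_comp h (𝟙 K) f p q

lemma mk_comp_right {H : A} {K K' : B} (l : K ⟶ K') (f : X ⟶ (T.obj H).obj K)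
    (p : P.val H) (q : Q.val K') :
    mk (f ≫ (T.obj H).map l) p q = mk f p (Q.res l q) := by
  simpa using mk_comp (𝟙 H) l f p q

lemma linear_ext {V : Type v₁} [AddCommGroup V] [Module k V] {a b : Day T P Q X →ₗ[k] V}
    (h : ∀ (H : A) (K : B) (f : X ⟶ (T.obj H).obj K) (p : P.val H) (q : Q.val K),
      a (mk f p q) = b (mk f p q)) : a = b := by
  refine Submodule.linearMap_qext _ (DaySum.ext fun H K => ?_)
  refine LinearMap.congr_fun (f := (a.comp (proj T P Q X)).comp (DaySum.incl H K))
    (g := (b.comp (proj T P Q X)).comp (DaySum.incl H K)) ?_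
  exact TensorProduct.ext_threefold (h H K)

/-- The linear map out of the direct sum induced by a trilinear family. -/
def liftAux {V : Type v₁} [AddCommGroup V] [Module k V]
    (t : ∀ (H : A) (K : B), (X ⟶ (T.obj H).obj K) → P.val H → Q.val K → V)
    (h1 : ∀ H K f f' p q, t H K (f + f') p q = t H K f p q + t H K f' p q)
    (h2 : ∀ H K (c : k) f p q, t H K (c • f) p q = c • t H K f p q)
    (h3 : ∀ H K f p p' q, t H K f (p + p') q = t H K f p q + t H K f p' q)
    (h4 : ∀ H K (c : k) f p q, t H K f (c • p) q = c • t H K f p q)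
    (h5 : ∀ H K f p q q', t H K f p (q + q') = t H K f p q + t H K f p q')
    (h6 : ∀ H K (c : k) f p q, t H K f p (c • q) = c • t H K f p q) :
    DaySum T P Q X →ₗ[k] V :=
  DaySum.desc fun H K =>
    TensorProduct.lift (TensorProduct.lift
      (LinearMap.mk₂ k
        (fun f p =>
          ({ toFun := t H K f p
             map_add' := h5 _ _ _ _
             map_smul' := fun c q => h6 _ _ c _ _ q } : Q.val K →ₗ[k] V))
        (fun f f' p => LinearMap.ext fun q => h1 _ _ f f' p q)
        (fun c f p => LinearMap.ext fun q => h2 _ _ c f p q)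
        (fun f p p' => LinearMap.ext fun q => h3 _ _ f p p' q)
        (fun c f p => LinearMap.ext fun q => h4 _ _ c f p q)))

@[simp] lemma liftAux_pure {V : Type v₁} [AddCommGroup V] [Module k V]
    (t : ∀ (H : A) (K : B), (X ⟶ (T.obj H).obj K) → P.val H → Q.val K → V)
    (h1 h2 h3 h4 h5 h6) (H : A) (K : B) (f : X ⟶ (T.obj H).obj K) (p : P.val H)
    (q : Q.val K) : liftAux (k := k) t h1 h2 h3 h4 h5 h6 (DaySum.pure H K f p q) = t H K f p q := by
  simp [liftAux, DaySum.pure]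

/-- The linear map out of the coend induced by a dinatural trilinear family. -/
def lift {V : Type v₁} [AddCommGroup V] [Module k V]
    (t : ∀ (H : A) (K : B), (X ⟶ (T.obj H).obj K) → P.val H → Q.val K → V)
    (h1 : ∀ H K f f' p q, t H K (f + f') p q = t H K f p q + t H K f' p q)
    (h2 : ∀ H K (c : k) f p q, t H K (c • f) p q = c • t H K f p q)
    (h3 : ∀ H K f p p' q, t H K f (p + p') q = t H K f p q + t H K f p' q)
    (h4 : ∀ H K (c : k) f p q, t H K f (c • p) q = c • t H K f p q)
    (h5 : ∀ H K f p q q', t H K f p (q + q') = t H K f p q + t H K f p q')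
    (h6 : ∀ H K (c : k) f p q, t H K f p (c • q) = c • t H K f p q)
    (h7 : ∀ (H H' : A) (K K' : B) (h : H ⟶ H') (l : K ⟶ K') (f : X ⟶ (T.obj H).obj K)
      (p : P.val H') (q : Q.val K'), t H' K' (f ≫ (T.map h).app K ≫ (T.obj H').map l) p q =
        t H K f (P.res h p) (Q.res l q)) : Day T P Q X →ₗ[k] V :=
  (dayRel T P Q X).liftQ (liftAux t h1 h2 h3 h4 h5 h6)
    (by
      refine Submodule.span_le.2 ?_
      rintro _ ⟨H, H', K, K', h, l, f, p, q, rfl⟩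
      simp [← h7])

@[simp] lemma lift_mk {V : Type v₁} [AddCommGroup V] [Module k V]
    (t : ∀ (H : A) (K : B), (X ⟶ (T.obj H).obj K) → P.val H → Q.val K → V)
    (h1 h2 h3 h4 h5 h6 h7) (H : A) (K : B) (f : X ⟶ (T.obj H).obj K) (p : P.val H)
    (q : Q.val K) : lift (k := k) t h1 h2 h3 h4 h5 h6 h7 (mk f p q) = t H K f p q :=
  liftAux_pure (k := k) t h1 h2 h3 h4 h5 h6 H K f p q

/-- Restriction along `g : Y ⟶ X` on the coend, given by precomposition. -/
def restrict {Y : C} (g : Y ⟶ X) : Day T P Q X →ₗ[k] Day T P Q Y :=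
  lift (fun H K f p q => mk (g ≫ f) p q)
    (by simp [mk_add_left]) (by simp [mk_smul_left])
    (by simp [mk_add_mid]) (by simp [mk_smul_mid])
    (by simp [mk_add_right]) (by simp [mk_smul_right])
    (by intros; rw [← mk_comp]; simp)

@[simp] lemma restrict_mk {Y : C} (g : Y ⟶ X) {H : A} {K : B} (f : X ⟶ (T.obj H).obj K)
    (p : P.val H) (q : Q.val K) : restrict g (mk f p q) = mk (g ≫ f) p q := by
  simp [restrict]

lemma restrict_id (x : Day T P Q X) : restrict (𝟙 X) x = x :=
  LinearMap.congr_fun (f := restrict (𝟙 X)) (g := LinearMap.id) (linear_ext (by simp)) x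

lemma restrict_comp {Y Z : C} (f : Z ⟶ Y) (g : Y ⟶ X) (x : Day T P Q X) :
    restrict (f ≫ g) x = restrict f (restrict g x) :=
  LinearMap.congr_fun (f := restrict (f ≫ g)) (g := (restrict f).comp (restrict g))
    (linear_ext (by simp)) x

lemma restrict_add {Y : C} (f g : Y ⟶ X) (x : Day T P Q X) :
    restrict (f + g) x = restrict f x + restrict g x :=
  LinearMap.congr_fun (f := restrict (f + g)) (g := restrict f + restrict g)
    (linear_ext (by simp [mk_add_left])) x

lemma restrict_smul {Y : C} (c : k) (f : Y ⟶ X) (x : Day T P Q X) :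
    restrict (c • f) x = c • restrict f x :=
  LinearMap.congr_fun (f := restrict (c • f)) (g := c • restrict f)
    (linear_ext (by simp [mk_smul_left])) x

end Day

/-- The convolution of `P` and `Q` along `T`: the presheaf
`X ↦ ∫^{H,K} Hom(X, T(H, K)) ⊗ P(H) ⊗ Q(K)`. -/
def dayObj (T : A ⥤ B ⥤ C) (P : PSh k A) (Q : PSh k B) : PSh k C :=
  PSh.mk' (fun X => Day T P Q X) (fun g => Day.restrict g) (fun _ => Day.restrict_id)
    Day.restrict_comp Day.restrict_add Day.restrict_smul

namespace Day

variable {T : A ⥤ B ⥤ C} {P : PSh k A} {Q : PSh k B} {X : C}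

/-- The class of `f ⊗ p ⊗ q` as an element of the convolution. -/
def el {H : A} {K : B} (f : X ⟶ (T.obj H).obj K) (p : P.val H) (q : Q.val K) :
    (dayObj T P Q).val X :=
  (mk f p q : Day T P Q X)

lemma el_add_left {H : A} {K : B} (f f' : X ⟶ (T.obj H).obj K) (p : P.val H) (q : Q.val K) :
    el (f + f') p q = el f p q + el f' p q := mk_add_left f f' p q

lemma el_smul_left {H : A} {K : B} (c : k) (f : X ⟶ (T.obj H).obj K) (p : P.val H)
    (q : Q.val K) : el (c • f) p q = c • el f p q := mk_smul_left c f p q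

lemma el_add_mid {H : A} {K : B} (f : X ⟶ (T.obj H).obj K) (p p' : P.val H) (q : Q.val K) :
    el f (p + p') q = el f p q + el f p' q := mk_add_mid f p p' q

lemma el_smul_mid {H : A} {K : B} (c : k) (f : X ⟶ (T.obj H).obj K) (p : P.val H)
    (q : Q.val K) : el f (c • p) q = c • el f p q := mk_smul_mid c f p q

lemma el_add_right {H : A} {K : B} (f : X ⟶ (T.obj H).obj K) (p : P.val H) (q q' : Q.val K) :
    el f p (q + q') = el f p q + el f p q' := mk_add_right f p q q'

lemma el_smul_right {H : A} {K : B} (c : k) (f : X ⟶ (T.obj H).obj K) (p : P.val H)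
    (q : Q.val K) : el f p (c • q) = c • el f p q := mk_smul_right c f p q

lemma el_comp_left {H H' : A} {K : B} (h : H ⟶ H') (f : X ⟶ (T.obj H).obj K)
    (p : P.val H') (q : Q.val K) :
    el (f ≫ (T.map h).app K) p q = el f (P.res h p) q := mk_comp_left h f p q

lemma el_comp_right {H : A} {K K' : B} (l : K ⟶ K') (f : X ⟶ (T.obj H).obj K)
    (p : P.val H) (q : Q.val K') :
    el (f ≫ (T.obj H).map l) p q = el f p (Q.res l q) := mk_comp_right l f p q

@[simp] lemma res_el {Y : C} (g : Y ⟶ X) {H : A} {K : B} (f : X ⟶ (T.obj H).obj K)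
    (p : P.val H) (q : Q.val K) : (dayObj T P Q).res g (el f p q) = el (g ≫ f) p q :=
  restrict_mk g f p q

lemma el_comp {H H' : A} {K K' : B} (h : H ⟶ H') (l : K ⟶ K') (f : X ⟶ (T.obj H).obj K)
    (p : P.val H') (q : Q.val K') :
    el (f ≫ (T.map h).app K ≫ (T.obj H').map l) p q = el f (P.res h p) (Q.res l q) :=
  mk_comp h l f p q

lemma el_id_left {H H' : A} {K : B} (h : H ⟶ H') (p : P.val H') (q : Q.val K) :
    el (𝟙 ((T.obj H).obj K)) (P.res h p) q =
      (dayObj T P Q).res ((T.map h).app K) (el (𝟙 _) p q) := by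
  rw [← el_comp_left, res_el]; simp

lemma el_id_right {H : A} {K K' : B} (l : K ⟶ K') (p : P.val H) (q : Q.val K') :
    el (𝟙 ((T.obj H).obj K)) p (Q.res l q) =
      (dayObj T P Q).res ((T.obj H).map l) (el (𝟙 _) p q) := by
  rw [← el_comp_right, res_el]; simp

/-- `el f p q` is linear in `p`. -/
def elMid (P : PSh k A) {H : A} {K : B} (f : X ⟶ (T.obj H).obj K) (q : Q.val K) :
    P.val H →ₗ[k] (dayObj T P Q).val X where
  toFun p := el f p q
  map_add' p p' := el_add_mid f p p' q
  map_smul' c p := el_smul_mid c f p q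

/-- `el f p q` is linear in `q`. -/
def elRight (Q : PSh k B) {H : A} {K : B} (f : X ⟶ (T.obj H).obj K) (p : P.val H) :
    Q.val K →ₗ[k] (dayObj T P Q).val X where
  toFun q := el f p q
  map_add' q q' := el_add_right f p q q'
  map_smul' c q := el_smul_right c f p q

@[simp] lemma elMid_apply {H : A} {K : B} (f : X ⟶ (T.obj H).obj K) (p : P.val H)
    (q : Q.val K) : elMid P f q p = el f p q := rfl

@[simp] lemma elRight_apply {H : A} {K : B} (f : X ⟶ (T.obj H).obj K) (p : P.val H)
    (q : Q.val K) : elRight Q f p q = el f p q := rfl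

lemma el_ext {V : Type v₁} [AddCommGroup V] [Module k V]
    {a b : (dayObj T P Q).val X →ₗ[k] V}
    (h : ∀ (H : A) (K : B) (f : X ⟶ (T.obj H).obj K) (p : P.val H) (q : Q.val K),
      a (el f p q) = b (el f p q)) : a = b :=
  linear_ext h

/-- Morphisms out of a convolution agree as soon as they agree on the universal elements. -/
lemma hom_ext {R : PSh k C} {φ ψ : dayObj T P Q ⟶ R}
    (h : ∀ (H : A) (K : B) (p : P.val H) (q : Q.val K),
      PSh.app φ _ (el (𝟙 _) p q) = PSh.app ψ _ (el (𝟙 _) p q)) : φ = ψ := by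
  refine PSh.hom_ext fun X => LinearMap.congr_fun (el_ext fun H K f p q => ?_)
  have e : el (T := T) f p q = (dayObj T P Q).res f (el (𝟙 _) p q) := by simp
  rw [e, PSh.app_res, PSh.app_res, h]

/-- The components of the morphism `desc` below. -/
def descApp {R : PSh k C} (t : ∀ (H : A) (K : B), P.val H → Q.val K → R.val ((T.obj H).obj K))
    (h3 : ∀ H K p p' q, t H K (p + p') q = t H K p q + t H K p' q)
    (h4 : ∀ H K (c : k) p q, t H K (c • p) q = c • t H K p q)
    (h5 : ∀ H K p q q', t H K p (q + q') = t H K p q + t H K p q')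
    (h6 : ∀ H K (c : k) p q, t H K p (c • q) = c • t H K p q)
    (h7 : ∀ (H H' : A) (K K' : B) (h : H ⟶ H') (l : K ⟶ K') (p : P.val H') (q : Q.val K'),
      R.res ((T.map h).app K ≫ (T.obj H').map l) (t H' K' p q) =
        t H K (P.res h p) (Q.res l q)) (X : C) : (dayObj T P Q).val X →ₗ[k] R.val X :=
  lift (fun H K f p q => R.res f (t H K p q))
    (by simp [PSh.res_add]) (by simp [PSh.res_smul])
    (by simp [h3]) (by simp [h4]) (by simp [h5]) (by simp [h6])
    (by intros; rw [PSh.res_comp, h7])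

@[simp] lemma descApp_el {R : PSh k C}
    (t : ∀ (H : A) (K : B), P.val H → Q.val K → R.val ((T.obj H).obj K)) (h3 h4 h5 h6 h7)
    (H : A) (K : B) (f : X ⟶ (T.obj H).obj K) (p : P.val H) (q : Q.val K) :
    descApp (R := R) t h3 h4 h5 h6 h7 X (el f p q) = R.res f (t H K p q) :=
  lift_mk (k := k) ..

/-- The morphism out of a convolution induced by a natural bilinear family
`P(H) × Q(K) → R(T(H, K))`. -/
def desc {R : PSh k C} (t : ∀ (H : A) (K : B), P.val H → Q.val K → R.val ((T.obj H).obj K))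
    (h3 : ∀ H K p p' q, t H K (p + p') q = t H K p q + t H K p' q)
    (h4 : ∀ H K (c : k) p q, t H K (c • p) q = c • t H K p q)
    (h5 : ∀ H K p q q', t H K p (q + q') = t H K p q + t H K p q')
    (h6 : ∀ H K (c : k) p q, t H K p (c • q) = c • t H K p q)
    (h7 : ∀ (H H' : A) (K K' : B) (h : H ⟶ H') (l : K ⟶ K') (p : P.val H') (q : Q.val K'),
      R.res ((T.map h).app K ≫ (T.obj H').map l) (t H' K' p q) =
        t H K (P.res h p) (Q.res l q)) : dayObj T P Q ⟶ R :=
  PSh.homMk' (descApp t h3 h4 h5 h6 h7) fun {X Y} g =>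
    LinearMap.congr_fun (f := (descApp t h3 h4 h5 h6 h7 X).comp ((dayObj T P Q).res g))
      (g := (R.res g).comp (descApp t h3 h4 h5 h6 h7 Y))
      (el_ext fun H K f p q => by simp [PSh.res_comp])

@[simp] lemma desc_el {R : PSh k C}
    (t : ∀ (H : A) (K : B), P.val H → Q.val K → R.val ((T.obj H).obj K)) (h3 h4 h5 h6 h7)
    (H : A) (K : B) (f : X ⟶ (T.obj H).obj K) (p : P.val H) (q : Q.val K) :
    PSh.app (desc (R := R) t h3 h4 h5 h6 h7) X (el f p q) = R.res f (t H K p q) :=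
  descApp_el t h3 h4 h5 h6 h7 H K f p q

/-- Functoriality of the convolution. -/
def map {P P' : PSh k A} {Q Q' : PSh k B} (T : A ⥤ B ⥤ C) (φ : P ⟶ P') (ψ : Q ⟶ Q') :
    dayObj T P Q ⟶ dayObj T P' Q' :=
  desc (fun H K p q => el (𝟙 _) (PSh.app φ H p) (PSh.app ψ K q))
    (by simp [el_add_mid]) (by simp [el_smul_mid]) (by simp [el_add_right])
    (by simp [el_smul_right])
    (by
      intro H H' K K' h l p q
      rw [res_el, Category.comp_id, PSh.app_res, PSh.app_res, ← el_comp, Category.id_comp])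

@[simp] lemma map_el {P P' : PSh k A} {Q Q' : PSh k B} (φ : P ⟶ P') (ψ : Q ⟶ Q') {H : A} {K : B}
    (f : X ⟶ (T.obj H).obj K) (p : P.val H) (q : Q.val K) :
    PSh.app (map T φ ψ) X (el f p q) = el f (PSh.app φ H p) (PSh.app ψ K q) := by
  simp [map]

lemma map_add_left {P P' : PSh k A} {Q Q' : PSh k B} (φ φ' : P ⟶ P') (ψ : Q ⟶ Q') :
    map T (φ + φ') ψ = map T φ ψ + map T φ' ψ := hom_ext (by simp [el_add_mid])

lemma map_smul_left {P P' : PSh k A} {Q Q' : PSh k B} (c : k) (φ : P ⟶ P') (ψ : Q ⟶ Q') :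
    map T (c • φ) ψ = c • map T φ ψ := hom_ext (by simp [el_smul_mid])

lemma map_add_right {P P' : PSh k A} {Q Q' : PSh k B} (φ : P ⟶ P') (ψ ψ' : Q ⟶ Q') :
    map T φ (ψ + ψ') = map T φ ψ + map T φ ψ' := hom_ext (by simp [el_add_right])

lemma map_smul_right {P P' : PSh k A} {Q Q' : PSh k B} (c : k) (φ : P ⟶ P') (ψ : Q ⟶ Q') :
    map T φ (c • ψ) = c • map T φ ψ := hom_ext (by simp [el_smul_right])

end Day

/-- The convolution bifunctor `[Aᵒᵖ, Vec] × [Bᵒᵖ, Vec] ⥤ [Cᵒᵖ, Vec]` extending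
`T : A × B ⥤ C`. -/
def dayExt (T : A ⥤ B ⥤ C) : PSh k A ⥤ PSh k B ⥤ PSh k C where
  obj P :=
    { obj := fun Q => dayObj T P Q
      map := fun ψ => Day.map T (𝟙 P) ψ
      map_id := fun Q => Day.hom_ext (by simp)
      map_comp := fun ψ ψ' => Day.hom_ext (by simp) }
  map φ :=
    { app := fun Q => Day.map T φ (𝟙 Q)
      naturality := fun Q Q' ψ => Day.hom_ext (by simp) }
  map_id P := by ext Q : 2; exact Day.hom_ext (by simp)
  map_comp φ φ' := by ext Q : 2; exact Day.hom_ext (by simp)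

@[simp] lemma dayExt_obj_obj (T : A ⥤ B ⥤ C) (P : PSh k A) (Q : PSh k B) :
    ((dayExt T).obj P).obj Q = dayObj T P Q := rfl

@[simp] lemma dayExt_obj_map (T : A ⥤ B ⥤ C) (P : PSh k A) {Q Q' : PSh k B} (ψ : Q ⟶ Q') :
    ((dayExt T).obj P).map ψ = Day.map T (𝟙 P) ψ := rfl

@[simp] lemma dayExt_map_app (T : A ⥤ B ⥤ C) {P P' : PSh k A} (φ : P ⟶ P') (Q : PSh k B) :
    ((dayExt T).map φ).app Q = Day.map T φ (𝟙 Q) := rfl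

lemma dayExt_bilinear (T : A ⥤ B ⥤ C) : IsBilinear k (dayExt (k := k) T) where
  add_left f g Q := Day.map_add_left f g (𝟙 Q)
  smul_left c f Q := Day.map_smul_left c f (𝟙 Q)
  add_right P _ _ f g := Day.map_add_right (𝟙 P) f g
  smul_right P _ _ c f := Day.map_smul_right c (𝟙 P) f

end Day

section Associator

variable {k : Type u} [Field k]
variable {A B C D E G : Type u} [SmallCategory A] [SmallCategory B] [SmallCategory C]
  [SmallCategory D] [SmallCategory E] [SmallCategory G]
  [Preadditive A] [Preadditive B] [Preadditive C] [Preadditive D] [Preadditive E] [Preadditive G]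
  [Linear k A] [Linear k B] [Linear k C] [Linear k D] [Linear k E] [Linear k G]

namespace Day

/-- Morphisms out of a left-nested convolution agree if they agree on universal elements. -/
lemma hom_ext_left {T₁ : A ⥤ B ⥤ D} {T₂ : D ⥤ C ⥤ E} {P : PSh k A} {Q : PSh k B}
    {R : PSh k C} {W : PSh k E} {φ ψ : dayObj T₂ (dayObj T₁ P Q) R ⟶ W}
    (h : ∀ (H : A) (K : B) (Z : C) (p : P.val H) (q : Q.val K) (r : R.val Z),
      PSh.app φ _ (el (𝟙 _) (el (𝟙 _) p q) r) = PSh.app ψ _ (el (𝟙 _) (el (𝟙 _) p q) r)) :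
    φ = ψ := by
  refine hom_ext fun X Z a r => ?_
  refine LinearMap.congr_fun (f := (PSh.app φ _).comp (elMid _ (𝟙 _) r))
    (g := (PSh.app ψ _).comp (elMid _ (𝟙 _) r)) (el_ext fun H K g p q => ?_) a
  have e : el (T := T₁) g p q = (dayObj T₁ P Q).res g (el (𝟙 _) p q) := by simp
  have e' : el (T := T₂) (𝟙 ((T₂.obj X).obj Z)) (el (T := T₁) g p q) r =
      (dayObj T₂ _ R).res ((T₂.map g).app Z) (el (𝟙 _) (el (𝟙 _) p q) r) := by
    rw [e, ← el_comp_left]; simp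
  simp only [LinearMap.comp_apply, elMid_apply]
  rw [e', PSh.app_res, PSh.app_res, h]

/-- Morphisms out of a right-nested convolution agree if they agree on universal elements. -/
lemma hom_ext_right {T₃ : B ⥤ C ⥤ G} {T₄ : A ⥤ G ⥤ E} {P : PSh k A} {Q : PSh k B}
    {R : PSh k C} {W : PSh k E} {φ ψ : dayObj T₄ P (dayObj T₃ Q R) ⟶ W}
    (h : ∀ (H : A) (K : B) (Z : C) (p : P.val H) (q : Q.val K) (r : R.val Z),
      PSh.app φ _ (el (𝟙 _) p (el (𝟙 _) q r)) = PSh.app ψ _ (el (𝟙 _) p (el (𝟙 _) q r))) :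
    φ = ψ := by
  refine hom_ext fun H Y p b => ?_
  refine LinearMap.congr_fun (f := (PSh.app φ _).comp (elRight _ (𝟙 _) p))
    (g := (PSh.app ψ _).comp (elRight _ (𝟙 _) p)) (el_ext fun K Z g q r => ?_) b
  have e : el (T := T₃) g q r = (dayObj T₃ Q R).res g (el (𝟙 _) q r) := by simp
  have e' : el (T := T₄) (𝟙 ((T₄.obj H).obj Y)) p (el (T := T₃) g q r) =
      (dayObj T₄ P _).res ((T₄.obj H).map g) (el (𝟙 _) p (el (𝟙 _) q r)) := by
    rw [e, ← el_comp_right]; simp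
  simp only [LinearMap.comp_apply, elRight_apply]
  rw [e', PSh.app_res, PSh.app_res, h]

end Day

variable {S M : Type u} [SmallCategory S] [SmallCategory M] [Preadditive S] [Preadditive M]
  [Linear k S] [Linear k M] {σ : SemigroupStr k S} (μ : ModuleStr σ M)

namespace ModuleStr

open Day

variable (P Q : PSh k S) (R : PSh k M)

lemma assoc_nat_left_assoc {G G' : S} (f : G ⟶ G') (H : S) (X : M) {Z : M}
    (h : (μ.act.obj G').obj ((μ.act.obj H).obj X) ⟶ Z) :
    (μ.act.map ((σ.tensor.map f).app H)).app X ≫ (μ.assoc G' H X).hom ≫ h =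
      (μ.assoc G H X).hom ≫ (μ.act.map f).app ((μ.act.obj H).obj X) ≫ h := by
  rw [reassoc_of% (μ.assoc_nat_left f H X)]

lemma assoc_nat_mid_assoc (G : S) {H H' : S} (f : H ⟶ H') (X : M) {Z : M}
    (h : (μ.act.obj G).obj ((μ.act.obj H').obj X) ⟶ Z) :
    (μ.act.map ((σ.tensor.obj G).map f)).app X ≫ (μ.assoc G H' X).hom ≫ h =
      (μ.assoc G H X).hom ≫ (μ.act.obj G).map ((μ.act.map f).app X) ≫ h := by
  rw [reassoc_of% (μ.assoc_nat_mid G f X)]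

/-- An auxiliary map for `assocHom`. -/
def assocHomAux (X : S) (Z : M) (r : R.val Z) : (dayObj σ.tensor P Q).val X →ₗ[k]
    (dayObj μ.act P (dayObj μ.act Q R)).val ((μ.act.obj X).obj Z) :=
  lift (fun H K g p q => el ((μ.act.map g).app Z ≫ (μ.assoc H K Z).hom) p (el (𝟙 _) q r))
    (by intros; simp [μ.bilinear.add_left, el_add_left])
    (by intros; simp [μ.bilinear.smul_left, el_smul_left])
    (by intros; simp [el_add_mid]) (by intros; simp [el_smul_mid])
    (by intros; simp [el_add_mid, el_add_right]) (by intros; simp [el_smul_mid, el_smul_right])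
    (by
      intro H H' K K' h l f p q
      rw [el_id_left l, ← el_comp_right, ← el_comp_left]
      simp [μ.assoc_nat_left_assoc, μ.assoc_nat_mid])

@[simp] lemma assocHomAux_el (X : S) (Z : M) (r : R.val Z) {H K : S}
    (g : X ⟶ (σ.tensor.obj H).obj K) (p : P.val H) (q : Q.val K) :
    μ.assocHomAux P Q R X Z r (el g p q) =
      el ((μ.act.map g).app Z ≫ (μ.assoc H K Z).hom) p (el (𝟙 _) q r) :=
  lift_mk (k := k) ..

/-- The map `(P ⊛ Q) ⋆ R ⟶ P ⋆ (Q ⋆ R)`. -/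
def assocHom : dayObj μ.act (dayObj σ.tensor P Q) R ⟶ dayObj μ.act P (dayObj μ.act Q R) :=
  desc (fun X Z a r => μ.assocHomAux P Q R X Z r a)
    (by simp) (by simp)
    (fun X Z a r r' => LinearMap.congr_fun (f := μ.assocHomAux P Q R X Z (r + r'))
      (g := μ.assocHomAux P Q R X Z r + μ.assocHomAux P Q R X Z r')
      (el_ext (by simp [el_add_right])) a)
    (fun X Z c a r => LinearMap.congr_fun (f := μ.assocHomAux P Q R X Z (c • r))
      (g := c • μ.assocHomAux P Q R X Z r) (el_ext (by simp [el_smul_right])) a)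
    (fun X X' Z Z' h l a r => LinearMap.congr_fun
      (f := (PSh.res _ _).comp (μ.assocHomAux P Q R X' Z' r))
      (g := (μ.assocHomAux P Q R X Z (R.res l r)).comp (PSh.res _ h))
      (el_ext (by
        intro H K g p q
        simp only [LinearMap.comp_apply, assocHomAux_el, res_el]
        rw [el_id_right l, ← el_comp_right]
        simp [μ.assoc_nat_right])) a)

@[simp] lemma assocHom_el (X : M) (D : S) (Z : M) (f : X ⟶ (μ.act.obj D).obj Z) {H K : S}
    (g : D ⟶ (σ.tensor.obj H).obj K) (p : P.val H) (q : Q.val K) (r : R.val Z) :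
    PSh.app (μ.assocHom P Q R) X (el f (el g p q) r) =
      el (f ≫ (μ.act.map g).app Z ≫ (μ.assoc H K Z).hom) p (el (𝟙 _) q r) := by
  simp [assocHom]

/-- An auxiliary map for `assocInv`. -/
def assocInvAux (H : S) (p : P.val H) (Y : M) : (dayObj μ.act Q R).val Y →ₗ[k]
    (dayObj μ.act (dayObj σ.tensor P Q) R).val ((μ.act.obj H).obj Y) :=
  lift (fun K Z g q r => el ((μ.act.obj H).map g ≫ (μ.assoc H K Z).inv) (el (𝟙 _) p q) r)
    (by intros; simp [μ.bilinear.add_right, el_add_left])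
    (by intros; simp [μ.bilinear.smul_right, el_smul_left])
    (by intros; simp [el_add_mid, el_add_right]) (by intros; simp [el_smul_mid, el_smul_right])
    (by intros; simp [el_add_right]) (by intros; simp [el_smul_right])
    (by
      intro K K' Z Z' h l f q r
      rw [el_id_right h, ← el_comp_left, ← el_comp_right]
      congr 1
      rw [← cancel_mono (μ.assoc H K' Z').hom]
      simp [μ.assoc_nat_mid_assoc, μ.assoc_nat_right])

@[simp] lemma assocInvAux_el (H : S) (p : P.val H) (Y : M) {K : S} {Z : M}
    (g : Y ⟶ (μ.act.obj K).obj Z) (q : Q.val K) (r : R.val Z) :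
    μ.assocInvAux P Q R H p Y (el g q r) =
      el ((μ.act.obj H).map g ≫ (μ.assoc H K Z).inv) (el (𝟙 _) p q) r :=
  lift_mk (k := k) ..

/-- The map `P ⋆ (Q ⋆ R) ⟶ (P ⊛ Q) ⋆ R`. -/
def assocInv : dayObj μ.act P (dayObj μ.act Q R) ⟶ dayObj μ.act (dayObj σ.tensor P Q) R :=
  desc (fun H Y p b => μ.assocInvAux P Q R H p Y b)
    (fun H Y p p' b => LinearMap.congr_fun (f := μ.assocInvAux P Q R H (p + p') Y)
      (g := μ.assocInvAux P Q R H p Y + μ.assocInvAux P Q R H p' Y)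
      (el_ext (by simp [el_add_mid])) b)
    (fun H Y c p b => LinearMap.congr_fun (f := μ.assocInvAux P Q R H (c • p) Y)
      (g := c • μ.assocInvAux P Q R H p Y) (el_ext (by simp [el_smul_mid])) b)
    (by simp) (by simp)
    (fun H H' Y Y' h l p b => LinearMap.congr_fun
      (f := (PSh.res _ _).comp (μ.assocInvAux P Q R H' p Y'))
      (g := (μ.assocInvAux P Q R H (P.res h p) Y).comp (PSh.res _ l))
      (el_ext (by
        intro K Z g q r
        simp only [LinearMap.comp_apply, assocInvAux_el, res_el]
        rw [el_id_left h, ← el_comp_left]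
        congr 1
        rw [← cancel_mono (μ.assoc H' K Z).hom]
        simp [μ.assoc_nat_left])) b)

@[simp] lemma assocInv_el (X : M) (H : S) (Y : M) (f : X ⟶ (μ.act.obj H).obj Y) {K : S} {Z : M}
    (g : Y ⟶ (μ.act.obj K).obj Z) (p : P.val H) (q : Q.val K) (r : R.val Z) :
    PSh.app (μ.assocInv P Q R) X (el f p (el g q r)) =
      el (f ≫ (μ.act.obj H).map g ≫ (μ.assoc H K Z).inv) (el (𝟙 _) p q) r := by
  simp [assocInv]

/-- The associativity isomorphism `(P ⊛ Q) ⋆ R ≅ P ⋆ (Q ⋆ R)` of convolution. -/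
def dayAssoc : dayObj μ.act (dayObj σ.tensor P Q) R ≅ dayObj μ.act P (dayObj μ.act Q R) where
  hom := μ.assocHom P Q R
  inv := μ.assocInv P Q R
  hom_inv_id := hom_ext_left (by simp)
  inv_hom_id := hom_ext_right (by simp)

@[simp] lemma dayAssoc_hom : (μ.dayAssoc P Q R).hom = μ.assocHom P Q R := rfl

end ModuleStr

namespace Day

/-- Morphisms out of a four-fold left-nested convolution agree if they agree on universal
elements. -/
lemma hom_ext_left_left {A₁ A₂ A₃ A₄ C₁ C₂ C₃ : Type u} [SmallCategory A₁] [SmallCategory A₂]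
    [SmallCategory A₃] [SmallCategory A₄] [SmallCategory C₁] [SmallCategory C₂] [SmallCategory C₃]
    [Preadditive A₁] [Preadditive A₂] [Preadditive A₃] [Preadditive A₄] [Preadditive C₁]
    [Preadditive C₂] [Preadditive C₃] [Linear k A₁] [Linear k A₂] [Linear k A₃] [Linear k A₄]
    [Linear k C₁] [Linear k C₂] [Linear k C₃]
    {T₁ : A₁ ⥤ A₂ ⥤ C₁} {T₂ : C₁ ⥤ A₃ ⥤ C₂} {T₃ : C₂ ⥤ A₄ ⥤ C₃}
    {P : PSh k A₁} {Q : PSh k A₂} {R : PSh k A₃} {N : PSh k A₄} {W : PSh k C₃}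
    {φ ψ : dayObj T₃ (dayObj T₂ (dayObj T₁ P Q) R) N ⟶ W}
    (h : ∀ (H : A₁) (K : A₂) (L : A₃) (Z : A₄) (p : P.val H) (q : Q.val K) (r : R.val L)
      (n : N.val Z),
      PSh.app φ _ (el (𝟙 _) (el (𝟙 _) (el (𝟙 _) p q) r) n) =
        PSh.app ψ _ (el (𝟙 _) (el (𝟙 _) (el (𝟙 _) p q) r) n)) : φ = ψ := by
  refine hom_ext_left fun X L Z a r n => ?_
  refine LinearMap.congr_fun
    (f := ((PSh.app φ _).comp (elMid _ (𝟙 _) n)).comp (elMid _ (𝟙 _) r))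
    (g := ((PSh.app ψ _).comp (elMid _ (𝟙 _) n)).comp (elMid _ (𝟙 _) r))
    (el_ext fun H K g p q => ?_) a
  have e : el (T := T₁) g p q = (dayObj T₁ P Q).res g (el (𝟙 _) p q) := by simp
  simp only [LinearMap.comp_apply, elMid_apply]
  rw [e, el_id_left, el_id_left, PSh.app_res, PSh.app_res, h]

end Day

namespace ModuleStr

open Day

lemma dayAssoc_nat_left {P P' : PSh k S} (f : P ⟶ P') (Q : PSh k S) (R : PSh k M) :
    Day.map μ.act (Day.map σ.tensor f (𝟙 Q)) (𝟙 R) ≫ μ.assocHom P' Q R =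
      μ.assocHom P Q R ≫ Day.map μ.act f (𝟙 (dayObj μ.act Q R)) :=
  hom_ext_left (by simp)

lemma dayAssoc_nat_mid (P : PSh k S) {Q Q' : PSh k S} (f : Q ⟶ Q') (R : PSh k M) :
    Day.map μ.act (Day.map σ.tensor (𝟙 P) f) (𝟙 R) ≫ μ.assocHom P Q' R =
      μ.assocHom P Q R ≫ Day.map μ.act (𝟙 P) (Day.map μ.act f (𝟙 R)) :=
  hom_ext_left (by simp)

lemma dayAssoc_nat_right (P Q : PSh k S) {R R' : PSh k M} (f : R ⟶ R') :
    Day.map μ.act (𝟙 (dayObj σ.tensor P Q)) f ≫ μ.assocHom P Q R' =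
      μ.assocHom P Q R ≫ Day.map μ.act (𝟙 P) (Day.map μ.act (𝟙 Q) f) :=
  hom_ext_left (by simp)

lemma dayAssoc_pentagon (P Q R : PSh k S) (N : PSh k M) :
    Day.map μ.act (σ.regular.assocHom P Q R) (𝟙 N) ≫
        μ.assocHom P (dayObj σ.tensor Q R) N ≫ Day.map μ.act (𝟙 P) (μ.assocHom Q R N) =
      μ.assocHom (dayObj σ.tensor P Q) R N ≫ μ.assocHom P Q (dayObj μ.act R N) := by
  refine hom_ext_left_left fun H K L Z p q r n => ?_
  have e1 : PSh.app (σ.regular.assocHom P Q R) ((σ.tensor.obj ((σ.tensor.obj H).obj K)).obj L)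
      (el (T := σ.tensor) (𝟙 _) (el (T := σ.tensor) (𝟙 _) p q) r) =
        el (T := σ.tensor) (σ.assoc H K L).hom p (el (T := σ.tensor) (𝟙 _) q r) := by
    refine (σ.regular.assocHom_el P Q R _ _ L _ _ p q r).trans ?_
    refine congrArg (fun t => el (T := σ.tensor) t p (el (T := σ.tensor) (𝟙 _) q r)) ?_
    simp [SemigroupStr.regular]
  have e2 : PSh.app (Day.map μ.act (σ.regular.assocHom P Q R) (𝟙 N)) _
      (el (T := μ.act) (𝟙 ((μ.act.obj ((σ.tensor.obj ((σ.tensor.obj H).obj K)).obj L)).obj Z))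
        (el (T := σ.tensor) (𝟙 _) (el (T := σ.tensor) (𝟙 _) p q) r) n) =
      el (T := μ.act) (𝟙 _) (el (T := σ.tensor) (σ.assoc H K L).hom p
        (el (T := σ.tensor) (𝟙 _) q r)) n :=
    (map_el (T := μ.act) _ (𝟙 N) _ _ _).trans (congrArg (fun t => el (T := μ.act) (𝟙 _) t n) e1)
  refine (congrArg (fun t => PSh.app (Day.map μ.act (𝟙 P) (μ.assocHom Q R N)) _
    (PSh.app (μ.assocHom P (dayObj σ.tensor Q R) N) _ t)) e2).trans ?_
  have e3 : PSh.app (μ.assocHom (dayObj σ.tensor P Q) R N ≫ μ.assocHom P Q (dayObj μ.act R N)) _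
      (el (T := μ.act) (𝟙 ((μ.act.obj ((σ.tensor.obj ((σ.tensor.obj H).obj K)).obj L)).obj Z))
        (el (T := σ.tensor) (𝟙 _) (el (T := σ.tensor) (𝟙 _) p q) r) n) =
      el (T := μ.act) ((μ.assoc ((σ.tensor.obj H).obj K) L Z).hom ≫
        (μ.assoc H K ((μ.act.obj L).obj Z)).hom) p (el (𝟙 _) q (el (𝟙 _) r n)) := by
    simp
  refine Eq.trans ?_ e3.symm
  rw [← μ.pentagon, ← Category.assoc, el_comp_right]
  simp

end ModuleStr

open Day

/-- Day convolution on the category of presheaves on a semigroup category. -/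
def SemigroupStr.psh (σ : SemigroupStr k S) : SemigroupStr k (PSh k S) where
  tensor := dayExt σ.tensor
  bilinear := dayExt_bilinear σ.tensor
  assoc P Q R := σ.regular.dayAssoc P Q R
  assoc_nat_left f Y Z := σ.regular.dayAssoc_nat_left f Y Z
  assoc_nat_mid X _ _ f Z := σ.regular.dayAssoc_nat_mid X f Z
  assoc_nat_right X Y _ _ f := σ.regular.dayAssoc_nat_right X Y f
  pentagon W X Y Z := σ.regular.dayAssoc_pentagon W X Y Z

/-- The module category of presheaves on a module category, over the presheaves on the semigroup
category, with action `(P ⋆ R)(X) = ∫^{H,Y} Hom(X, H ⋆ Y) ⊗ P(H) ⊗ R(Y)`: the extension of the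
original action which is cocontinuous in both variables. -/
def ModuleStr.psh (μ : ModuleStr σ M) : ModuleStr σ.psh (PSh k M) where
  act := dayExt μ.act
  bilinear := dayExt_bilinear μ.act
  assoc P Q R := μ.dayAssoc P Q R
  assoc_nat_left f Y Z := μ.dayAssoc_nat_left f Y Z
  assoc_nat_mid X _ _ f Z := μ.dayAssoc_nat_mid X f Z
  assoc_nat_right X Y _ _ f := μ.dayAssoc_nat_right X Y f
  pentagon W X Y Z := μ.dayAssoc_pentagon W X Y Z

end Associator
section Adjunctions

variable {k : Type u} [Field k] {S : Type u₁} [Category.{v₁} S] [Preadditive S] [Linear k S]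

namespace SemigroupStr

/-- The object `X ⊠ Y`. -/
abbrev prod (σ : SemigroupStr k S) (X Y : S) : S := (σ.tensor.obj X).obj Y

/-- The morphism `X ⊠ f`. -/
abbrev wl (σ : SemigroupStr k S) (X : S) {Y Y' : S} (f : Y ⟶ Y') : σ.prod X Y ⟶ σ.prod X Y' :=
  (σ.tensor.obj X).map f

/-- The morphism `f ⊠ Y`. -/
abbrev wr (σ : SemigroupStr k S) {X X' : S} (f : X ⟶ X') (Y : S) : σ.prod X Y ⟶ σ.prod X' Y :=
  (σ.tensor.map f).app Y

end SemigroupStr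

/-- An adjunction `(F, G, ηˡ, ηʳ, εˡ, εʳ)` in a semigroup category, exhibiting `G` as the right
dual `F^⋄` of `F` (and `F` as the left dual of `G`). -/
structure DualPair (σ : SemigroupStr k S) (F G : S) where
  etaL : ∀ X : S, X ⟶ σ.prod X (σ.prod G F)
  epsL : ∀ X : S, σ.prod X (σ.prod F G) ⟶ X
  etaR : ∀ X : S, X ⟶ σ.prod (σ.prod G F) X
  epsR : ∀ X : S, σ.prod (σ.prod F G) X ⟶ X
  etaL_nat : ∀ {X Y : S} (f : X ⟶ Y), f ≫ etaL Y = etaL X ≫ σ.wr f (σ.prod G F)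
  epsL_nat : ∀ {X Y : S} (f : X ⟶ Y), σ.wr f (σ.prod F G) ≫ epsL Y = epsL X ≫ f
  etaR_nat : ∀ {X Y : S} (f : X ⟶ Y), f ≫ etaR Y = etaR X ≫ σ.wl (σ.prod G F) f
  epsR_nat : ∀ {X Y : S} (f : X ⟶ Y), σ.wl (σ.prod F G) f ≫ epsR Y = epsR X ≫ f
  /-- `ηˡ` is a transformation of left module functors. -/
  etaL_module : ∀ X Y : S,
    etaL (σ.prod X Y) ≫ (σ.assoc X Y (σ.prod G F)).hom = σ.wl X (etaL Y)
  /-- `εˡ` is a transformation of left module functors. -/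
  epsL_module : ∀ X Y : S,
    (σ.assoc X Y (σ.prod F G)).hom ≫ σ.wl X (epsL Y) = epsL (σ.prod X Y)
  /-- `ηʳ` is a transformation of right module functors. -/
  etaR_module : ∀ X Y : S,
    σ.wr (etaR X) Y ≫ (σ.assoc (σ.prod G F) X Y).hom = etaR (σ.prod X Y)
  /-- `εʳ` is a transformation of right module functors. -/
  epsR_module : ∀ X Y : S,
    (σ.assoc (σ.prod F G) X Y).hom ≫ epsR (σ.prod X Y) = σ.wr (epsR X) Y
  /-- First triangle identity for `(- ⊠ G) ⊣ (- ⊠ F)` with unit `ηˡ` and counit `εˡ`. -/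
  triangleL : ∀ X : S,
    σ.wr (etaL X) G ≫ σ.wr (σ.assoc X G F).inv G ≫ (σ.assoc (σ.prod X G) F G).hom ≫
      epsL (σ.prod X G) = 𝟙 (σ.prod X G)
  /-- Second triangle identity for `(- ⊠ G) ⊣ (- ⊠ F)`. -/
  triangleL' : ∀ X : S,
    etaL (σ.prod X F) ≫ (σ.assoc (σ.prod X F) G F).inv ≫ σ.wr (σ.assoc X F G).hom F ≫
      σ.wr (epsL X) F = 𝟙 (σ.prod X F)
  /-- First triangle identity for `(F ⊠ -) ⊣ (G ⊠ -)` with unit `ηʳ` and counit `εʳ`. -/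
  triangleR : ∀ X : S,
    σ.wl F (etaR X) ≫ σ.wl F (σ.assoc G F X).hom ≫ (σ.assoc F G (σ.prod F X)).inv ≫
      epsR (σ.prod F X) = 𝟙 (σ.prod F X)
  /-- Second triangle identity for `(F ⊠ -) ⊣ (G ⊠ -)`. -/
  triangleR' : ∀ X : S,
    etaR (σ.prod G X) ≫ (σ.assoc G F (σ.prod G X)).hom ≫ σ.wl G (σ.assoc F G X).inv ≫
      σ.wl G (epsR X) = 𝟙 (σ.prod G X)
  /-- The zigzag identity for `F`. -/
  zigzag : etaL F ≫ (σ.assoc F G F).inv ≫ epsR F = 𝟙 F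
  /-- The zigzag identity for `G`. -/
  zigzag' : etaR G ≫ (σ.assoc G F G).hom ≫ epsL G = 𝟙 G
  /-- Compatibility of `ηˡ` and `ηʳ`. -/
  eta_compat : ∀ H K : S,
    σ.wl H (etaR K) ≫ (σ.assoc H (σ.prod G F) K).inv = σ.wr (etaL H) K
  /-- Compatibility of `εˡ` and `εʳ`. -/
  eps_compat : ∀ H K : S,
    (σ.assoc H (σ.prod F G) K).hom ≫ σ.wl H (epsR K) = σ.wr (epsL H) K

/-- A semigroup category is rigid if every object has a right dual and a left dual. -/
def IsRigid (σ : SemigroupStr k S) : Prop :=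
  ∀ F : S, (∃ G, Nonempty (DualPair σ F G)) ∧ ∃ G, Nonempty (DualPair σ G F)

end Adjunctions

section Summands

/-- `Y` is a direct summand of a finite direct sum `X₁ ⊕ ⋯ ⊕ Xₙ` of objects satisfying `W`. This
is expressed by the components `Y ⟶ Xᵢ` and `Xᵢ ⟶ Y` of the split monomorphism and of its
retraction, so that the direct sum itself need not exist in `C`. -/
def IsSummandOfSum {C : Type u₁} [Category.{v₁} C] [Preadditive C] (W : ObjectProperty C)
    (Y : C) : Prop :=
  ∃ (n : ℕ) (X : Fin n → C) (f : ∀ i, Y ⟶ X i) (g : ∀ i, X i ⟶ Y),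
    (∀ i, W (X i)) ∧ ∑ i, f i ≫ g i = 𝟙 Y

/-- A functor is liberal if every object of the target is a direct summand of a finite direct sum
of objects of the form `T(X)`. -/
def IsLiberal {C : Type u₁} {D : Type u₂} [Category.{v₁} C] [Category.{v₂} D] [Preadditive D]
    (T : C ⥤ D) : Prop :=
  ∀ Y : D, IsSummandOfSum (fun Z => ∃ X : C, Z = T.obj X) Y

/-- A `k`-linear category is Cauchy complete if it has finite direct sums and split
idempotents. -/
def IsCauchyComplete (C : Type u₁) [Category.{v₁} C] [Preadditive C] : Prop :=
  Limits.HasFiniteBiproducts C ∧ IsIdempotentComplete C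

end Summands

section Modules

variable {k : Type u} [Field k] {S : Type u₁} [Category.{v₁} S] [Preadditive S] [Linear k S]
  {σ : SemigroupStr k S}
  {M : Type u₂} [Category.{v₂} M] [Preadditive M] [Linear k M]
  {N : Type u₃} [Category.{v₃} N] [Preadditive N] [Linear k N]
  {L : Type u₄} [Category.{v₄} L] [Preadditive L] [Linear k L]

/-- The condition `S ⋆ M = M`: every object of `M` is a direct summand of a finite direct sum of
objects of the form `H ⋆ Y`. -/
def ModuleStr.Spans (μ : ModuleStr σ M) : Prop :=
  ∀ X : M, IsSummandOfSum (fun Z => ∃ (H : S) (Y : M), Z = (μ.act.obj H).obj Y) X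

/-- An adjunction `(F, G, ηˡ, ηʳ, εˡ, εʳ)` is respected in the module category `M` if there is an
adjunction `(F ⋆ -) ⊣ (G ⋆ -)` with unit `η` and counit `ε` such that `H ⋆ η_X = ηˡ_H ⋆ X` and
`H ⋆ ε_X = εˡ_H ⋆ X` for all `H` and `X`, up to the module associators. -/
def DualPair.Respected {F G : S} (adj : DualPair σ F G) (μ : ModuleStr σ M) : Prop :=
  ∃ a : μ.act.obj F ⊣ μ.act.obj G, ∀ (H : S) (X : M),
    (μ.act.map (adj.etaL H)).app X ≫ (μ.assoc H (σ.prod G F) X).hom ≫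
        (μ.act.obj H).map (μ.assoc G F X).hom = (μ.act.obj H).map (a.unit.app X) ∧
    (μ.assoc H (σ.prod F G) X).hom ≫ (μ.act.obj H).map (μ.assoc F G X).hom ≫
        (μ.act.obj H).map (a.counit.app X) = (μ.act.map (adj.epsL H)).app X

/-- A unit object with unit isomorphisms satisfying the triangle axiom. A monoidal category is a
semigroup category with such a structure. -/
structure UnitStr (σ : SemigroupStr k S) where
  unit : S
  leftUnitor : σ.tensor.obj unit ≅ 𝟭 S
  rightUnitor : σ.tensor.flip.obj unit ≅ 𝟭 S
  triangle : ∀ X Y : S, (σ.assoc X unit Y).hom ≫ σ.wl X (leftUnitor.hom.app Y) =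
    σ.wr (rightUnitor.hom.app X) Y

/-- A module category over a monoidal category is monoidal if the unit object acts as the identity,
up to a natural isomorphism satisfying the triangle axiom. -/
def UnitStr.IsMonoidalModule (U : UnitStr σ) (μ : ModuleStr σ M) : Prop :=
  ∃ l : μ.act.obj U.unit ≅ 𝟭 M, ∀ (X : S) (Y : M),
    (μ.assoc X U.unit Y).hom ≫ (μ.act.obj X).map (l.hom.app Y) =
      (μ.act.map (U.rightUnitor.hom.app X)).app Y

/-- A (strong) module functor between module categories over a semigroup category. -/
structure ModuleFunctor (μ : ModuleStr σ M) (ν : ModuleStr σ N) where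
  toFunctor : M ⥤ N
  additive : toFunctor.Additive
  linear : toFunctor.Linear k
  iso : ∀ (G : S) (X : M),
    toFunctor.obj ((μ.act.obj G).obj X) ≅ (ν.act.obj G).obj (toFunctor.obj X)
  nat_left : ∀ {G G' : S} (f : G ⟶ G') (X : M),
    toFunctor.map ((μ.act.map f).app X) ≫ (iso G' X).hom =
      (iso G X).hom ≫ (ν.act.map f).app (toFunctor.obj X)
  nat_right : ∀ (G : S) {X X' : M} (f : X ⟶ X'),
    toFunctor.map ((μ.act.obj G).map f) ≫ (iso G X').hom =
      (iso G X).hom ≫ (ν.act.obj G).map (toFunctor.map f)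
  coherence : ∀ (G H : S) (X : M),
    toFunctor.map (μ.assoc G H X).hom ≫ (iso G ((μ.act.obj H).obj X)).hom ≫
        (ν.act.obj G).map (iso H X).hom =
      (iso (σ.prod G H) X).hom ≫ (ν.assoc G H (toFunctor.obj X)).hom

/-- Two module categories are equivalent if there is a module functor between them which is an
equivalence of categories. -/
def ModuleEquivalent (μ : ModuleStr σ M) (ν : ModuleStr σ N) : Prop :=
  ∃ Φ : ModuleFunctor μ ν, Φ.toFunctor.IsEquivalence

lemma ModuleEquivalent.refl (μ : ModuleStr σ M) : ModuleEquivalent μ μ :=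
  ⟨{ toFunctor := 𝟭 M
     additive := inferInstance
     linear := inferInstance
     iso := fun _ _ => Iso.refl _
     nat_left := by simp
     nat_right := by simp
     coherence := by simp }, (inferInstance : (𝟭 M).IsEquivalence)⟩

lemma ModuleEquivalent.trans {μ : ModuleStr σ M} {ν : ModuleStr σ N} {l : ModuleStr σ L}
    (h : ModuleEquivalent μ ν) (h' : ModuleEquivalent ν l) : ModuleEquivalent μ l := by
  obtain ⟨Φ, e⟩ := h
  obtain ⟨Ψ, e'⟩ := h'
  have := Φ.additive
  have := Φ.linear
  have := Ψ.additive
  have := Ψ.linear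
  refine ⟨{ toFunctor := Φ.toFunctor ⋙ Ψ.toFunctor
            additive := inferInstance
            linear := inferInstance
            iso := fun G X => Ψ.toFunctor.mapIso (Φ.iso G X) ≪≫ Ψ.iso G (Φ.toFunctor.obj X)
            nat_left := ?_
            nat_right := ?_
            coherence := ?_ }, (inferInstance : (Φ.toFunctor ⋙ Ψ.toFunctor).IsEquivalence)⟩
  · intro G G' f X
    have h := congrArg Ψ.toFunctor.map (Φ.nat_left f X)
    simp only [Functor.map_comp] at h
    simp [reassoc_of% h, Ψ.nat_left]
  · intro G X X' f
    have h := congrArg Ψ.toFunctor.map (Φ.nat_right G f)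
    simp only [Functor.map_comp] at h
    simp [reassoc_of% h, Ψ.nat_right]
  · intro G H X
    have h := congrArg Ψ.toFunctor.map (Φ.coherence G H X)
    have h1 := Ψ.nat_right G (Φ.iso H X).hom
    simp only [Functor.map_comp] at h
    simp only [Functor.comp_map, Functor.comp_obj, Iso.trans_hom, Functor.mapIso_hom,
      Functor.map_comp, Category.assoc]
    rw [← reassoc_of% h1, reassoc_of% h, Ψ.coherence]

lemma ModuleEquivalent.symm {μ : ModuleStr σ M} {ν : ModuleStr σ N}
    (h : ModuleEquivalent μ ν) : ModuleEquivalent ν μ := by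
  obtain ⟨Φ, e⟩ := h
  obtain ⟨Ψ, hΨ, _, _, c, hc⟩ : ∃ (Ψ : N ⥤ M) (_ : Ψ.IsEquivalence) (_ : Ψ.Additive)
      (_ : Ψ.Linear k) (c : ∀ Y, Φ.toFunctor.obj (Ψ.obj Y) ≅ Y),
      ∀ {X Y : N} (f : X ⟶ Y), Φ.toFunctor.map (Ψ.map f) = (c X).hom ≫ f ≫ (c Y).inv := by
    let E := Φ.toFunctor.asEquivalence
    have : E.functor.Additive := Φ.additive
    have : E.functor.Linear k := Φ.linear
    exact ⟨E.inverse, inferInstance, inferInstance, inferInstance, fun Y => E.counitIso.app Y,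
      fun f => E.fun_inv_map _ _ f⟩
  let s : ∀ (G : S) (Y : N),
      Ψ.obj ((ν.act.obj G).obj Y) ≅ (μ.act.obj G).obj (Ψ.obj Y) := fun G Y =>
    Φ.toFunctor.preimageIso (c _ ≪≫
      (ν.act.obj G).mapIso (c Y).symm ≪≫ (Φ.iso G (Ψ.obj Y)).symm)
  have hs : ∀ (G : S) (Y : N), Φ.toFunctor.map (s G Y).hom ≫ (Φ.iso G (Ψ.obj Y)).hom =
      (c _).hom ≫ (ν.act.obj G).map (c Y).inv := by
    intro G Y
    simp [s]
  refine ⟨{ toFunctor := Ψ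
            additive := inferInstance
            linear := inferInstance
            iso := s
            nat_left := ?_
            nat_right := ?_
            coherence := ?_ }, hΨ⟩
  · intro G G' f X
    apply Φ.toFunctor.map_injective
    rw [← cancel_mono (Φ.iso G' (Ψ.obj X)).hom]
    simp only [Functor.map_comp, Category.assoc]
    rw [Φ.nat_left f, hs, reassoc_of% (hs G X), hc]
    simp
  · intro G X X' f
    apply Φ.toFunctor.map_injective
    rw [← cancel_mono (Φ.iso G (Ψ.obj X')).hom]
    simp only [Functor.map_comp, Category.assoc]
    rw [Φ.nat_right G, hs, reassoc_of% (hs G X), hc, hc]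
    simp
  · intro G H X
    apply Φ.toFunctor.map_injective
    rw [← cancel_mono (Φ.iso G ((μ.act.obj H).obj (Ψ.obj X))).hom,
      ← cancel_mono ((ν.act.obj G).map (Φ.iso H (Ψ.obj X)).hom)]
    simp only [Functor.map_comp, Category.assoc]
    rw [Φ.coherence, reassoc_of% (hs (σ.prod G H) X), reassoc_of% (Φ.nat_right G (s H X).hom),
      ← Functor.map_comp, hs, reassoc_of% (hs G _), hc, ν.assoc_nat_right]
    simp

end Modules

section Restriction

variable {k : Type u} [Field k]

lemma yo_map_add {A : Type u} [SmallCategory A] [Preadditive A] [Linear k A] {G H : A}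
    (f g : G ⟶ H) : (yo (k := k)).map (f + g) = yo.map f + yo.map g :=
  PSh.hom_ext fun _ p => Preadditive.comp_add _ _ _ p f g

lemma yo_map_smul {A : Type u} [SmallCategory A] [Preadditive A] [Linear k A] {G H : A} (c : k)
    (f : G ⟶ H) : (yo (k := k)).map (c • f) = c • yo.map f :=
  PSh.hom_ext fun _ p => Linear.comp_smul _ _ _ p c f

namespace Day

variable {A B C : Type u} [SmallCategory A] [SmallCategory B] [SmallCategory C]

/-- The morphism `T(p, q)`. -/
def pairMap (T : A ⥤ B ⥤ C) {G G' : A} {H H' : B} (p : G' ⟶ G) (q : H' ⟶ H) :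
    (T.obj G').obj H' ⟶ (T.obj G).obj H :=
  (T.map p).app H' ≫ (T.obj G).map q

lemma pairMap_id (T : A ⥤ B ⥤ C) (G : A) (H : B) : pairMap T (𝟙 G) (𝟙 H) = 𝟙 _ := by
  simp [pairMap]

lemma pairMap_comp (T : A ⥤ B ⥤ C) {G G' G'' : A} {H H' H'' : B} (h : G' ⟶ G'') (l : H' ⟶ H'')
    (p : G'' ⟶ G) (q : H'' ⟶ H) : pairMap T h l ≫ pairMap T p q = pairMap T (h ≫ p) (l ≫ q) := by
  simp [pairMap]

lemma pairMap_left (T : A ⥤ B ⥤ C) {G G' G'' : A} {H' H'' : B} (p : G' ⟶ G) (q : H' ⟶ H'')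
    (g : G ⟶ G'') : pairMap T p q ≫ (T.map g).app H'' = pairMap T (p ≫ g) q := by
  simp [pairMap]

lemma pairMap_right (T : A ⥤ B ⥤ C) {G G' : A} {H H' H'' : B} (p : G' ⟶ G) (q : H' ⟶ H)
    (l : H ⟶ H'') : pairMap T p q ≫ (T.obj G).map l = pairMap T p (q ≫ l) := by
  simp [pairMap]

variable [Preadditive A] [Preadditive B] [Preadditive C] [Linear k A] [Linear k B] [Linear k C]

/-- A morphism `X ⟶ G` as an element of `Hom(-, G)` at `X`. -/
def yoEl (k : Type u) [Field k] [Linear k A] {X G : A} (f : X ⟶ G) :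
    (yo (k := k).obj G).val X := f

lemma res_yoEl {X Y G : A} (g : X ⟶ Y) (f : Y ⟶ G) :
    (yo (k := k).obj G).res g (yoEl k f) = yoEl k (g ≫ f) := rfl

lemma app_yoEl {X G H : A} (g : G ⟶ H) (f : X ⟶ G) :
    PSh.app (yo (k := k).map g) X (yoEl k f) = yoEl k (f ≫ g) := rfl

/-- The morphism `Hom(-, G) ⊛ Hom(-, H) ⟶ Hom(-, T(G, H))`. -/
def yoHom {T : A ⥤ B ⥤ C} (hT : IsBilinear k T) (G : A) (H : B) :
    dayObj T (yo (k := k).obj G) (yo.obj H) ⟶ yo.obj ((T.obj G).obj H) :=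
  desc (R := yo.obj ((T.obj G).obj H))
    (fun G' H' (p : G' ⟶ G) (q : H' ⟶ H) => yoEl k (pairMap T p q))
    (fun G' H' (p p' : G' ⟶ G) (q : H' ⟶ H) =>
      show pairMap T (p + p') q = pairMap T p q + pairMap T p' q by simp [pairMap, hT.add_left])
    (fun G' H' c (p : G' ⟶ G) (q : H' ⟶ H) =>
      show pairMap T (c • p) q = c • pairMap T p q by simp [pairMap, hT.smul_left])
    (fun G' H' (p : G' ⟶ G) (q q' : H' ⟶ H) =>
      show pairMap T p (q + q') = pairMap T p q + pairMap T p q' by simp [pairMap, hT.add_right])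
    (fun G' H' c (p : G' ⟶ G) (q : H' ⟶ H) =>
      show pairMap T p (c • q) = c • pairMap T p q by simp [pairMap, hT.smul_right])
    (fun _ _ _ _ h l p q => pairMap_comp T h l p q)

lemma yoHom_el {T : A ⥤ B ⥤ C} (hT : IsBilinear k T) (G : A) (H : B) {X : C} {G' : A}
    {H' : B} (f : X ⟶ (T.obj G').obj H') (p : G' ⟶ G) (q : H' ⟶ H) :
    PSh.app (yoHom hT G H) X (el f (yoEl k p) (yoEl k q)) = yoEl k (f ≫ pairMap T p q) := by
  exact desc_el ..

/-- The morphism `Hom(-, T(G, H)) ⟶ Hom(-, G) ⊛ Hom(-, H)`. -/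
def yoInv (T : A ⥤ B ⥤ C) (G : A) (H : B) :
    yo (k := k).obj ((T.obj G).obj H) ⟶ dayObj T (yo (k := k).obj G) (yo.obj H) :=
  PSh.homMk'
    (fun X =>
      { toFun := fun f : X ⟶ (T.obj G).obj H => el f (yoEl k (𝟙 G)) (yoEl k (𝟙 H))
        map_add' := fun f f' => el_add_left f f' _ _
        map_smul' := fun c f => el_smul_left c f _ _ })
    (fun g f => (res_el g f _ _).symm)

lemma yoInv_yoEl (T : A ⥤ B ⥤ C) (G : A) (H : B) {X : C} (f : X ⟶ (T.obj G).obj H) :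
    PSh.app (yoInv (k := k) T G H) X (yoEl k f) = el f (yoEl k (𝟙 G)) (yoEl k (𝟙 H)) := rfl

/-- The convolution of representable presheaves is representable. -/
def yoIso {T : A ⥤ B ⥤ C} (hT : IsBilinear k T) (G : A) (H : B) :
    dayObj T (yo (k := k).obj G) (yo.obj H) ≅ yo.obj ((T.obj G).obj H) where
  hom := yoHom hT G H
  inv := yoInv T G H
  hom_inv_id := hom_ext fun G' H' (p : G' ⟶ G) (q : H' ⟶ H) => by
    change PSh.app (yoInv (k := k) T G H) _ (PSh.app (yoHom hT G H) _
      (el (𝟙 _) (yoEl k p) (yoEl k q))) = el (𝟙 _) (yoEl k p) (yoEl k q)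
    rw [yoHom_el, yoInv_yoEl, pairMap, el_comp, res_yoEl, res_yoEl, Category.comp_id,
      Category.comp_id]
  inv_hom_id := PSh.hom_ext fun X (f : X ⟶ (T.obj G).obj H) => by
    change PSh.app (yoHom hT G H) _ (PSh.app (yoInv (k := k) T G H) _ (yoEl k f)) = yoEl k f
    rw [yoInv_yoEl, yoHom_el, pairMap_id, Category.comp_id]

lemma yoHom_nat_left {T : A ⥤ B ⥤ C} (hT : IsBilinear k T) {G G' : A} (g : G ⟶ G') (H : B) :
    map T (yo.map g) (𝟙 (yo.obj H)) ≫ yoHom hT G' H =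
      yoHom hT G H ≫ (yo (k := k)).map ((T.map g).app H) :=
  hom_ext fun K L (p : K ⟶ G) (q : L ⟶ H) => by
    change PSh.app (yoHom hT G' H) _ (PSh.app (map T (yo (k := k).map g) (𝟙 (yo.obj H))) _
        (el (𝟙 _) (yoEl k p) (yoEl k q))) =
      PSh.app (yo.map _) _ (PSh.app (yoHom hT G H) _ (el (𝟙 _) (yoEl k p) (yoEl k q)))
    rw [map_el, app_yoEl, PSh.app_id, yoHom_el, yoHom_el, app_yoEl, Category.assoc, pairMap_left]

lemma yoHom_nat_right {T : A ⥤ B ⥤ C} (hT : IsBilinear k T) (G : A) {H H' : B} (h : H ⟶ H') :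
    map T (𝟙 (yo.obj G)) (yo.map h) ≫ yoHom hT G H' =
      yoHom hT G H ≫ (yo (k := k)).map ((T.obj G).map h) :=
  hom_ext fun K L (p : K ⟶ G) (q : L ⟶ H) => by
    change PSh.app (yoHom hT G H') _ (PSh.app (map T (𝟙 (yo.obj G)) (yo (k := k).map h)) _
        (el (𝟙 _) (yoEl k p) (yoEl k q))) =
      PSh.app (yo.map _) _ (PSh.app (yoHom hT G H) _ (el (𝟙 _) (yoEl k p) (yoEl k q)))
    rw [map_el, app_yoEl, PSh.app_id, yoHom_el, yoHom_el, app_yoEl, Category.assoc, pairMap_right]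

end Day

open Day

variable {S M : Type u} [SmallCategory S] [SmallCategory M] [Preadditive S] [Preadditive M]
  [Linear k S] [Linear k M] {σ : SemigroupStr k S}

lemma ModuleStr.pairMap_assoc (μ : ModuleStr σ M) {G G' H H' : S} {X X' : M} (p : G' ⟶ G)
    (q : H' ⟶ H) (r : X' ⟶ X) : pairMap μ.act (pairMap σ.tensor p q) r ≫ (μ.assoc G H X).hom =
      (μ.assoc G' H' X').hom ≫ pairMap μ.act p (pairMap μ.act q r) := by
  simp [pairMap, μ.assoc_nat_right, μ.assoc_nat_left_assoc, μ.assoc_nat_mid_assoc]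

/-- The associators of `S` and of the convolution correspond under the Yoneda embedding. -/
lemma ModuleStr.yo_assoc (μ : ModuleStr σ M) (G H : S) (X : M) :
    Day.map μ.act (yoHom σ.bilinear G H) (𝟙 (yo.obj X)) ≫ yoHom μ.bilinear (σ.prod G H) X ≫
        (yo (k := k)).map (μ.assoc G H X).hom =
      μ.assocHom (yo.obj G) (yo.obj H) (yo.obj X) ≫
        Day.map μ.act (𝟙 (yo.obj G)) (yoHom μ.bilinear H X) ≫
          yoHom μ.bilinear G ((μ.act.obj H).obj X) :=
  hom_ext_left fun G' H' X' (p : G' ⟶ G) (q : H' ⟶ H) (r : X' ⟶ X) => by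
    change PSh.app (yo.map _) _ (PSh.app (yoHom μ.bilinear (σ.prod G H) X) _
        (PSh.app (Day.map μ.act (yoHom σ.bilinear G H) (𝟙 (yo.obj X))) _
          (el (𝟙 _) (el (𝟙 _) (yoEl k p) (yoEl k q)) (yoEl k r)))) =
      PSh.app (yoHom μ.bilinear G ((μ.act.obj H).obj X)) _
        (PSh.app (Day.map μ.act (𝟙 (yo.obj G)) (yoHom μ.bilinear H X)) _
          (PSh.app (μ.assocHom (yo.obj G) (yo.obj H) (yo.obj X)) _
            (el (𝟙 _) (el (𝟙 _) (yoEl k p) (yoEl k q)) (yoEl k r))))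
    rw [map_el, yoHom_el, PSh.app_id, yoHom_el, app_yoEl, μ.assocHom_el, map_el, PSh.app_id,
      yoHom_el, yoHom_el]
    simp [μ.pairMap_assoc]

section

variable (σ)

/-- The comparison `Hom(-, G ⊠ H) ⟶ Hom(-, G) ⊛ Hom(-, H)`. -/
def yoCmp (G H : S) :
    yo (k := k).obj (σ.prod G H) ≅ σ.psh.prod (yo.obj G) (yo.obj H) :=
  (yoIso σ.bilinear G H).symm

lemma yoCmp_nat_left {G G' : S} (g : G ⟶ G') (H : S) :
    (yo (k := k)).map (σ.wr g H) ≫ (yoCmp σ G' H).hom =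
      (yoCmp σ G H).hom ≫ σ.psh.wr (yo.map g) (yo.obj H) := by
  rw [← Iso.inv_comp_eq, ← Category.assoc, ← Iso.eq_comp_inv]
  exact (yoHom_nat_left σ.bilinear g H).symm

lemma yoCmp_nat_right (G : S) {H H' : S} (h : H ⟶ H') :
    (yo (k := k)).map (σ.wl G h) ≫ (yoCmp σ G H').hom =
      (yoCmp σ G H).hom ≫ σ.psh.wl (yo.obj G) (yo.map h) := by
  rw [← Iso.inv_comp_eq, ← Category.assoc, ← Iso.eq_comp_inv]
  exact (yoHom_nat_right σ.bilinear G h).symm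

lemma yoCmp_assoc (G H K : S) :
    (yo (k := k)).map (σ.assoc G H K).hom ≫ (yoCmp σ G (σ.prod H K)).hom ≫
        σ.psh.wl (yo.obj G) (yoCmp σ H K).hom =
      (yoCmp σ (σ.prod G H) K).hom ≫ σ.psh.wr (yoCmp σ G H).hom (yo.obj K) ≫
        (σ.psh.assoc (yo.obj G) (yo.obj H) (yo.obj K)).hom := by
  have h : σ.psh.wr (yoCmp (k := k) σ G H).inv (yo.obj K) ≫ (yoCmp σ (σ.prod G H) K).inv ≫
      yo.map (σ.assoc G H K).hom = (σ.psh.assoc (yo.obj G) (yo.obj H) (yo.obj K)).hom ≫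
        σ.psh.wl (yo.obj G) (yoCmp σ H K).inv ≫ (yoCmp σ G (σ.prod H K)).inv :=
    σ.regular.yo_assoc G H K
  have h1 : σ.psh.wr (yoCmp (k := k) σ G H).hom (yo.obj K) ≫
      σ.psh.wr (yoCmp (k := k) σ G H).inv (yo.obj K) = 𝟙 _ := by
    rw [← NatTrans.comp_app, ← Functor.map_comp]; simp
  have h2 : σ.psh.wl (yo.obj G) (yoCmp (k := k) σ H K).inv ≫
      σ.psh.wl (yo.obj G) (yoCmp (k := k) σ H K).hom = 𝟙 _ := by
    rw [← Functor.map_comp]; simp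
  have h3 := congrArg (fun t => (yoCmp (k := k) σ (σ.prod G H) K).hom ≫
    σ.psh.wr (yoCmp (k := k) σ G H).hom (yo.obj K) ≫ t ≫ (yoCmp σ G (σ.prod H K)).hom ≫
      σ.psh.wl (yo.obj G) (yoCmp σ H K).hom) h
  simp only [Category.assoc, Iso.inv_hom_id_assoc, reassoc_of% h1, Iso.hom_inv_id_assoc, h2,
    Category.comp_id] at h3
  exact h3

end

/-- The restriction of a module category over `[Sᵒᵖ, Vec_k]` to a module category over `S` along
the Yoneda embedding: `G ⋆ X = Hom(-, G) ⋆ X`. -/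
def ModuleStr.restrict {N : Type u₃} [Category.{v₃} N] [Preadditive N] [Linear k N]
    (ν : ModuleStr (σ.psh (k := k)) N) : ModuleStr σ N where
  act := yo ⋙ ν.act
  bilinear :=
    { add_left := fun f g X => by
        simp only [Functor.comp_map, yo_map_add, ν.bilinear.add_left]
      smul_left := fun c f X => by
        simp only [Functor.comp_map, yo_map_smul, ν.bilinear.smul_left]
      add_right := fun G _ _ f g => ν.bilinear.add_right (yo.obj G) f g
      smul_right := fun G _ _ c f => ν.bilinear.smul_right (yo.obj G) c f }
  assoc G H X := (ν.act.mapIso (yoCmp σ G H)).app X ≪≫ ν.assoc (yo.obj G) (yo.obj H) X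
  assoc_nat_left f H X := by
    have h := congrArg (fun t => (ν.act.map t).app X) (yoCmp_nat_left σ f H)
    simp only [Functor.map_comp, NatTrans.comp_app] at h
    simp [reassoc_of% h, ν.assoc_nat_left]
  assoc_nat_mid G _ _ f X := by
    have h := congrArg (fun t => (ν.act.map t).app X) (yoCmp_nat_right σ G f)
    simp only [Functor.map_comp, NatTrans.comp_app] at h
    simp [reassoc_of% h, ν.assoc_nat_mid]
  assoc_nat_right G H _ _ f := by
    simp [ν.assoc_nat_right]
  pentagon G H K X := by
    have h := congrArg (fun t => (ν.act.map t).app X) (yoCmp_assoc σ G H K)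
    simp only [Functor.map_comp, NatTrans.comp_app] at h
    have h1 := ν.assoc_nat_left (yoCmp σ G H).hom (yo.obj K) X
    have h2 := ν.assoc_nat_mid (yo.obj G) (yoCmp σ H K).hom X
    have h3 := ν.pentagon (yo.obj G) (yo.obj H) (yo.obj K) X
    simp only [Functor.comp_obj, Functor.comp_map, Iso.trans_hom, Iso.app_hom, Functor.mapIso_hom,
      Functor.map_comp, Category.assoc]
    rw [← reassoc_of% h1, ← h3, ← reassoc_of% h2, reassoc_of% h]

/-- A full subcategory which is closed under the action is a module category. -/
def ModuleStr.fullSub {S : Type u₁} [Category.{v₁} S] [Preadditive S] [Linear k S]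
    {σ : SemigroupStr k S} {N : Type u₃} [Category.{v₃} N] [Preadditive N] [Linear k N]
    (ν : ModuleStr σ N) (W : ObjectProperty N)
    (hW : ∀ (G : S) (X : N), W X → W ((ν.act.obj G).obj X)) :
    ModuleStr σ W.FullSubcategory where
  act :=
    { obj := fun G => W.lift (W.ι ⋙ ν.act.obj G) (fun X => hW G _ X.property)
      map := fun g => { app := fun X => ObjectProperty.homMk ((ν.act.map g).app X.obj) } }
  bilinear :=
    { add_left := fun f g X => W.hom_ext (ν.bilinear.add_left f g X.obj)
      smul_left := fun c f X => W.hom_ext (ν.bilinear.smul_left c f X.obj)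
      add_right := fun G _ _ f g => W.hom_ext (ν.bilinear.add_right G f.hom g.hom)
      smul_right := fun G _ _ c f => W.hom_ext (ν.bilinear.smul_right G c f.hom) }
  assoc G H X := W.isoMk (ν.assoc G H X.obj)
  assoc_nat_left f H X := W.hom_ext (ν.assoc_nat_left f H X.obj)
  assoc_nat_mid G _ _ f X := W.hom_ext (ν.assoc_nat_mid G f X.obj)
  assoc_nat_right G H _ _ f := W.hom_ext (ν.assoc_nat_right G H f.hom)
  pentagon G H K X := W.hom_ext (ν.pentagon G H K X.obj)

end Restriction

section Projectives

variable {k : Type u} [Field k] {A : Type u} [SmallCategory A] [Preadditive A] [Linear k A]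

/-- A presheaf is finitely generated if finitely many of its elements generate it, equivalently,
if it is a quotient of a finite direct sum of representable presheaves. -/
def PSh.IsFG (P : PSh k A) : Prop :=
  ∃ (n : ℕ) (X : Fin n → A) (p : ∀ i, P.val (X i)), ∀ (Y : A) (y : P.val Y),
    ∃ f : ∀ i, Y ⟶ X i, y = ∑ i, P.res (f i) (p i)

variable (k A) in
/-- The finitely generated projective presheaves. -/
def fgProj : ObjectProperty (PSh k A) := fun P => P.IsFG ∧ Projective P

end Projectives

section Correspondence

variable {k : Type u} [Field k] {S : Type u} [SmallCategory S] [Preadditive S] [Linear k S]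

/-- A small semigroup module category over `S`. -/
structure SmallModule (σ : SemigroupStr k S) where
  carrier : Type u
  [category : SmallCategory carrier]
  [preadditive : Preadditive carrier]
  [linear : Linear k carrier]
  str : ModuleStr σ carrier

attribute [instance] SmallModule.category SmallModule.preadditive SmallModule.linear

/-- A semigroup module category over `[Sᵒᵖ, Vec_k]` whose underlying category is the category of
presheaves `[Aᵒᵖ, Vec_k]` on a small category `A`. -/
structure PresheafModule (σ : SemigroupStr k S) where
  base : Type u
  [category : SmallCategory base]
  [preadditive : Preadditive base]
  [linear : Linear k base]
  str : ModuleStr σ.psh (PSh k base)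

attribute [instance] PresheafModule.category PresheafModule.preadditive PresheafModule.linear

variable {σ : SemigroupStr k S}

/-- The presheaf category `[Mᵒᵖ, Vec_k]` of a small module category `M`, with the action obtained by
cocontinuous extension. -/
def SmallModule.presheaves (M : SmallModule σ) : PresheafModule σ where
  base := M.carrier
  str := M.str.psh

/-- The action is cocontinuous in both variables. -/
def PresheafModule.IsCocontinuous (N : PresheafModule σ) : Prop :=
  (∀ P : PSh k S, Limits.PreservesColimitsOfSize.{u, u} (N.str.act.obj P)) ∧
    ∀ X : PSh k N.base, Limits.PreservesColimitsOfSize.{u, u} (N.str.act.flip.obj X)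

/-- The finitely generated projective objects are closed under the action of representable
presheaves. -/
def PresheafModule.ActsOnFGProj (N : PresheafModule σ) : Prop :=
  ∀ (G : S) (P : PSh k N.base), fgProj k N.base P →
    fgProj k N.base ((N.str.restrict.act.obj G).obj P)

/-- The `S`-module category of finitely generated projective objects, with the `S`-module structure
obtained by restriction. -/
def PresheafModule.fgProjModule (N : PresheafModule σ) (h : N.ActsOnFGProj) :
    ModuleStr σ (fgProj k N.base).FullSubcategory :=
  N.str.restrict.fullSub (fgProj k N.base) h

/-- The Cauchy complete small semigroup `S`-module categories `M` in which the given adjunction is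
respected and such that `S ⋆ M = M`. -/
def RespectingModules {F G : S} (adj : DualPair σ F G) : Type (u + 1) :=
  { M : SmallModule σ // IsCauchyComplete M.carrier ∧ adj.Respected M.str ∧ M.str.Spans }

/-- The monoidal `[Sᵒᵖ, Vec_k]`-module presheaf categories, that is, those with an action which is
cocontinuous in both variables, on which `Hom(-, G)` acts faithfully. -/
def FaithfulPresheafModules (U : UnitStr (σ.psh (k := k))) (G : S) : Type (u + 1) :=
  { N : PresheafModule σ // U.IsMonoidalModule N.str ∧ N.IsCocontinuous ∧
    (N.str.act.obj (yo.obj G)).Faithful }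

/-- Equivalence of module categories. -/
instance RespectingModules.setoid {F G : S} (adj : DualPair σ F G) :
    Setoid (RespectingModules adj) where
  r M M' := ModuleEquivalent M.1.str M'.1.str
  iseqv := ⟨fun M => .refl M.1.str, .symm, .trans⟩

/-- Equivalence of module categories. -/
instance FaithfulPresheafModules.setoid (U : UnitStr (σ.psh (k := k))) (G : S) :
    Setoid (FaithfulPresheafModules U G) where
  r N N' := ModuleEquivalent N.1.str N'.1.str
  iseqv := ⟨fun N => .refl N.1.str, .symm, .trans⟩

end Correspondence

end SemigroupModule

end

/-! Write `D` for the object `F ⊠ F'`. Since `S` has no unit, the counits of the adjunction let `D`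
play the role of a cover of the missing unit. A triangle identity splits `εʳ` at every object `F ⊠
Z`; naturality spreads the splitting to summands of finite sums, and liberality of `F ⊠ -` makes
these all objects (`exists_section_epsR`). For `εˡ` rigidity enters: decomposing the left dual of
`X` along `F ⊠ -` and passing to mates exhibits `K ⊠ X` as a summand of objects `W ⊠ F'`, where `εˡ`
splits (`isSummandOfSum_prod`, `exists_section_epsL`). The unit presheaf is the coequalizer of the
two counit maps `Hom(-, D ⊠ D) ⇉ Hom(-, D)`, and the sections of the counits produce inverses of `1
⊛ P ⟶ P` and `P ⊛ 1 ⟶ P`.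

If `M` respects the adjunction and is spanned by the action, the counit of `(F ⋆ -) ⊣ (F' ⋆ -)` is
split epi, so `F' ⋆ -` is faithful, and this forces the maps `D ⋆ X ⟶ X` to be compatible with both
`εˡ` and `εʳ` (`Respected.exists_counitOn`). The coequalizer computation then gives `1 ⋆ P ≅ P`
(`isIso_unitAct`). Any isomorphism between `1 ⋆ -` and the identity can be replaced by one
satisfying the triangle axiom (`isMonoidalModule_of_iso`), so the choice of unit structure is
irrelevant.

Conversely, let `N` be a monoidal module presheaf category. The right module transformations of any
adjunction in `S` extend to presheaves and are induced by morphisms from a representable to the unit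
and from the unit to a representable. Hence every adjunction acts on `N` (`respected_restrict`), so
every `Hom(-, G) ⋆ -` has a cocontinuous right adjoint and preserves finitely generated projectives.
For the given adjunction the morphism `Hom(-, D) ⟶ 1` is epi, so `D ⋆ X ⟶ X` is epi for every `X`:
this yields faithfulness of `Hom(-, F')`, and on projectives it splits, which yields the spanning
condition.

The rest is Morita theory. Finitely generated projectives are the summands of finite sums of
representables (`fgProj_iff`). The nerve along a small model of them is an equivalence
(`nerve_isEquivalence`) compatible with the actions (`isIso_nerveAct`), and a Cauchy complete `M` is
recovered as the finitely generated projectives of its presheaves. These two facts show that the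
assignments are mutually inverse on equivalence classes. -/

noncomputable section

namespace SemigroupModule

/-! ### Summands of finite direct sums -/

section SummandsOfSums

variable {C : Type u₁} [Category.{v₁} C] [Preadditive C]

/-- The morphisms which are finite sums of morphisms factoring through objects satisfying `W`. -/
def factoring (W : ObjectProperty C) (Y Z : C) : AddSubmonoid (Y ⟶ Z) :=
  AddSubmonoid.closure {h | ∃ (X : C) (f : Y ⟶ X) (g : X ⟶ Z), W X ∧ h = f ≫ g}

lemma comp_mem_factoring {W : ObjectProperty C} {X Y Z : C} (f : Y ⟶ X) (g : X ⟶ Z) (hX : W X) :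
    f ≫ g ∈ factoring W Y Z :=
  AddSubmonoid.subset_closure ⟨X, f, g, hX, rfl⟩

/-- The morphisms in `factoring W` form a two-sided ideal, so being a summand becomes the single
condition that this ideal contains the identity. Closure properties can then be proved by induction,
without handling indexed families. -/
lemma isSummandOfSum_iff {W : ObjectProperty C} {Y : C} :
    IsSummandOfSum W Y ↔ 𝟙 Y ∈ factoring W Y Y := by
  constructor
  · rintro ⟨n, X, f, g, hX, h⟩
    rw [← h]
    exact sum_mem fun i _ => comp_mem_factoring _ _ (hX i)
  · intro h
    obtain ⟨l, hl, h⟩ := AddSubmonoid.exists_list_of_mem_closure h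
    choose X f g hX hfg using fun i : Fin l.length => hl (l.get i) (List.get_mem _ _)
    refine ⟨l.length, X, f, g, hX, ?_⟩
    rw [← h, ← Finset.sum_congr rfl (fun i _ => hfg i)]
    simp

lemma factoring_precomp {W : ObjectProperty C} {X Y Z : C} (a : X ⟶ Y) {h : Y ⟶ Z}
    (hh : h ∈ factoring W Y Z) : a ≫ h ∈ factoring W X Z := by
  induction hh using AddSubmonoid.closure_induction with
  | mem x hx =>
    obtain ⟨V, f, g, hV, rfl⟩ := hx
    rw [← Category.assoc]
    exact comp_mem_factoring _ _ hV
  | zero => simp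
  | add x y _ _ hx hy => simpa using add_mem hx hy

lemma factoring_postcomp {W : ObjectProperty C} {X Y Z : C} {h : X ⟶ Y} (a : Y ⟶ Z)
    (hh : h ∈ factoring W X Y) : h ≫ a ∈ factoring W X Z := by
  induction hh using AddSubmonoid.closure_induction with
  | mem x hx =>
    obtain ⟨V, f, g, hV, rfl⟩ := hx
    rw [Category.assoc]
    exact comp_mem_factoring _ _ hV
  | zero => simp
  | add x y _ _ hx hy => simpa using add_mem hx hy

lemma factoring_map {D : Type u₂} [Category.{v₂} D] [Preadditive D] {W : ObjectProperty C}
    {W' : ObjectProperty D} (T : C ⥤ D) [T.Additive] (hT : ∀ X, W X → W' (T.obj X))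
    {Y Z : C} {h : Y ⟶ Z} (hh : h ∈ factoring W Y Z) :
    T.map h ∈ factoring W' (T.obj Y) (T.obj Z) := by
  induction hh using AddSubmonoid.closure_induction with
  | mem x hx =>
    obtain ⟨V, f, g, hV, rfl⟩ := hx
    rw [T.map_comp]
    exact comp_mem_factoring _ _ (hT _ hV)
  | zero => simp
  | add x y _ _ hx hy => simpa using add_mem hx hy

lemma IsSummandOfSum.map {D : Type u₂} [Category.{v₂} D] [Preadditive D] {W : ObjectProperty C}
    {W' : ObjectProperty D} (T : C ⥤ D) [T.Additive] (hT : ∀ X, W X → W' (T.obj X))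
    {Y : C} (h : IsSummandOfSum W Y) : IsSummandOfSum W' (T.obj Y) := by
  rw [isSummandOfSum_iff] at h ⊢
  simpa using factoring_map T hT h

/-- Passing to summands of sums is transitive. -/
lemma IsSummandOfSum.trans {W W' : ObjectProperty C} {Y : C} (h : IsSummandOfSum W Y)
    (hW : ∀ X, W X → IsSummandOfSum W' X) : IsSummandOfSum W' Y := by
  obtain ⟨n, X, f, g, hX, h⟩ := h
  rw [isSummandOfSum_iff, ← h]
  refine sum_mem fun i _ => ?_
  -- Each term `f i ≫ g i` is read as `f i ≫ 𝟙 ≫ g i`, with the middle identity in the ideal for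
  -- `W'`.
  have := factoring_postcomp (g i) (factoring_precomp (f i) (isSummandOfSum_iff.1 (hW _ (hX i))))
  simpa using this

lemma IsSummandOfSum.of_retract {W : ObjectProperty C} {X Y : C} (f : Y ⟶ X) (g : X ⟶ Y)
    (h : f ≫ g = 𝟙 Y) (hX : IsSummandOfSum W X) : IsSummandOfSum W Y :=
  IsSummandOfSum.trans (W := fun Z => Z = X) ⟨1, fun _ => X, fun _ => f, fun _ => g,
    fun _ => rfl, by simpa using h⟩ (by rintro _ rfl; exact hX)

lemma IsSummandOfSum.of_mem {W : ObjectProperty C} {X Y : C} (f : Y ⟶ X) (g : X ⟶ Y)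
    (h : f ≫ g = 𝟙 Y) (hX : W X) : IsSummandOfSum W Y :=
  ⟨1, fun _ => X, fun _ => f, fun _ => g, fun _ => hX, by simpa using h⟩

/-- A transformation which is invertible at all objects satisfying `W` is invertible at all
summands of their sums. -/
lemma IsSummandOfSum.isIso_app {D : Type u₂} [Category.{v₂} D] [Preadditive D]
    {T T' : C ⥤ D} [T.Additive] [T'.Additive] (α : T ⟶ T') {W : ObjectProperty C} {Y : C}
    (h : IsSummandOfSum W Y) (hα : ∀ X, W X → IsIso (α.app X)) : IsIso (α.app Y) := by
  obtain ⟨n, X, f, g, hX, h⟩ := h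
  have := fun i => hα _ (hX i)
  -- The inverse is glued from the inverses at the `X i`; naturality collapses each composite to the
  -- image of `f i ≫ g i`.
  refine ⟨∑ i, T'.map (f i) ≫ inv (α.app (X i)) ≫ T.map (g i), ?_, ?_⟩
  · rw [Preadditive.comp_sum]
    simp_rw [← α.naturality_assoc, IsIso.hom_inv_id_assoc, ← T.map_comp]
    rw [← T.map_sum, h, T.map_id]
  · rw [Preadditive.sum_comp]
    simp_rw [Category.assoc, α.naturality, IsIso.inv_hom_id_assoc, ← T'.map_comp]
    rw [← T'.map_sum, h, T'.map_id]

/-- A natural family of morphisms which is split epi at all objects satisfying `W` is split epi at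
all summands of their sums. -/
lemma IsSummandOfSum.exists_section {T : C ⥤ C} (α : T ⟶ 𝟭 C) {W : ObjectProperty C} {Y : C}
    (h : IsSummandOfSum W Y) (hα : ∀ X, W X → ∃ s, s ≫ α.app X = 𝟙 X) :
    ∃ s, s ≫ α.app Y = 𝟙 Y := by
  obtain ⟨n, X, f, g, hX, h⟩ := h
  choose s hs using fun i => hα _ (hX i)
  -- The sections are glued in the same way. Only naturality of `α` at `g i` intervenes, so `T` may
  -- be any functor.
  refine ⟨∑ i, f i ≫ s i ≫ T.map (g i), ?_⟩
  rw [Preadditive.sum_comp, ← h]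
  refine Finset.sum_congr rfl fun i _ => ?_
  have := α.naturality (g i)
  simp only [Functor.id_map] at this
  rw [Category.assoc, Category.assoc, this, reassoc_of% (hs i)]

end SummandsOfSums

/-! ### Elements of presheaves, epimorphisms and the Yoneda lemma -/

section Elements

variable {k : Type u} [Field k] {A : Type u} [SmallCategory A] [Preadditive A] [Linear k A]

namespace PSh

lemma app_zero {P Q : PSh k A} (X : A) (p : P.val X) : app (0 : P ⟶ Q) X p = 0 := rfl

lemma app_sum {P Q : PSh k A} {I : Type*} (s : Finset I) (φ : I → (P ⟶ Q)) (X : A)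
    (p : P.val X) : app (∑ i ∈ s, φ i) X p = ∑ i ∈ s, app (φ i) X p := by
  classical
  induction s using Finset.induction_on with
  | empty => rfl
  | insert i s hi ih => rw [Finset.sum_insert hi, Finset.sum_insert hi, app_add, ih]

/-- The quotient of a presheaf by a subpresheaf. -/
def quotient (P : PSh k A) (W : ∀ X, Submodule k (P.val X))
    (hW : ∀ {X Y : A} (f : X ⟶ Y) (p : P.val Y), p ∈ W Y → P.res f p ∈ W X) : PSh k A :=
  mk' (fun X => P.val X ⧸ W X)
    (fun f => (W _).mapQ (W _) (P.res f) (fun p hp => hW f p hp))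
    (by rintro X ⟨p⟩; exact congrArg _ (P.res_id X p))
    (by rintro X Y Z f g ⟨p⟩; exact congrArg _ (P.res_comp f g p))
    (by rintro X Y f g ⟨p⟩; exact congrArg _ (P.res_add f g p))
    (by rintro X Y c f ⟨p⟩; exact congrArg _ (P.res_smul c f p))

section

variable {P : PSh k A} {W : ∀ X, Submodule k (P.val X)}
  (hW : ∀ {X Y : A} (f : X ⟶ Y) (p : P.val Y), p ∈ W Y → P.res f p ∈ W X)

/-- The projection onto the quotient presheaf. -/
def quotientMk : P ⟶ quotient P W hW :=
  homMk' (fun X => (W X).mkQ) (fun _ _ => rfl)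

lemma quotientMk_surjective (X : A) : Function.Surjective (app (quotientMk hW) X) :=
  Submodule.mkQ_surjective _

lemma quotientMk_eq_zero {X : A} {p : P.val X} : app (quotientMk hW) X p = 0 ↔ p ∈ W X :=
  Submodule.Quotient.mk_eq_zero _

end

/-- A morphism factors through a surjection as soon as it kills its kernel. -/
lemma exists_desc {C P Z : PSh k A} (π : C ⟶ P) (hπ : ∀ X, Function.Surjective (app π X))
    (h : C ⟶ Z) (hk : ∀ X x, app π X x = 0 → app h X x = 0) : ∃ φ : P ⟶ Z, π ≫ φ = h := by
  have key : ∀ X (x y : C.val X), app π X x = app π X y → app h X x = app h X y := by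
    intro X x y e
    rw [← sub_eq_zero, ← map_sub] at e ⊢
    exact hk X _ e
  choose s hs using hπ
  refine ⟨homMk' (fun X =>
    { toFun := fun p => app h X (s X p)
      map_add' := fun p q => ?_
      map_smul' := fun c p => ?_ }) fun {X Y} f p => ?_, hom_ext fun X x => key _ _ _ (hs _ _)⟩
  · rw [← map_add]; exact key _ _ _ (by simp [hs])
  · rw [RingHom.id_apply, ← map_smul]; exact key _ _ _ (by simp [hs])
  · change app h X (s X (P.res f p)) = Z.res f (app h Y (s Y p))
    rw [← app_res]; exact key _ _ _ (by rw [app_res, hs, hs])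

lemma epi_of_surjective {P Q : PSh k A} (φ : P ⟶ Q) (h : ∀ X, Function.Surjective (app φ X)) :
    Epi φ where
  left_cancellation ψ ψ' e := hom_ext fun X q => by
    obtain ⟨p, rfl⟩ := h X q
    exact congrArg (fun t => app t X p) e

/-- A family of morphisms which is jointly epi generates all elements of the target. -/
lemma mem_iSup_range {I : Type*} {C : PSh k A} {D : I → PSh k A} (ι : ∀ i, D i ⟶ C)
    (h : ∀ (Z : PSh k A) (φ : C ⟶ Z), (∀ i, ι i ≫ φ = 0) → φ = 0) (X : A) (c : C.val X) :
    c ∈ ⨆ i, LinearMap.range (app (ι i) X) := by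
  have hW : ∀ {X Y : A} (f : X ⟶ Y) (p : C.val Y), p ∈ ⨆ i, LinearMap.range (app (ι i) Y) →
      C.res f p ∈ ⨆ i, LinearMap.range (app (ι i) X) := by
    intro X Y f p hp
    have : (⨆ i, LinearMap.range (app (ι i) Y)) ≤
        (⨆ i, LinearMap.range (app (ι i) X)).comap (C.res f) := by
      refine iSup_le fun i => ?_
      rintro _ ⟨d, rfl⟩
      rw [Submodule.mem_comap, ← app_res]
      exact Submodule.mem_iSup_of_mem i ⟨_, rfl⟩
    exact this hp
  -- The projection onto the quotient by the subpresheaf generated by the images kills every `ι i`,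
  -- hence vanishes, so that subpresheaf is everything.
  have h0 := h _ (quotientMk (W := fun X => ⨆ i, LinearMap.range (app (ι i) X)) hW)
    (fun i => hom_ext fun X d => (quotientMk_eq_zero hW).2 (Submodule.mem_iSup_of_mem i ⟨d, rfl⟩))
  exact (quotientMk_eq_zero hW).1 (by rw [h0, app_zero])

/-- This is the one-element case of `mem_iSup_range`: an epimorphism is a jointly epimorphic family
by itself. -/
lemma surjective_of_epi {P Q : PSh k A} (φ : P ⟶ Q) [Epi φ] (X : A) :
    Function.Surjective (app φ X) := by
  intro q
  have := mem_iSup_range (I := Unit) (fun _ => φ)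
    (fun Z ψ h => by rw [← cancel_epi φ, h ()]; simp) X q
  simpa using this

lemma isIso_of_bijective {P Q : PSh k A} (φ : P ⟶ Q)
    (h : ∀ X, Function.Bijective (app φ X)) : IsIso φ := by
  have := epi_of_surjective φ fun X => (h X).2
  obtain ⟨ψ, hψ⟩ := exists_desc φ (fun X => (h X).2) (𝟙 P)
    (fun X x hx => (h X).1 (hx.trans (map_zero _).symm))
  exact ⟨ψ, hψ, by rw [← cancel_epi φ, reassoc_of% hψ, Category.comp_id]⟩

end PSh

/-- The morphism `Hom(-, X) ⟶ P` given by an element of `P(X)`. -/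
def yoDesc {P : PSh k A} {X : A} (p : P.val X) : yo.obj X ⟶ P :=
  PSh.homMk' (fun Y =>
    { toFun := fun f : Y ⟶ X => P.res f p
      map_add' := fun f g => P.res_add f g p
      map_smul' := fun c f => P.res_smul c f p }) (fun f g => P.res_comp f g p)

lemma yoDesc_app {P : PSh k A} {X Y : A} (p : P.val X) (f : Y ⟶ X) :
    PSh.app (yoDesc p) Y (Day.yoEl k f) = P.res f p := rfl

lemma yoDesc_app_id {P : PSh k A} {X : A} (p : P.val X) :
    PSh.app (yoDesc p) X (Day.yoEl k (𝟙 X)) = p := P.res_id X p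

lemma yo_hom_ext {P : PSh k A} {X : A} {φ ψ : yo.obj X ⟶ P}
    (h : PSh.app φ X (Day.yoEl k (𝟙 X)) = PSh.app ψ X (Day.yoEl k (𝟙 X))) : φ = ψ := by
  refine PSh.hom_ext fun Y (f : Y ⟶ X) => ?_
  have e : Day.yoEl k f = (yo (k := k).obj X).res f (Day.yoEl k (𝟙 X)) :=
    (congrArg (Day.yoEl k) (Category.comp_id f)).symm
  change PSh.app φ Y (Day.yoEl k f) = PSh.app ψ Y (Day.yoEl k f)
  rw [e, PSh.app_res, PSh.app_res, h]

lemma yoDesc_eq {P : PSh k A} {X : A} (φ : yo.obj X ⟶ P) :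
    yoDesc (PSh.app φ X (Day.yoEl k (𝟙 X))) = φ :=
  yo_hom_ext (yoDesc_app_id _)

lemma yoDesc_comp {P Q : PSh k A} {X : A} (p : P.val X) (φ : P ⟶ Q) :
    yoDesc p ≫ φ = yoDesc (PSh.app φ X p) :=
  yo_hom_ext (by rw [PSh.app_comp, yoDesc_app_id, yoDesc_app_id])

lemma map_yoDesc {P : PSh k A} {X Y : A} (f : X ⟶ Y) (p : P.val Y) :
    yo.map f ≫ yoDesc p = yoDesc (P.res f p) :=
  yo_hom_ext (by
    rw [PSh.app_comp, yoDesc_app_id, Day.app_yoEl, yoDesc_app, Category.id_comp])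

instance yo_full : (yo (k := k) (A := A)).Full where
  map_surjective {X Y} φ := ⟨PSh.app φ X (Day.yoEl k (𝟙 X)),
    yo_hom_ext (Category.id_comp (obj := A) (Y := Y) (PSh.app φ X (Day.yoEl k (𝟙 X))))⟩

instance yo_faithful : (yo (k := k) (A := A)).Faithful where
  map_injective {X Y} f g h := by
    have := congrArg (fun t => PSh.app t X (Day.yoEl k (𝟙 X))) h
    simp only [Day.app_yoEl, Category.id_comp] at this
    exact this

instance yo_additive : (yo (k := k) (A := A)).Additive where
  map_add := yo_map_add _ _

instance yo_linear : (yo (k := k) (A := A)).Linear k where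
  map_smul f c := yo_map_smul c f

variable (k A) in
/-- The representable presheaves. -/
def representables : ObjectProperty (PSh k A) := fun P => ∃ X : A, P = yo.obj X

end Elements

end SemigroupModule

end

noncomputable section

namespace SemigroupModule

open Limits

/-! ### Limits and colimits of linear presheaves -/

section Colimits

variable {k : Type u} [Field k] {A : Type u} [SmallCategory A] [Preadditive A] [Linear k A]

/-- Colimits of presheaves are computed objectwise, so linearity of the restriction maps may be
tested after composing with the coprojections, where naturality transfers it to the diagram. -/
instance (J : Type v₁) [Category.{v₂} J] [HasColimitsOfShape J (ModuleCat.{u} k)] :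
    (linearPresheaf k A).IsClosedUnderColimitsOfShape J where
  colimitsOfShape_le := by
    rintro P ⟨p⟩
    have hc := fun Y : A =>
      isColimitOfPreserves ((evaluation Aᵒᵖ (ModuleCat.{u} k)).obj (op Y)) p.isColimit
    have nat := fun (X Y : A) (f : X ⟶ Y) j => (p.ι.app j).naturality f.op
    refine ⟨fun X Y f g => (hc Y).hom_ext fun j => ?_, fun X Y c f => (hc Y).hom_ext fun j => ?_⟩
    · have h := (p.prop_diag_obj j).1 X Y f g
      change (p.ι.app j).app (op Y) ≫ _ = (p.ι.app j).app (op Y) ≫ _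
      rw [Preadditive.comp_add]
      erw [← nat, ← nat, ← nat, ← Preadditive.add_comp, h]
    · have h := (p.prop_diag_obj j).2 X Y c f
      change (p.ι.app j).app (op Y) ≫ _ = (p.ι.app j).app (op Y) ≫ _
      rw [Linear.comp_smul]
      erw [← nat, ← nat, ← Linear.smul_comp, h]

/-- The dual argument with projections. It supplies the equalizers that split idempotents of
presheaves. -/
instance (J : Type v₁) [Category.{v₂} J] [HasLimitsOfShape J (ModuleCat.{u} k)] :
    (linearPresheaf k A).IsClosedUnderLimitsOfShape J where
  limitsOfShape_le := by
    rintro P ⟨p⟩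
    have hc := fun Y : A =>
      isLimitOfPreserves ((evaluation Aᵒᵖ (ModuleCat.{u} k)).obj (op Y)) p.isLimit
    have nat := fun (X Y : A) (f : X ⟶ Y) j => (p.π.app j).naturality f.op
    refine ⟨fun X Y f g => (hc X).hom_ext fun j => ?_, fun X Y c f => (hc X).hom_ext fun j => ?_⟩
    · have h := (p.prop_diag_obj j).1 X Y f g
      change _ ≫ (p.π.app j).app (op X) = _ ≫ (p.π.app j).app (op X)
      rw [Preadditive.add_comp]
      erw [nat, nat, nat, ← Preadditive.comp_add, h]
    · have h := (p.prop_diag_obj j).2 X Y c f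
      change _ ≫ (p.π.app j).app (op X) = _ ≫ (p.π.app j).app (op X)
      rw [Linear.smul_comp]
      erw [nat, nat, ← Linear.comp_smul, h]

instance : HasColimitsOfSize.{u, u} (PSh k A) where
  has_colimits_of_shape _ _ := inferInstance

instance : HasFiniteBiproducts (PSh k A) := .of_hasFiniteCoproducts

instance : IsIdempotentComplete (PSh k A) :=
  (Idempotents.isIdempotentComplete_iff_hasEqualizer_of_id_and_idempotent _).2
    fun _ _ _ => inferInstance

end Colimits

/-! ### Presentations by representable presheaves -/

section Presentations

variable {k : Type u} [Field k] {A : Type u} [SmallCategory A] [Preadditive A] [Linear k A]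

/-- The sum of representable presheaves indexed by a family of elements. -/
abbrev freeOn {I : Type u} (X : I → A) : PSh k A := ∐ fun i => yo.obj (X i)

/-- The morphism from a sum of representable presheaves given by a family of elements. -/
abbrev freeDesc {I : Type u} (X : I → A) {P : PSh k A} (p : ∀ i, P.val (X i)) : freeOn X ⟶ P :=
  Sigma.desc fun i => yoDesc (p i)

lemma freeDesc_gen {I : Type u} (X : I → A) {P : PSh k A} (p : ∀ i, P.val (X i)) (i : I) :
    PSh.app (freeDesc X p) (X i)
      (PSh.app (Sigma.ι (fun i => yo.obj (X i)) i) (X i) (Day.yoEl k (𝟙 (X i)))) = p i := by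
  rw [← PSh.app_comp, Sigma.ι_desc, yoDesc_app_id]

variable (P : PSh k A)

/-- The canonical cover of a presheaf by a sum of representable presheaves. -/
abbrev freeCover : freeOn (fun i : Σ X : A, P.val X => i.1) ⟶ P :=
  freeDesc _ fun i => i.2

lemma freeCover_surjective (X : A) : Function.Surjective (PSh.app (freeCover P) X) := fun p =>
  ⟨_, freeDesc_gen (fun i : Σ X : A, P.val X => i.1) (fun i => i.2) ⟨X, p⟩⟩

/-- The elements of the kernel of the canonical cover. -/
abbrev FreeRelIndex : Type u :=
  Σ X : A, { x : (freeOn (k := k) (fun i : Σ X : A, P.val X => i.1)).val X //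
    PSh.app (freeCover P) X x = 0 }

/-- The canonical relations of a presheaf. -/
abbrev freeRel : freeOn (k := k) (fun i : FreeRelIndex P => i.1) ⟶
    freeOn (k := k) (fun i : Σ X : A, P.val X => i.1) :=
  freeDesc _ fun i => i.2.1

lemma freeRel_freeCover : freeRel P ≫ freeCover P = 0 := by
  refine Sigma.hom_ext _ _ fun i => yo_hom_ext ?_
  rw [← Category.assoc, PSh.app_comp, Sigma.ι_desc, yoDesc_app_id, i.2.2, comp_zero, PSh.app_zero]

/-- Every presheaf is the cokernel of a morphism between sums of representable presheaves. -/
def freePresentation :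
    IsColimit (CokernelCofork.ofπ (f := freeRel P) (freeCover P) (freeRel_freeCover P)) :=
  haveI : Epi (freeCover P) := PSh.epi_of_surjective _ (freeCover_surjective P)
  CokernelCofork.IsColimit.ofπ' _ _ fun h hh =>
    -- Each element of the kernel is itself an index of `freeRel`, so it is the image of a
    -- generator, and anything killing `freeRel` kills it.
    have e := PSh.exists_desc (freeCover P) (freeCover_surjective P) h (fun X x hx => by
      obtain ⟨y, hy⟩ : ∃ y, PSh.app (freeRel P) X y = x :=
        ⟨_, freeDesc_gen (fun i : FreeRelIndex P => i.1) (fun i => i.2.1) ⟨X, x, hx⟩⟩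
      rw [← hy, ← PSh.app_comp, hh, PSh.app_zero])
    ⟨e.choose, e.choose_spec⟩

end Presentations

/-! ### Transformations between cocontinuous functors -/

section Transformations

/-- A transformation between functors preserving a colimit is invertible at the colimit if it is
invertible at the diagram. -/
lemma isIso_app_of_isColimit {J : Type v₁} [Category.{v₂} J] {C : Type u₁} [Category.{v₃} C]
    {D : Type u₂} [Category.{v₄} D] {T T' : C ⥤ D} (α : T ⟶ T') {K : J ⥤ C} {c : Cocone K}
    (hc : IsColimit c) [PreservesColimit K T] [PreservesColimit K T']
    (h : ∀ j, IsIso (α.app (K.obj j))) : IsIso (α.app c.pt) := by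
  have : ∀ j, IsIso ((Functor.whiskerLeft K α).app j) := h
  have : IsIso (Functor.whiskerLeft K α) := NatIso.isIso_of_isIso_app _
  have e : α.app c.pt = (IsColimit.coconePointsIsoOfNatIso (isColimitOfPreserves T hc)
      (isColimitOfPreserves T' hc) (asIso (Functor.whiskerLeft K α))).hom :=
    (isColimitOfPreserves T hc).hom_ext fun j => by
      refine (α.naturality (c.ι.app j)).trans ?_
      exact ((isColimitOfPreserves T hc).ι_map (T'.mapCocone c) (Functor.whiskerLeft K α) j).symm
  rw [e]
  infer_instance

variable {k : Type u} [Field k] {A : Type u} [SmallCategory A] [Preadditive A] [Linear k A]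

/-- A transformation between cocontinuous functors on presheaves is invertible if it is invertible
at representable presheaves. -/
lemma isIso_app_of_representables {D : Type u₁} [Category.{v₁} D] {T T' : PSh k A ⥤ D}
    [PreservesColimitsOfSize.{u, u} T] [PreservesColimitsOfSize.{u, u} T'] (α : T ⟶ T')
    (h : ∀ X : A, IsIso (α.app (yo.obj X))) (P : PSh k A) : IsIso (α.app P) := by
  have h1 : ∀ {I : Type u} (X : I → A), IsIso (α.app (freeOn (k := k) X)) := fun X =>
    isIso_app_of_isColimit α (coproductIsCoproduct fun i => yo.obj (X i)) fun j => h (X j.as)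
  -- The presentation is a colimit over the walking parallel pair, which lives in universe `0`.
  have : PreservesColimitsOfSize.{0, 0} T := preservesColimitsOfSize_shrink T
  have : PreservesColimitsOfSize.{0, 0} T' := preservesColimitsOfSize_shrink T'
  refine isIso_app_of_isColimit α (freePresentation P) ?_
  rintro (_ | _)
  · exact h1 _
  · exact h1 _

end Transformations

/-! ### Finitely generated projective presheaves -/

section FinitelyGeneratedProjectives

variable {k : Type u} [Field k] {A : Type u} [SmallCategory A] [Preadditive A] [Linear k A]

/-- Finite generation gives an epimorphism from a finite sum of representables, which projectivity
splits. Conversely, generators are the images of the identities, and lifting works because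
epimorphisms are surjective on elements and, by Yoneda, morphisms out of a representable are
elements. -/
lemma fgProj_iff (P : PSh k A) : fgProj k A P ↔ IsSummandOfSum (representables k A) P := by
  constructor
  · rintro ⟨⟨n, X, p, hp⟩, hP⟩
    let π : (⨁ fun i => yo.obj (X i)) ⟶ P := biproduct.desc fun i => yoDesc (p i)
    have : Epi π := PSh.epi_of_surjective _ fun Y y => by
      obtain ⟨f, hf⟩ := hp Y y
      refine ⟨∑ i, PSh.app (biproduct.ι (fun i => yo.obj (X i)) i) Y (Day.yoEl k (f i)), ?_⟩
      rw [hf, map_sum]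
      refine Finset.sum_congr rfl fun i _ => ?_
      rw [← PSh.app_comp, biproduct.ι_desc, yoDesc_app]
    refine ⟨n, fun i => yo.obj (X i), fun i => Projective.factorThru (𝟙 P) π ≫ biproduct.π _ i,
      fun i => biproduct.ι (fun i => yo.obj (X i)) i ≫ π, fun i => ⟨X i, rfl⟩, ?_⟩
    simp_rw [Category.assoc]
    rw [← Preadditive.comp_sum]
    simp_rw [← Category.assoc (biproduct.π _ _)]
    rw [← Preadditive.sum_comp, biproduct.total, Category.id_comp, Projective.factorThru_comp]
  · rintro ⟨n, Q, f, g, hQ, h⟩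
    choose X hX using hQ
    obtain rfl : Q = fun i => yo.obj (X i) := funext hX
    constructor
    · refine ⟨n, X, fun i => PSh.app (g i) (X i) (Day.yoEl k (𝟙 (X i))), fun Y y =>
        ⟨fun i => PSh.app (f i) Y y, ?_⟩⟩
      have := congrArg (fun t => PSh.app t Y y) h
      simp only [PSh.app_id, PSh.app_sum, PSh.app_comp] at this
      refine this.symm.trans (Finset.sum_congr rfl fun i _ => ?_)
      conv_lhs => rw [← yoDesc_eq (g i)]
      rfl
    · refine ⟨fun {E Z} φ e he => ?_⟩
      choose z hz using fun i => PSh.surjective_of_epi e (X i)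
        (PSh.app (g i ≫ φ) (X i) (Day.yoEl k (𝟙 (X i))))
      refine ⟨∑ i, f i ≫ yoDesc (z i), ?_⟩
      rw [Preadditive.sum_comp, ← Category.id_comp φ, ← h, Preadditive.sum_comp]
      refine Finset.sum_congr rfl fun i _ => ?_
      rw [Category.assoc, Category.assoc, yoDesc_comp, hz, yoDesc_eq]

lemma fgProj_yo (X : A) : fgProj k A (yo.obj X) :=
  (fgProj_iff _).2 (.of_mem (𝟙 _) (𝟙 _) (Category.id_comp _) ⟨X, rfl⟩)

lemma fgProj_of_summands {P : PSh k A} (h : IsSummandOfSum (fgProj k A) P) : fgProj k A P :=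
  (fgProj_iff P).2 (h.trans fun _ hX => (fgProj_iff _).1 hX)

/-- A morphism from a finitely generated projective presheaf to a sum is a finite sum of morphisms
through the summands. -/
lemma mem_iSup_of_fgProj {P : PSh k A} (hP : fgProj k A P) {I : Type*} {C : PSh k A}
    {D : I → PSh k A} (ι : ∀ i, D i ⟶ C)
    (h : ∀ (Z : PSh k A) (φ : C ⟶ Z), (∀ i, ι i ≫ φ = 0) → φ = 0) (s : P ⟶ C) :
    s ∈ ⨆ i, LinearMap.range (Linear.rightComp k P (ι i)) := by
  obtain ⟨n, Q, f, g, hQ, e⟩ := (fgProj_iff P).1 hP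
  rw [← Category.id_comp s, ← e, Preadditive.sum_comp]
  refine sum_mem fun j _ => ?_
  obtain ⟨X, hX⟩ := hQ j
  generalize f j = a, g j = b at *
  generalize Q j = R at *
  subst hX
  rw [Category.assoc, ← yoDesc_eq (b ≫ s)]
  -- After restriction to a representable, the morphism is an element of `C`, which is a finite sum
  -- of elements coming from the `D i`.
  have h2 := PSh.mem_iSup_range ι h X (PSh.app (b ≫ s) X (Day.yoEl k (𝟙 X)))
  generalize PSh.app (b ≫ s) X (Day.yoEl k (𝟙 X)) = c at h2
  refine Submodule.iSup_induction _ (motive := fun c => a ≫ yoDesc c ∈ _) h2 ?_ ?_ ?_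
  · rintro i _ ⟨d, rfl⟩
    refine Submodule.mem_iSup_of_mem i ⟨a ≫ yoDesc d, ?_⟩
    rw [← yoDesc_comp, ← Category.assoc]
    rfl
  · convert Submodule.zero_mem _
    have : yoDesc (0 : C.val X) = 0 := yo_hom_ext (by rw [yoDesc_app_id, PSh.app_zero])
    rw [this, comp_zero]
  · intro x y hx hy
    have : yoDesc (x + y) = yoDesc x + yoDesc y :=
      yo_hom_ext (by rw [PSh.app_add, yoDesc_app_id, yoDesc_app_id, yoDesc_app_id])
    rw [this, Preadditive.comp_add]
    exact add_mem hx hy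

variable {B : Type u} [SmallCategory B] [Preadditive B] [Linear k B]

/-- A left adjoint functor with cocontinuous right adjoint preserves finitely generated projective
presheaves. -/
lemma fgProj_of_adjunction {L : PSh k A ⥤ PSh k B} {R : PSh k B ⥤ PSh k A} (adj : L ⊣ R)
    [L.Additive] [PreservesColimitsOfSize.{u, u} R] {P : PSh k A} (hP : fgProj k A P) :
    fgProj k B (L.obj P) := by
  have : PreservesColimitsOfSize.{0, 0} R := preservesColimitsOfSize_shrink R
  have : R.Additive := adj.right_adjoint_additive
  -- A cocontinuous `R` preserves epimorphisms, so its left adjoint preserves projectives. What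
  -- remains is finite generation.
  have hL : Projective (L.obj P) := adj.map_projective P hP.2
  let Q := L.obj P
  have : Epi (freeCover Q) := PSh.epi_of_surjective _ (freeCover_surjective Q)
  let s := Projective.factorThru (𝟙 Q) (freeCover Q)
  have hs : s ≫ freeCover Q = 𝟙 Q := Projective.factorThru_comp _ _
  let K : (Σ X : B, Q.val X) → PSh k B := fun i => yo.obj i.1
  -- Since `R` preserves the coproduct, the images of the coprojections are jointly epi. The
  -- transpose of `s` starts at `P`, so it is a finite sum of morphisms through the `R.obj (K i)`.
  have h := mem_iSup_of_fgProj hP (C := R.obj (∐ K)) (fun i => R.map (Sigma.ι K i))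
    (fun Z φ hφ => (isColimitOfPreserves R (coproductIsCoproduct K)).hom_ext fun j => by
      simpa using hφ j.as) (adj.homEquiv _ _ s)
  -- Transposing back, `s` is a finite sum of morphisms through representables, and composing with
  -- the cover turns this into a decomposition of the identity.
  rw [fgProj_iff, isSummandOfSum_iff, ← hs]
  refine factoring_postcomp _ ?_
  rw [← (adj.homEquiv _ _).symm_apply_apply s]
  generalize adj.homEquiv _ _ s = t at h
  refine Submodule.iSup_induction _ (motive := fun t => (adj.homEquiv _ _).symm t ∈ _) h ?_ ?_ ?_
  · rintro i _ ⟨d, rfl⟩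
    rw [Linear.rightComp_apply, adj.homEquiv_naturality_right_symm]
    exact comp_mem_factoring _ _ ⟨i.1, rfl⟩
  · rw [adj.homEquiv_counit, L.map_zero, zero_comp]
    exact zero_mem _
  · intro x y hx hy
    rw [adj.homEquiv_counit] at hx hy ⊢
    rw [L.map_add, Preadditive.add_comp]
    exact add_mem hx hy

end FinitelyGeneratedProjectives

end SemigroupModule

end

noncomputable section

namespace SemigroupModule

open Limits

/-! ### The nerve along a dense family of presheaves -/

section Nerve

variable {k : Type u} [Field k]
variable {A B : Type u} [SmallCategory A] [Preadditive A] [Linear k A]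
  [SmallCategory B] [Preadditive B] [Linear k B]

/-- The restricted Yoneda functor `P ↦ Hom(E -, P)`. -/
def nerve (E : B ⥤ PSh k A) [E.Additive] [E.Linear k] : PSh k A ⥤ PSh k B where
  obj P := PSh.mk' (fun b => (E.obj b ⟶ P)) (fun f => Linear.leftComp k P (E.map f))
    (by simp) (by simp) (by simp) (by simp [Functor.map_smul])
  map φ := PSh.homMk' (fun b => Linear.rightComp k (E.obj b) φ)
    (fun g p => Category.assoc (E.map g) p φ)
  map_id P := PSh.hom_ext fun b p => Category.comp_id p
  map_comp φ ψ := PSh.hom_ext fun b p => (Category.assoc p φ ψ).symm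

variable (E : B ⥤ PSh k A) [E.Additive] [E.Linear k]

/-- A morphism `E(b) ⟶ P` as an element of the nerve of `P` at `b`. -/
def nerveEl {b : B} {P : PSh k A} (p : E.obj b ⟶ P) : ((nerve E).obj P).val b := p

variable {E} in
/-- The morphism underlying an element of a nerve. -/
def nerveHom {b : B} {P : PSh k A} (p : ((nerve E).obj P).val b) : E.obj b ⟶ P := p

@[simp] lemma nerveHom_nerveEl {b : B} {P : PSh k A} (p : E.obj b ⟶ P) :
    nerveHom (nerveEl E p) = p := rfl

@[simp] lemma nerveEl_nerveHom {b : B} {P : PSh k A} (p : ((nerve E).obj P).val b) :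
    nerveEl E (nerveHom p) = p := rfl

lemma nerve_res {b b' : B} {P : PSh k A} (f : b' ⟶ b) (p : E.obj b ⟶ P) :
    ((nerve E).obj P).res f (nerveEl E p) = nerveEl E (E.map f ≫ p) := rfl

lemma nerve_app {b : B} {P Q : PSh k A} (φ : P ⟶ Q) (p : E.obj b ⟶ P) :
    PSh.app ((nerve E).map φ) b (nerveEl E p) = nerveEl E (p ≫ φ) := rfl

instance nerve_additive : (nerve E).Additive where
  map_add {P Q φ ψ} := PSh.hom_ext fun b p =>
    Preadditive.comp_add (E.obj b) P Q (nerveHom p) φ ψ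

instance nerve_linear : (nerve E).Linear k where
  map_smul {P Q} φ c := PSh.hom_ext fun b p => Linear.comp_smul (E.obj b) P Q (nerveHom p) c φ

/-- Every representable presheaf is a summand of a sum of objects in the image of `E`. -/
def IsDense (E : B ⥤ PSh k A) : Prop :=
  ∀ X : A, IsSummandOfSum (fun P => ∃ b, P = E.obj b) (yo.obj X)

variable {E}

/-- A morphism of presheaves is determined by its effect on maps from representables. Density writes
such a map as a sum of maps factoring through objects `E b`, on which the nerve records the effect.
-/
lemma nerve_faithful (hE : IsDense E) : (nerve E).Faithful where
  map_injective {P Q} φ ψ h := by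
    refine PSh.hom_ext fun X p => ?_
    obtain ⟨n, R, f, g, hR, e⟩ := hE X
    rw [← yoDesc_app_id p, ← PSh.app_comp, ← PSh.app_comp]
    congr 2
    rw [← Category.id_comp (yoDesc p), ← e, Preadditive.sum_comp, Preadditive.sum_comp,
      Preadditive.sum_comp]
    refine Finset.sum_congr rfl fun i _ => ?_
    obtain ⟨b, hb⟩ := hR i
    generalize f i = f, g i = g
    generalize R i = R at *
    subst hb
    simp only [Category.assoc]
    congr 1
    have := congrArg (fun t => PSh.app t b (nerveEl E (g ≫ yoDesc p))) h
    simp only [nerve_app] at this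
    simpa using congrArg nerveHom this

/-- A morphism of nerves is an operation `Ψ` on maps out of the objects `E b`, natural for all maps
between them because `E` is full. Density extends it to an operation `Φ` on maps out of
representables, which is a morphism of presheaves by Yoneda. -/
lemma nerve_full (hE : IsDense E) [E.Full] : (nerve E).Full where
  map_surjective {P Q} ψ := by
    choose n R f g hR e using hE
    choose b hb using hR
    obtain rfl : R = fun X i => E.obj (b X i) := by funext X i; exact hb X i
    let Ψ : ∀ {b : B}, (E.obj b ⟶ P) → (E.obj b ⟶ Q) := fun {b} p =>
      nerveHom (PSh.app ψ b (nerveEl E p))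
    have hΨ : ∀ {b b' : B} (w : E.obj b ⟶ E.obj b') (p : E.obj b' ⟶ P),
        Ψ (w ≫ p) = w ≫ Ψ p := by
      intro b b' w p
      obtain ⟨w, rfl⟩ := E.map_surjective w
      have := PSh.app_res ψ w (nerveEl E p)
      exact this
    have hadd : ∀ {b : B} (p q : E.obj b ⟶ P), Ψ (p + q) = Ψ p + Ψ q := fun p q =>
      map_add (PSh.app ψ _) (nerveEl E p) (nerveEl E q)
    have hsmul : ∀ {b : B} (c : k) (p : E.obj b ⟶ P), Ψ (c • p) = c • Ψ p := fun c p =>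
      map_smul (PSh.app ψ _) c (nerveEl E p)
    let Φ : ∀ {X : A}, (yo.obj X ⟶ P) → (yo.obj X ⟶ Q) := fun {X} p =>
      ∑ i, f X i ≫ Ψ (g X i ≫ p)
    -- This identity makes `Φ` independent of the chosen decomposition: naturality of `Ψ` along `g X
    -- i ≫ w` moves the sum onto the identity of `yo.obj X`.
    have hΦ : ∀ {X : A} {b : B} (w : yo.obj X ⟶ E.obj b) (p : E.obj b ⟶ P),
        Φ (w ≫ p) = w ≫ Ψ p := by
      intro X b w p
      change ∑ i, f X i ≫ Ψ (g X i ≫ w ≫ p) = _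
      simp_rw [← Category.assoc (g X _), hΨ, ← Category.assoc]
      rw [← Preadditive.sum_comp, ← Preadditive.sum_comp]
      simp [e]
    have hΦ' : ∀ {X Y : A} (w : yo.obj X ⟶ yo.obj Y) (p : yo.obj Y ⟶ P),
        Φ (w ≫ p) = w ≫ Φ p := by
      intro X Y w p
      -- Inserting the decomposition of the identity of `yo.obj Y` reduces naturality between
      -- representables to `hΦ`.
      have : w ≫ p = ∑ i, (w ≫ f Y i) ≫ g Y i ≫ p := by
        simp_rw [← Category.assoc]
        rw [← Preadditive.sum_comp]
        simp_rw [Category.assoc]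
        rw [← Preadditive.comp_sum, e, Category.comp_id]
      have hs : ∀ {I : Type} (s : Finset I) (q : I → (yo.obj X ⟶ P)),
          Φ (∑ i ∈ s, q i) = ∑ i ∈ s, Φ (q i) := by
        intro I s q
        have h0 : ∀ q q' : yo.obj X ⟶ P, Φ (q + q') = Φ q + Φ q' := fun q q' => by
          simp only [Φ, Preadditive.comp_add, hadd, Finset.sum_add_distrib]
        exact map_sum (AddMonoidHom.mk' Φ h0) q s
      rw [this, hs]
      simp_rw [hΦ, Category.assoc]
      rw [← Preadditive.comp_sum]
    refine ⟨PSh.homMk' (fun X =>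
      { toFun := fun p => PSh.app (Φ (yoDesc p)) X (Day.yoEl k (𝟙 X))
        map_add' := fun p q => ?_
        map_smul' := fun c p => ?_ }) fun {X Y} w p => ?_, ?_⟩
    · have : yoDesc (p + q) = yoDesc p + yoDesc q :=
        yo_hom_ext (by rw [PSh.app_add, yoDesc_app_id, yoDesc_app_id, yoDesc_app_id])
      rw [this, ← PSh.app_add]
      simp only [Φ, Preadditive.comp_add, hadd, Finset.sum_add_distrib]
    · have : yoDesc (c • p) = c • yoDesc p :=
        yo_hom_ext (by rw [PSh.app_smul, yoDesc_app_id, yoDesc_app_id])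
      rw [this, RingHom.id_apply, ← PSh.app_smul]
      simp only [Φ, Linear.comp_smul, hsmul, Finset.smul_sum]
    · change PSh.app (Φ (yoDesc (P.res w p))) X (Day.yoEl k (𝟙 X)) =
        Q.res w (PSh.app (Φ (yoDesc p)) Y (Day.yoEl k (𝟙 Y)))
      rw [← map_yoDesc, hΦ', PSh.app_comp, Day.app_yoEl, Category.id_comp, ← PSh.app_res,
        Day.res_yoEl, Category.comp_id]
    · refine PSh.hom_ext fun b p => ?_
      rw [← nerveEl_nerveHom E p, nerve_app]
      refine congrArg (nerveEl E) (PSh.hom_ext fun X y => ?_)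
      change PSh.app (Φ (yoDesc (PSh.app (nerveHom p) X y))) X (Day.yoEl k (𝟙 X)) =
        PSh.app (Ψ (nerveHom p)) X y
      rw [← yoDesc_comp, hΦ, PSh.app_comp, yoDesc_app_id]

/-- The canonical morphism from `Hom(-, b)` to the nerve of `E(b)`. -/
def nerveUnit (E : B ⥤ PSh k A) [E.Additive] [E.Linear k] (b : B) :
    yo.obj b ⟶ (nerve E).obj (E.obj b) :=
  yoDesc (nerveEl E (𝟙 (E.obj b)))

lemma nerveUnit_app (b : B) {X : B} (f : X ⟶ b) :
    PSh.app (nerveUnit E b) X (Day.yoEl k f) = nerveEl E (E.map f) := by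
  rw [nerveUnit, yoDesc_app, nerve_res, Category.comp_id]

/-- On elements the map is the action of `E` on morphisms `X ⟶ b`, which is bijective. -/
instance isIso_nerveUnit [E.Full] [E.Faithful] (b : B) : IsIso (nerveUnit E b) :=
  PSh.isIso_of_bijective _ fun X => by
    constructor
    · intro (f : X ⟶ b) (g : X ⟶ b) h
      exact E.map_injective (((nerveUnit_app b f).symm.trans h).trans (nerveUnit_app b g))
    · intro p
      obtain ⟨f, hf⟩ := E.map_surjective (nerveHom p)
      exact ⟨Day.yoEl k f, (nerveUnit_app b f).trans (congrArg (nerveEl E) hf)⟩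

/-- The composite of two nerves is the identity. -/
lemma nerve_yo_nerve (hE : IsDense E) [E.Full] :
    Nonempty (nerve E ⋙ nerve (yo ⋙ nerve E) ≅ 𝟭 (PSh k A)) := by
  have := nerve_faithful hE
  have := nerve_full hE
  -- The double nerve at `X` consists of the morphisms from the nerve of `Hom(-, X)` to the nerve of
  -- `P`. As `nerve E` is fully faithful, these are the morphisms `Hom(-, X) ⟶ P`, that is, the
  -- elements of `P(X)`.
  let α : 𝟭 (PSh k A) ⟶ nerve E ⋙ nerve (yo ⋙ nerve E) :=
    { app := fun P => PSh.homMk' (fun X =>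
        { toFun := fun p => nerveEl (yo ⋙ nerve E) ((nerve E).map (yoDesc p))
          map_add' := fun p q => by
            have : yoDesc (p + q) = yoDesc p + yoDesc q :=
              yo_hom_ext (by rw [PSh.app_add, yoDesc_app_id, yoDesc_app_id, yoDesc_app_id])
            rw [this, Functor.map_add]
            rfl
          map_smul' := fun c p => by
            have : yoDesc (c • p) = c • yoDesc p :=
              yo_hom_ext (by rw [PSh.app_smul, yoDesc_app_id, yoDesc_app_id])
            rw [this, Functor.map_smul]
            rfl }) (fun f p => by
          change nerveEl (yo ⋙ nerve E) ((nerve E).map (yoDesc (P.res f p))) =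
            PSh.res _ f (nerveEl (yo ⋙ nerve E) ((nerve E).map (yoDesc p)))
          rw [nerve_res, ← map_yoDesc, Functor.map_comp]
          rfl)
      naturality := fun P Q φ => PSh.hom_ext fun X p => by
        change nerveEl (yo ⋙ nerve E) ((nerve E).map (yoDesc (PSh.app φ X p))) =
          PSh.app ((nerve (yo ⋙ nerve E)).map ((nerve E).map φ)) X
            (nerveEl (yo ⋙ nerve E) ((nerve E).map (yoDesc p)))
        rw [nerve_app, ← yoDesc_comp, Functor.map_comp] }
  have : ∀ P, IsIso (α.app P) := fun P => PSh.isIso_of_bijective _ fun X => by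
    constructor
    · intro p q h
      have h1 : (nerve E).map (yoDesc p) = (nerve E).map (yoDesc q) := h
      rw [← yoDesc_app_id p, (nerve E).map_injective h1, yoDesc_app_id]
    · intro p
      obtain ⟨f, hf⟩ := (nerve E).map_surjective (nerveHom p)
      refine ⟨PSh.app f X (Day.yoEl k (𝟙 X)), ?_⟩
      change nerveEl (yo ⋙ nerve E) ((nerve E).map (yoDesc _)) = p
      rw [yoDesc_eq, hf, nerveEl_nerveHom]
  exact ⟨(@asIso _ _ _ _ α (NatIso.isIso_of_isIso_app α)).symm⟩

/-- Presheaves on a dense full subcategory of finitely generated projective presheaves. -/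
lemma nerve_isEquivalence (hE : IsDense E) [E.Full] [E.Faithful]
    (hproj : ∀ b, fgProj k A (E.obj b)) : (nerve E).IsEquivalence := by
  have := nerve_faithful hE
  have := nerve_full hE
  obtain ⟨e⟩ := nerve_yo_nerve hE
  -- Here projectivity enters: `E b` is a summand of a sum of representables, the additive functor
  -- `nerve E` preserves this, and the nerve of `E b` is `Hom(-, b)`.
  have hE' : IsDense (yo ⋙ nerve E) := fun b => by
    have h := ((fgProj_iff _).1 (hproj b)).map (nerve E)
      (W' := fun P => ∃ X, P = (yo ⋙ nerve E).obj X) (by rintro _ ⟨X, rfl⟩; exact ⟨X, rfl⟩)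
    exact h.of_retract (nerveUnit E b) (inv (nerveUnit E b)) (by simp)
  have := nerve_faithful hE'
  have := nerve_full hE'
  -- The second nerve is fully faithful by density and has the first as a right inverse up to
  -- isomorphism, so it is an equivalence, and then so is the first.
  have : (nerve (yo ⋙ nerve E)).EssSurj := ⟨fun P => ⟨(nerve E).obj P, ⟨e.app P⟩⟩⟩
  have : (nerve (yo ⋙ nerve E)).IsEquivalence := {}
  have : (nerve E ⋙ nerve (yo ⋙ nerve E)).IsEquivalence :=
    Functor.isEquivalence_of_iso e.symm
  exact Functor.isEquivalence_of_comp_right _ (nerve (yo ⋙ nerve E))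

end Nerve

end SemigroupModule

end

noncomputable section

namespace SemigroupModule

open Limits

/-! ### Cocontinuity of convolution -/

section Cocontinuity

variable {k : Type u} [Field k]
variable {A B C : Type u} [SmallCategory A] [SmallCategory B] [SmallCategory C]
  [Preadditive A] [Preadditive B] [Preadditive C] [Linear k A] [Linear k B] [Linear k C]

lemma IsBilinear.flip {T : A ⥤ B ⥤ C} (hT : IsBilinear k T) : IsBilinear k T.flip where
  add_left f g Y := hT.add_right Y f g
  smul_left c f Y := hT.smul_right Y c f
  add_right X _ _ f g := hT.add_left f g X
  smul_right X _ _ c f := hT.smul_left c f X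

namespace Day

variable {T : A ⥤ B ⥤ C} (hT : IsBilinear k T)

/-- The presheaf `R(T(-, K))`. -/
def slice (R : PSh k C) (K : B) : PSh k A :=
  PSh.mk' (fun H => R.val ((T.obj H).obj K)) (fun f => R.res ((T.map f).app K))
    (by intros; simp) (by intros; rw [Functor.map_comp, NatTrans.comp_app, PSh.res_comp])
    (by intros; rw [hT.add_left, PSh.res_add]) (by intros; rw [hT.smul_left, PSh.res_smul])

/-- The morphism `R(T(-, K')) ⟶ R(T(-, K))`. -/
def sliceMap (R : PSh k C) {K K' : B} (l : K ⟶ K') : slice hT R K' ⟶ slice hT R K :=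
  PSh.homMk' (fun H => R.res ((T.obj H).map l)) (fun {H H'} f p => by
    have key : ∀ r : R.val ((T.obj H').obj K'),
        R.res ((T.obj H).map l) (R.res ((T.map f).app K') r) =
          R.res ((T.map f).app K) (R.res ((T.obj H').map l) r) := fun r => by
      rw [← PSh.res_comp, ← PSh.res_comp, NatTrans.naturality]
    exact key p)

/-- The internal hom: the presheaf `K ↦ Hom(P, R(T(-, K)))`. -/
def ihom (P : PSh k A) (R : PSh k C) : PSh k B :=
  PSh.mk' (fun K => (P ⟶ slice hT R K))
    (fun l => Linear.rightComp k P (sliceMap hT R l))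
    (fun K φ => PSh.hom_ext fun H p => by
      have key : ∀ r : R.val ((T.obj H).obj K), R.res ((T.obj H).map (𝟙 K)) r = r := by simp
      exact key (PSh.app φ H p))
    (fun {K K' K''} l l' φ => PSh.hom_ext fun H p => by
      have key : ∀ r : R.val ((T.obj H).obj K''), R.res ((T.obj H).map (l ≫ l')) r =
          R.res ((T.obj H).map l) (R.res ((T.obj H).map l') r) := fun r => by
        rw [Functor.map_comp, PSh.res_comp]
      exact key (PSh.app φ H p))
    (fun {K K'} l l' φ => PSh.hom_ext fun H p => by
      have key : ∀ r : R.val ((T.obj H).obj K'), R.res ((T.obj H).map (l + l')) r =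
          R.res ((T.obj H).map l) r + R.res ((T.obj H).map l') r := fun r => by
        rw [hT.add_right, PSh.res_add]
      exact key (PSh.app φ H p))
    (fun {K K'} c l φ => PSh.hom_ext fun H p => by
      have key : ∀ r : R.val ((T.obj H).obj K'), R.res ((T.obj H).map (c • l)) r =
          c • R.res ((T.obj H).map l) r := fun r => by
        rw [hT.smul_right, PSh.res_smul]
      exact key (PSh.app φ H p))

section

variable {hT} {P : PSh k A} {Q : PSh k B} {R : PSh k C}

/-- Evaluation of an element of the internal hom. -/
def ev {K : B} (φ : (ihom hT P R).val K) (H : A) : P.val H →ₗ[k] R.val ((T.obj H).obj K) :=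
  PSh.app (P := P) (Q := slice hT R K) φ H

lemma ihom_ext {K : B} {φ ψ : (ihom hT P R).val K} (h : ∀ H p, ev φ H p = ev ψ H p) : φ = ψ :=
  PSh.hom_ext (P := P) (Q := slice hT R K) h

lemma ev_add {K : B} (φ ψ : (ihom hT P R).val K) (H : A) (p : P.val H) :
    ev (φ + ψ) H p = ev φ H p + ev ψ H p := rfl

lemma ev_smul {K : B} (c : k) (φ : (ihom hT P R).val K) (H : A) (p : P.val H) :
    ev (c • φ) H p = c • ev φ H p := rfl

lemma ev_res_left {K : B} (φ : (ihom hT P R).val K) {H H' : A}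
    (h : H ⟶ H') (p : P.val H') : ev φ H (P.res h p) = R.res ((T.map h).app K) (ev φ H' p) :=
  PSh.app_res (P := P) (Q := slice hT R K) φ h p

lemma ev_res_right {K K' : B} (l : K ⟶ K') (φ : (ihom hT P R).val K')
    (H : A) (p : P.val H) : ev ((ihom hT P R).res l φ) H p = R.res ((T.obj H).map l) (ev φ H p) :=
  rfl

variable (hT) in
/-- The element of the internal hom given by a morphism out of a convolution. -/
def curryVal (φ : dayObj T P Q ⟶ R) {K : B} (q : Q.val K) : (ihom hT P R).val K :=
  PSh.homMk' (P := P) (Q := slice hT R K)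
    (fun H => (PSh.app φ _).comp (elMid P (𝟙 ((T.obj H).obj K)) q))
    (fun {H H'} f p => by
      have key : PSh.app φ _ (el (𝟙 ((T.obj H).obj K)) (P.res f p) q) =
          R.res ((T.map f).app K) (PSh.app φ _ (el (𝟙 _) p q)) := by
        rw [el_id_left, PSh.app_res]
      exact key)

@[simp] lemma ev_curryVal (φ : dayObj T P Q ⟶ R) {K : B} (q : Q.val K) (H : A) (p : P.val H) :
    ev (curryVal hT φ q) H p = PSh.app φ _ (el (𝟙 _) p q) := rfl

variable (hT) in
/-- The morphism to the internal hom given by a morphism out of a convolution. -/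
def curry (φ : dayObj T P Q ⟶ R) : Q ⟶ ihom hT P R :=
  PSh.homMk' (fun K =>
    { toFun := fun q => curryVal hT φ q
      map_add' := fun q q' => ihom_ext fun H p => by
        rw [ev_add, ev_curryVal, ev_curryVal, ev_curryVal, el_add_right, map_add]
      map_smul' := fun c q => ihom_ext fun H p => by
        rw [RingHom.id_apply, ev_smul, ev_curryVal, ev_curryVal, el_smul_right, map_smul] })
    (fun {K K'} l q => ihom_ext fun H p => by
      have key : ev (curryVal hT φ (Q.res l q)) H p =
          ev ((ihom hT P R).res l (curryVal hT φ q)) H p := by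
        rw [ev_res_right, ev_curryVal, ev_curryVal, el_id_right, PSh.app_res]
      exact key)

lemma ev_curry (φ : dayObj T P Q ⟶ R) {K : B} (q : Q.val K) (H : A) (p : P.val H) :
    ev (PSh.app (curry hT φ) K q) H p = PSh.app φ _ (el (𝟙 _) p q) := rfl

/-- The morphism out of a convolution given by a morphism to the internal hom. -/
def uncurry (ψ : Q ⟶ ihom hT P R) : dayObj T P Q ⟶ R :=
  desc (fun H K p q => ev (PSh.app ψ K q) H p)
    (fun _ _ _ _ _ => map_add _ _ _) (fun _ _ _ _ _ => map_smul _ _ _)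
    (fun H K p q q' => by rw [map_add, ev_add]) (fun H K c p q => by rw [map_smul, ev_smul])
    (fun H H' K K' h l p q => by
      rw [ev_res_left, PSh.app_res, ev_res_right, PSh.res_comp])

lemma uncurry_el (ψ : Q ⟶ ihom hT P R) {H : A} {K : B} (p : P.val H) (q : Q.val K) :
    PSh.app (uncurry ψ) _ (el (𝟙 _) p q) = ev (PSh.app ψ K q) H p := by
  rw [uncurry, desc_el, PSh.res_id]

variable (hT P Q R) in
/-- The adjunction between convolution and internal hom. -/
def homEquiv : (dayObj T P Q ⟶ R) ≃ (Q ⟶ ihom hT P R) where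
  toFun := curry hT
  invFun := uncurry
  left_inv φ := hom_ext fun H K p q => by rw [uncurry_el, ev_curry]
  right_inv ψ := PSh.hom_ext fun K q => ihom_ext fun H p => by rw [ev_curry, uncurry_el]

lemma homEquiv_naturality {Q' : PSh k B} (ψ : Q ⟶ Q') (φ : dayObj T P Q' ⟶ R) :
    homEquiv hT P Q R (map T (𝟙 P) ψ ≫ φ) = ψ ≫ homEquiv hT P Q' R φ :=
  PSh.hom_ext fun K q => ihom_ext fun H p => by
    refine (ev_curry _ q H p).trans ?_
    rw [PSh.app_comp, PSh.app_comp, map_el, PSh.app_id]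
    exact (ev_curry φ _ H p).symm

end

include hT in
-- Convolution with `P` is left adjoint to the internal hom `ihom hT P`.
lemma preservesColimits_right (P : PSh k A) :
    PreservesColimitsOfSize.{u, u} ((dayExt T).obj P) :=
  (Adjunction.adjunctionOfEquivRight (F := (dayExt T).obj P) (G_obj := ihom hT P)
    (fun Q R => homEquiv hT P Q R)
    (fun _ _ _ ψ φ => homEquiv_naturality ψ φ)).leftAdjoint_preservesColimits

/-- The symmetry of convolution. -/
def swap (T : A ⥤ B ⥤ C) (P : PSh k A) (Q : PSh k B) : dayObj T P Q ⟶ dayObj T.flip Q P :=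
  desc (fun H K p q => el (T := T.flip) (𝟙 _) q p)
    (fun _ _ _ _ _ => el_add_right _ _ _ _) (fun _ _ _ _ _ => el_smul_right _ _ _ _)
    (fun _ _ _ _ _ => el_add_mid _ _ _ _) (fun _ _ _ _ _ => el_smul_mid _ _ _ _)
    (fun H H' K K' h l p q => by
      rw [← el_comp (T := T.flip), ← NatTrans.naturality]
      erw [res_el (T := T.flip)]
      congr 1
      simp)

lemma swap_el (P : PSh k A) (Q : PSh k B) {X : C} {H : A} {K : B} (f : X ⟶ (T.obj H).obj K)
    (p : P.val H) (q : Q.val K) : PSh.app (swap T P Q) X (el f p q) = el (T := T.flip) f q p := by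
  rw [swap, desc_el]
  erw [res_el (T := T.flip)]
  congr 1
  simp

/-- The symmetry isomorphism of convolution, natural in the first variable. -/
def swapIso (T : A ⥤ B ⥤ C) (Q : PSh k B) :
    (dayExt T).flip.obj Q ≅ (dayExt (k := k) T.flip).obj Q :=
  NatIso.ofComponents (fun P =>
    { hom := swap T P Q
      inv := swap T.flip Q P
      hom_inv_id := hom_ext fun H K p q =>
        (congrArg (PSh.app (swap T.flip Q P) _) (swap_el P Q _ p q)).trans
          (swap_el (T := T.flip) Q P _ q p)
      inv_hom_id := hom_ext fun K H q p =>
        (congrArg (PSh.app (swap T P Q) _) (swap_el (T := T.flip) Q P _ q p)).trans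
          (swap_el P Q _ p q) })
    (fun {P P'} φ => hom_ext fun H K p q => by
      change PSh.app (swap T P' Q) _ (PSh.app (map T φ (𝟙 Q)) _ (el (𝟙 _) p q)) =
        PSh.app (map T.flip (𝟙 Q) φ) _ (PSh.app (swap T P Q) _ (el (𝟙 _) p q))
      rw [map_el, swap_el, swap_el, map_el])

include hT in
-- Exchanging the two variables reduces this to `preservesColimits_right` for the flipped bifunctor.
lemma preservesColimits_left (Q : PSh k B) :
    PreservesColimitsOfSize.{u, u} ((dayExt (k := k) T).flip.obj Q) := by
  have := preservesColimits_right hT.flip Q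
  exact preservesColimits_of_natIso (swapIso T Q).symm

end Day

end Cocontinuity

end SemigroupModule

end

noncomputable section

namespace SemigroupModule

/-! ### Unit coherence in monoidal and module categories -/

section Units

variable {k : Type u} [Field k] {S : Type u₁} [Category.{v₁} S] [Preadditive S] [Linear k S]
  {σ : SemigroupStr k S} {M : Type u₂} [Category.{v₂} M] [Preadditive M] [Linear k M]

namespace UnitStr

/-- The monoidal category given by a semigroup category with a unit. -/
@[reducible]
def monoidalCategory (U : UnitStr σ) : MonoidalCategory S where
  tensorObj X Y := σ.prod X Y
  whiskerLeft X _ _ f := σ.wl X f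
  whiskerRight f X := σ.wr f X
  tensorHom {_ Y X' _} f g := σ.wr f X' ≫ σ.wl Y g
  tensorUnit := U.unit
  associator X Y Z := σ.assoc X Y Z
  leftUnitor X := U.leftUnitor.app X
  rightUnitor X := U.rightUnitor.app X
  tensorHom_def _ _ := rfl
  id_tensorHom_id X Y := by simp [SemigroupStr.wr, SemigroupStr.wl]
  tensorHom_comp_tensorHom f g h i := by simp [SemigroupStr.wr, SemigroupStr.wl]
  whiskerLeft_id X Y := (σ.tensor.obj X).map_id Y
  id_whiskerRight X Y := by simp [SemigroupStr.wr]
  associator_naturality {X₁ X₂ X₃ Y₁ Y₂ Y₃} f₁ f₂ f₃ := by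
    simp only [SemigroupStr.wl, SemigroupStr.wr, Functor.map_comp, NatTrans.comp_app,
      Category.assoc]
    rw [σ.assoc_nat_right, reassoc_of% (σ.assoc_nat_mid Y₁ f₂ X₃),
      reassoc_of% (σ.assoc_nat_left f₁ X₂ X₃)]
  leftUnitor_naturality f := U.leftUnitor.hom.naturality f
  rightUnitor_naturality f := U.rightUnitor.hom.naturality f
  pentagon W X Y Z := σ.pentagon W X Y Z
  triangle X Y := U.triangle X Y

variable (U : UnitStr σ)

/-- The right unit isomorphism of a tensor product. -/
lemma rightUnitor_prod (X Y : S) : U.rightUnitor.hom.app (σ.prod X Y) =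
    (σ.assoc X Y U.unit).hom ≫ σ.wl X (U.rightUnitor.hom.app Y) :=
  letI := U.monoidalCategory
  MonoidalCategory.rightUnitor_tensor_hom X Y

/-- Two units are isomorphic. -/
def unitIso (U U' : UnitStr σ) : U.unit ≅ U'.unit :=
  (U'.rightUnitor.app U.unit).symm ≪≫ U.leftUnitor.app U'.unit

/-- The triangle axiom for all objects follows from its instance for the unit object. -/
lemma module_triangle {μ : ModuleStr σ M} (l : μ.act.obj U.unit ≅ 𝟭 M)
    (h : ∀ Y : M, (μ.assoc U.unit U.unit Y).hom ≫ (μ.act.obj U.unit).map (l.hom.app Y) =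
      (μ.act.map (U.rightUnitor.hom.app U.unit)).app Y) (X : S) (Y : M) :
    (μ.assoc X U.unit Y).hom ≫ (μ.act.obj X).map (l.hom.app Y) =
      (μ.act.map (U.rightUnitor.hom.app X)).app Y := by
  -- The pentagon transfers the triangle from the unit object to objects `X ⊠ 1`. Naturality along
  -- the isomorphism `X ⊠ 1 ≅ X` then removes the extra factor.
  have h1 : (μ.assoc (σ.prod X U.unit) U.unit Y).hom ≫
      (μ.act.obj (σ.prod X U.unit)).map (l.hom.app Y) =
        (μ.act.map (U.rightUnitor.hom.app (σ.prod X U.unit))).app Y := by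
    rw [← cancel_mono (μ.assoc X U.unit Y).hom, Category.assoc]
    have e1 := μ.assoc_nat_right X U.unit (l.hom.app Y)
    simp only [Functor.id_obj] at e1
    rw [e1, ← reassoc_of% (μ.pentagon X U.unit U.unit Y), ← Functor.map_comp, h,
      ← μ.assoc_nat_mid, rightUnitor_prod, Functor.map_comp, NatTrans.comp_app, Category.assoc]
    rfl
  have e := μ.assoc_nat_left (U.rightUnitor.hom.app X) U.unit Y
  have e2 := (μ.act.map (U.rightUnitor.hom.app X)).naturality (l.hom.app Y)
  have e3 := congrArg (fun t => (μ.act.map t).app Y)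
    (U.rightUnitor.hom.naturality (U.rightUnitor.hom.app X))
  simp only [Functor.flip_obj_map, Functor.id_map, Functor.map_comp, NatTrans.comp_app] at e3
  have : IsIso ((μ.act.map ((σ.tensor.map (U.rightUnitor.hom.app X)).app U.unit)).app Y) := by
    have : IsIso ((σ.tensor.map (U.rightUnitor.hom.app X)).app U.unit) :=
      (NatIso.isIso_app_of_isIso (σ.tensor.map (U.rightUnitor.hom.app X)) U.unit)
    infer_instance
  rw [← cancel_epi ((μ.act.map ((σ.tensor.map (U.rightUnitor.hom.app X)).app U.unit)).app Y)]
  refine ((reassoc_of% e) _).trans ?_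
  refine (congrArg (fun t => _ ≫ t) e2.symm).trans ?_
  refine ((reassoc_of% h1) _).trans ?_
  exact e3.symm

/-- A module category on which the unit object acts as the identity is monoidal. -/
lemma isMonoidalModule_of_iso (μ : ModuleStr σ M) (e : μ.act.obj U.unit ≅ 𝟭 M) :
    U.IsMonoidalModule μ := by
  -- The isomorphism `e` serves only to make `1 ⋆ -` fully faithful. The actual unitor `l` is the
  -- map whose image under `1 ⋆ -` is what the triangle at the unit object prescribes.
  have : (μ.act.obj U.unit).Full := .of_iso e.symm
  have : (μ.act.obj U.unit).Faithful := .of_iso e.symm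
  let c : ∀ Y : M, (μ.act.obj U.unit).obj Y ≅ Y := fun Y =>
    (μ.act.obj U.unit).preimageIso ((μ.assoc U.unit U.unit Y).symm ≪≫
      (μ.act.mapIso (U.rightUnitor.app U.unit)).app Y)
  have hc : ∀ Y, (μ.act.obj U.unit).map (c Y).hom = (μ.assoc U.unit U.unit Y).inv ≫
      (μ.act.map (U.rightUnitor.hom.app U.unit)).app Y := fun Y => by simp [c]
  let l : μ.act.obj U.unit ≅ 𝟭 M := NatIso.ofComponents c fun {Y Y'} f => by
    apply (μ.act.obj U.unit).map_injective
    have e1 := μ.assoc_nat_right U.unit U.unit f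
    replace e1 : (μ.act.obj U.unit).map ((μ.act.obj U.unit).map f) ≫
        (μ.assoc U.unit U.unit Y').inv = (μ.assoc U.unit U.unit Y).inv ≫
          (μ.act.obj (σ.prod U.unit U.unit)).map f := by
      rw [Iso.comp_inv_eq, Category.assoc, Iso.eq_inv_comp, e1]
    have hn : (μ.act.obj U.unit).map ((μ.act.obj U.unit).map f) ≫
        (μ.act.obj U.unit).map (c Y').hom =
          (μ.act.obj U.unit).map (c Y).hom ≫ (μ.act.obj U.unit).map f := by
      rw [hc, hc, reassoc_of% e1, Category.assoc]
      exact congrArg (fun t => _ ≫ t) ((μ.act.map (U.rightUnitor.hom.app U.unit)).naturality f)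
    rw [← Functor.map_comp, ← Functor.map_comp] at hn
    exact hn
  exact ⟨l, U.module_triangle l fun Y => by simp [l, hc]⟩

/-- The left unit isomorphism of a monoidal module category at `K ⋆ X`. -/
lemma module_leftUnitor {μ : ModuleStr σ M} (l : μ.act.obj U.unit ≅ 𝟭 M)
    (h : ∀ (X : S) (Y : M), (μ.assoc X U.unit Y).hom ≫ (μ.act.obj X).map (l.hom.app Y) =
      (μ.act.map (U.rightUnitor.hom.app X)).app Y) (K : S) (X : M) :
    (μ.assoc U.unit K X).hom ≫ l.hom.app ((μ.act.obj K).obj X) =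
      (μ.act.map (U.leftUnitor.hom.app K)).app X := by
  -- Kelly's argument: the identity is checked after acting by `1`, where the pentagon and both
  -- triangles apply.
  have : (μ.act.obj U.unit).Faithful := .of_iso l.symm
  apply (μ.act.obj U.unit).map_injective
  rw [← cancel_epi (μ.assoc U.unit (σ.prod U.unit K) X).hom,
    ← cancel_epi ((μ.act.map (σ.assoc U.unit U.unit K).hom).app X), Functor.map_comp]
  have e1 := μ.pentagon U.unit U.unit K X
  have e2 := congrArg (fun t => (μ.act.map t).app X) (U.triangle U.unit K)
  simp only [Functor.map_comp, NatTrans.comp_app] at e2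
  have e3 := μ.assoc_nat_mid U.unit (U.leftUnitor.hom.app K) X
  have e4 := μ.assoc_nat_left (U.rightUnitor.hom.app U.unit) K X
  refine ((reassoc_of% e1) _).trans ?_
  refine (congrArg (fun t => _ ≫ t) (h U.unit _)).trans ?_
  refine e4.symm.trans ?_
  refine (congrArg (fun t => t ≫ _) e2.symm).trans ?_
  rw [Category.assoc]
  exact congrArg (fun t => _ ≫ t) e3

end UnitStr

end Units

end SemigroupModule

end

noncomputable section

namespace SemigroupModule

/-! ### Counits acting on module categories, and their splittings -/

section Counits

variable {k : Type u} [Field k] {S : Type u₁} [Category.{v₁} S] [Preadditive S] [Linear k S]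
  {σ : SemigroupStr k S} {M : Type u₂} [Category.{v₂} M] [Preadditive M] [Linear k M]
  {F G : S}

namespace DualPair

/-- The action on a module category of the counit of an adjunction. -/
structure CounitOn (adj : DualPair σ F G) (μ : ModuleStr σ M) where
  e : ∀ X : M, (μ.act.obj (σ.prod F G)).obj X ⟶ X
  nat : ∀ {X Y : M} (f : X ⟶ Y), (μ.act.obj (σ.prod F G)).map f ≫ e Y = e X ≫ f
  left : ∀ (H : S) (X : M), (μ.assoc H (σ.prod F G) X).hom ≫ (μ.act.obj H).map (e X) =
    (μ.act.map (adj.epsL H)).app X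
  right : ∀ (H : S) (X : M), (μ.assoc (σ.prod F G) H X).hom ≫ e ((μ.act.obj H).obj X) =
    (μ.act.map (adj.epsR H)).app X

/-- The action on a module category of the unit of an adjunction. -/
structure UnitOn (adj : DualPair σ F G) (μ : ModuleStr σ M) where
  n : ∀ X : M, X ⟶ (μ.act.obj (σ.prod G F)).obj X
  nat : ∀ {X Y : M} (f : X ⟶ Y), f ≫ n Y = n X ≫ (μ.act.obj (σ.prod G F)).map f
  left : ∀ (H : S) (X : M), (μ.act.map (adj.etaL H)).app X ≫ (μ.assoc H (σ.prod G F) X).hom =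
    (μ.act.obj H).map (n X)
  right : ∀ (H : S) (X : M), (μ.act.map (adj.etaR H)).app X ≫ (μ.assoc (σ.prod G F) H X).hom =
    n ((μ.act.obj H).obj X)

variable {adj : DualPair σ F G} {μ : ModuleStr σ M}

lemma map_app_comp (μ : ModuleStr σ M) {G H K : S} (f : G ⟶ H) (g : H ⟶ K) (X : M) :
    (μ.act.map (f ≫ g)).app X = (μ.act.map f).app X ≫ (μ.act.map g).app X := by
  rw [Functor.map_comp, NatTrans.comp_app]

lemma map_app_id (μ : ModuleStr σ M) (G : S) (X : M) : (μ.act.map (𝟙 G)).app X = 𝟙 _ := by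
  rw [CategoryTheory.Functor.map_id, NatTrans.id_app]

/-- `d.left` turns `F ⋆ n_X` into `ηˡ_F ⋆ X` and `c.right` turns the counit at `F ⋆ X` into `εʳ_F ⋆
X`. Up to the pentagon the composite is the image under `- ⋆ X` of the zigzag identity for `F`. -/
lemma CounitOn.left_triangle (c : adj.CounitOn μ) (d : adj.UnitOn μ) (X : M) :
    (μ.act.obj F).map (d.n X ≫ (μ.assoc G F X).hom) ≫
      (μ.assoc F G ((μ.act.obj F).obj X)).inv ≫ c.e ((μ.act.obj F).obj X) = 𝟙 _ := by
  have h2 := c.right F X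
  have h3 := μ.pentagon F G F X
  rw [← Iso.eq_inv_comp] at h2
  rw [Functor.map_comp, ← d.left F X, h2, ← map_app_id, ← adj.zigzag, map_app_comp, map_app_comp]
  simp only [Category.assoc]
  congr 1
  rw [← cancel_epi ((μ.act.map (σ.assoc F G F).hom).app X), reassoc_of% h3, Iso.hom_inv_id_assoc,
    Iso.hom_inv_id_assoc, ← Category.assoc, ← map_app_comp, Iso.hom_inv_id, map_app_id,
    Category.id_comp]

/-- Here `d.right` and `c.left` produce `ηʳ_G` and `εˡ_G`, and the zigzag identity for `G` applies.
-/
lemma CounitOn.right_triangle (c : adj.CounitOn μ) (d : adj.UnitOn μ) (X : M) :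
    (d.n ((μ.act.obj G).obj X) ≫ (μ.assoc G F ((μ.act.obj G).obj X)).hom) ≫
      (μ.act.obj G).map ((μ.assoc F G X).inv ≫ c.e X) = 𝟙 _ := by
  have h3 := μ.pentagon G F G X
  rw [Functor.map_comp, ← d.right G X, ← map_app_id, ← adj.zigzag', map_app_comp, map_app_comp,
    ← c.left G X]
  simp only [Category.assoc]
  have h6 : (μ.act.obj G).map (μ.assoc F G X).hom ≫ (μ.act.obj G).map (μ.assoc F G X).inv ≫
      (μ.act.obj G).map (c.e X) = (μ.act.obj G).map (c.e X) := by
    rw [← Category.assoc, ← Functor.map_comp, Iso.hom_inv_id, CategoryTheory.Functor.map_id,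
      Category.id_comp]
  rw [← reassoc_of% h3, h6]

/-- The adjunction on a module category given by the actions of its unit and counit. -/
def adjunctionOn (c : adj.CounitOn μ) (d : adj.UnitOn μ) : μ.act.obj F ⊣ μ.act.obj G :=
  Adjunction.mkOfUnitCounit
    { unit :=
        { app := fun X => d.n X ≫ (μ.assoc G F X).hom
          naturality := fun X Y f => by
            have key : f ≫ d.n Y ≫ (μ.assoc G F Y).hom =
                (d.n X ≫ (μ.assoc G F X).hom) ≫ (μ.act.obj G).map ((μ.act.obj F).map f) := by
              rw [reassoc_of% (d.nat f), μ.assoc_nat_right G F f, Category.assoc]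
            exact key }
      counit :=
        { app := fun X => (μ.assoc F G X).inv ≫ c.e X
          naturality := fun X Y f => by
            have key : (μ.act.obj F).map ((μ.act.obj G).map f) ≫ (μ.assoc F G Y).inv ≫ c.e Y =
                ((μ.assoc F G X).inv ≫ c.e X) ≫ f := by
              rw [Category.assoc, ← c.nat, ← Category.assoc, ← Category.assoc]
              congr 1
              rw [Iso.comp_inv_eq, Category.assoc, μ.assoc_nat_right F G f, Iso.inv_hom_id_assoc]
            exact key }
      left_triangle := by
        ext X
        simpa using c.left_triangle d X
      right_triangle := by
        ext X
        simpa using c.right_triangle d X }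

lemma adjunctionOn_counit_app (c : adj.CounitOn μ) (d : adj.UnitOn μ) (X : M) :
    (adjunctionOn c d).counit.app X = (μ.assoc F G X).inv ≫ c.e X := rfl

lemma respected_of_counitOn (c : adj.CounitOn μ) (d : adj.UnitOn μ) : adj.Respected μ := by
  refine ⟨adjunctionOn c d, fun H X => ⟨?_, ?_⟩⟩
  · change _ = (μ.act.obj H).map (d.n X ≫ (μ.assoc G F X).hom)
    rw [Functor.map_comp, ← d.left, Category.assoc]
  · change _ ≫ _ ≫ (μ.act.obj H).map ((μ.assoc F G X).inv ≫ c.e X) = _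
    rw [← Functor.map_comp, Iso.hom_inv_id_assoc, c.left]

/-- Objects are summands of sums of `H ⋆ Y`, and `H` is a summand of a sum of `F ⊠ K`, while `(F ⊠
K) ⋆ Y ≅ F ⋆ (K ⋆ Y)`. -/
lemma isLiberal_act (hF : IsLiberal (σ.tensor.obj F)) (hμ : μ.Spans) :
    IsLiberal (μ.act.obj F) := by
  intro X
  refine (hμ X).trans ?_
  rintro _ ⟨H, Y, rfl⟩
  have : (μ.act.flip.obj Y).Additive := ⟨fun {H H' f g} => μ.bilinear.add_left f g Y⟩
  refine IsSummandOfSum.trans (W := fun Z => ∃ K, Z = (μ.act.obj (σ.prod F K)).obj Y)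
    ((hF H).map (μ.act.flip.obj Y) ?_) ?_
  · rintro _ ⟨K, rfl⟩
    exact ⟨K, rfl⟩
  · rintro _ ⟨K, rfl⟩
    exact .of_mem (μ.assoc F K Y).hom (μ.assoc F K Y).inv (Iso.hom_inv_id _)
      ⟨(μ.act.obj K).obj Y, rfl⟩

/-- In a module category which respects the adjunction and is spanned by the action, the counit
acts by split epimorphisms. -/
lemma Respected.exists_counitOn (h : adj.Respected μ) (hF : IsLiberal (σ.tensor.obj F))
    (hμ : μ.Spans) : ∃ c : adj.CounitOn μ, ∀ X, ∃ s, s ≫ c.e X = 𝟙 X := by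
  obtain ⟨a, h⟩ := h
  -- At objects `F ⋆ Z` the section is `F ⋆ η_Z`, by the triangle identity; liberality propagates
  -- it.
  have hs : ∀ X, ∃ s, s ≫ a.counit.app X = 𝟙 X := by
    intro X
    refine (isLiberal_act hF hμ X).exists_section a.counit ?_
    rintro _ ⟨Z, rfl⟩
    exact ⟨_, a.left_triangle_components Z⟩
  have hG : (μ.act.obj G).Faithful := by
    have : ∀ X, Epi (a.counit.app X) := fun X => by
      obtain ⟨s, hs⟩ := hs X
      exact (SplitEpi.mk s hs).epi
    exact a.faithful_R_of_epi_counit_app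
  refine ⟨{ e := fun X => (μ.assoc F G X).hom ≫ a.counit.app X
            nat := fun {X Y} f => ?_
            left := fun H X => ?_
            right := fun H X => ?_ }, fun X => ?_⟩
  · have := a.counit.naturality f
    simp only [Functor.comp_map, Functor.id_map] at this
    rw [reassoc_of% (μ.assoc_nat_right F G f), this, Category.assoc]
  · rw [Functor.map_comp, (h H X).2]
  -- Respecting the adjunction only constrains the counit after acting by an object on the left,
  -- where `εˡ` appears. Acting by `G` loses nothing, and there `eps_compat` exchanges `εˡ_G ⊠ H`
  -- for `G ⊠ εʳ_H`.
  · apply (μ.act.obj G).map_injective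
    rw [← cancel_epi (μ.assoc G (σ.prod (σ.prod F G) H) X).hom,
      ← cancel_epi ((μ.act.map (σ.assoc G (σ.prod F G) H).hom).app X)]
    have e1 := μ.pentagon G (σ.prod F G) H X
    have e2 := congrArg (fun t => (μ.act.map t).app X) (adj.eps_compat G H)
    simp only [Functor.map_comp, NatTrans.comp_app] at e2
    have e3 := μ.assoc_nat_mid G (adj.epsR H) X
    have e4 := μ.assoc_nat_left (adj.epsL G) H X
    have e5 := (h G ((μ.act.obj H).obj X)).2
    rw [Functor.map_comp, Functor.map_comp]
    refine ((reassoc_of% e1) _).trans ?_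
    rw [e5]
    refine e4.symm.trans ?_
    refine (congrArg (fun t => t ≫ _) e2.symm).trans ?_
    rw [Category.assoc]
    exact congrArg (fun t => _ ≫ t) e3
  · obtain ⟨s, hs⟩ := hs X
    exact ⟨s ≫ (μ.assoc F G X).inv, by simpa using hs⟩

/-- The counit acting on the semigroup category itself. -/
def regularCounitOn (adj : DualPair σ F G) : adj.CounitOn σ.regular where
  e := adj.epsR
  nat := adj.epsR_nat
  left := adj.eps_compat
  right := adj.epsR_module

/-- The triangle identity for `(F ⊠ -) ⊣ (G ⊠ -)` gives a section at `F ⊠ Z`, and all objects are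
summands of sums of these. -/
lemma exists_section_epsR (adj : DualPair σ F G) (hF : IsLiberal (σ.tensor.obj F)) (X : S) :
    ∃ s, s ≫ adj.epsR X = 𝟙 X := by
  refine (hF X).exists_section (T := σ.tensor.obj (σ.prod F G))
    { app := adj.epsR, naturality := fun _ _ f => adj.epsR_nat f } ?_
  rintro _ ⟨Z, rfl⟩
  exact ⟨σ.wl F (adj.etaR Z) ≫ σ.wl F (σ.assoc G F Z).hom ≫ (σ.assoc F G (σ.prod F Z)).inv,
    by simpa using adj.triangleR Z⟩

/-- Tensoring on the right with dual objects are adjoint functors. -/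
def rightAdjunction (adj : DualPair σ F G) : σ.tensor.flip.obj G ⊣ σ.tensor.flip.obj F :=
  Adjunction.mkOfUnitCounit
    { unit :=
        { app := fun X => adj.etaL X ≫ (σ.assoc X G F).inv
          naturality := fun X Y f => by
            have key : f ≫ adj.etaL Y ≫ (σ.assoc Y G F).inv =
                (adj.etaL X ≫ (σ.assoc X G F).inv) ≫ σ.wr (σ.wr f G) F := by
              rw [← Category.assoc, adj.etaL_nat, Category.assoc, Category.assoc]
              congr 1
              rw [Iso.comp_inv_eq, Category.assoc, σ.assoc_nat_left f G F, Iso.inv_hom_id_assoc]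
            exact key }
      counit :=
        { app := fun X => (σ.assoc X F G).hom ≫ adj.epsL X
          naturality := fun X Y f => by
            have key : σ.wr (σ.wr f F) G ≫ (σ.assoc Y F G).hom ≫ adj.epsL Y =
                ((σ.assoc X F G).hom ≫ adj.epsL X) ≫ f := by
              have := σ.assoc_nat_left f F G
              rw [reassoc_of% this, Category.assoc, ← adj.epsL_nat]
            exact key }
      left_triangle := by
        ext X
        have := adj.triangleL X
        simpa using this
      right_triangle := by
        ext X
        have := adj.triangleL' X
        simpa using this }

lemma conjugateEquiv_symm_sum {C : Type u₁} [Category.{v₁} C] [Preadditive C] {L R : C ⥤ C}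
    (a : L ⊣ R) [L.Additive] {I : Type*} (s : Finset I) (φ : I → (R ⟶ R)) :
    (conjugateEquiv a a).symm (∑ i ∈ s, φ i) = ∑ i ∈ s, (conjugateEquiv a a).symm (φ i) := by
  refine map_sum (AddMonoidHom.mk' (conjugateEquiv a a).symm fun φ ψ => ?_) φ s
  ext X
  simp [conjugateEquiv_symm_apply_app]

/-- The objects `K ⊠ X` are summands of sums of objects of the form `W ⊠ G`, where `G` is the right
dual of an object which generates under right multiplication. -/
lemma isSummandOfSum_prod (hσ : IsRigid σ) (adj : DualPair σ F G)
    (hF : IsLiberal (σ.tensor.obj F)) (K X : S) :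
    IsSummandOfSum (fun Z => ∃ W, Z = σ.prod W G) (σ.prod K X) := by
  -- `Y` is a left dual of `X`, so `- ⊠ X` is left adjoint to `- ⊠ Y`. Liberality is applied to `Y`,
  -- and passing to mates will reverse the decomposition.
  obtain ⟨Y, ⟨p⟩⟩ := (hσ X).2
  obtain ⟨n, V, f, g, hV, h⟩ := hF Y
  choose Z hZ using hV
  obtain rfl : V = fun i => σ.prod F (Z i) := funext hZ
  choose Z' q using fun i => (hσ (Z i)).1
  have q := fun i => (q i).some
  let a := p.rightAdjunction
  -- With `Z' i` a right dual of `Z i`, this says that `(- ⊠ Z' i) ⊠ G` is left adjoint to `(- ⊠ F)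
  -- ⊠ Z i`.
  let b := fun i => (q i).rightAdjunction.comp adj.rightAdjunction
  have hadd : ∀ X : S, (σ.tensor.flip.obj X).Additive := fun X =>
    ⟨fun {H H' f g} => σ.bilinear.add_left f g X⟩
  let asc : ∀ i, σ.tensor.flip.obj (σ.prod F (Z i)) ≅
      σ.tensor.flip.obj F ⋙ σ.tensor.flip.obj (Z i) := fun i =>
    NatIso.ofComponents (fun W => (σ.assoc W F (Z i)).symm) fun {W W'} w => by
      have := σ.assoc_nat_left w F (Z i)
      simp only [Functor.comp_map, Functor.flip_obj_map, Iso.symm_hom]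
      rw [Iso.comp_inv_eq, Category.assoc, this, Iso.inv_hom_id_assoc]
  let φ := fun i => σ.tensor.flip.map (f i) ≫ (asc i).hom
  let γ := fun i => (asc i).inv ≫ σ.tensor.flip.map (g i)
  have hφ : ∑ i, φ i ≫ γ i = 𝟙 _ := by
    have : ∀ i, φ i ≫ γ i = σ.tensor.flip.map (f i ≫ g i) := fun i => by simp [φ, γ]
    simp_rw [this]
    have hf : σ.tensor.flip.Additive := ⟨fun {H H' f g} => by
      ext W; exact σ.bilinear.add_right W f g⟩
    rw [← Functor.map_sum, h, CategoryTheory.Functor.map_id]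
  -- The mates of the `γ i` and `φ i` decompose the identity of `- ⊠ X` through the functors `(- ⊠
  -- Z' i) ⊠ G`; evaluation at `K` gives the claim. Working with functors avoids any need for a
  -- unit.
  refine ⟨n, fun i => (σ.tensor.flip.obj (Z' i) ⋙ σ.tensor.flip.obj G).obj K,
    fun i => ((conjugateEquiv (b i) a).symm (γ i)).app K,
    fun i => ((conjugateEquiv a (b i)).symm (φ i)).app K, fun i => ⟨_, rfl⟩, ?_⟩
  have h2 := congrArg (fun t => ((conjugateEquiv a a).symm t).app K) hφ
  simp only [conjugateEquiv_symm_sum, conjugateEquiv_symm_id] at h2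
  have h3 : ∀ i, ((conjugateEquiv (b i) a).symm (γ i)) ≫ ((conjugateEquiv a (b i)).symm (φ i)) =
      (conjugateEquiv a a).symm (φ i ≫ γ i) := fun i => conjugateEquiv_symm_comp a (b i) a _ _
  simp_rw [← NatTrans.comp_app, h3]
  rw [← NatTrans.app_sum]
  exact h2

/-- Every object is a summand of a sum of `F ⊠ Z`, hence by `isSummandOfSum_prod` of a sum of `W ⊠
G`, where the triangle identity for `(- ⊠ G) ⊣ (- ⊠ F)` splits `εˡ`. -/
lemma exists_section_epsL (hσ : IsRigid σ) (adj : DualPair σ F G)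
    (hF : IsLiberal (σ.tensor.obj F)) (X : S) : ∃ s, s ≫ adj.epsL X = 𝟙 X := by
  refine IsSummandOfSum.exists_section (T := σ.tensor.flip.obj (σ.prod F G))
    { app := adj.epsL, naturality := fun _ _ f => adj.epsL_nat f }
    (W := fun Z => ∃ W, Z = σ.prod W G) ?_ ?_
  · refine (hF X).trans ?_
    rintro _ ⟨Z, rfl⟩
    exact isSummandOfSum_prod hσ adj hF F Z
  · rintro _ ⟨W, rfl⟩
    exact ⟨σ.wr (adj.etaL W) G ≫ σ.wr (σ.assoc W G F).inv G ≫ (σ.assoc (σ.prod W G) F G).hom,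
      by simpa using adj.triangleL W⟩

end DualPair

end Counits

end SemigroupModule

end

noncomputable section

namespace SemigroupModule

open Day

/-! ### The unit presheaf and its actions -/

section UnitPresheaf

variable {k : Type u} [Field k] {S : Type u} [SmallCategory S] [Preadditive S] [Linear k S]
  {σ : SemigroupStr k S} {M : Type u} [SmallCategory M] [Preadditive M] [Linear k M] {F G : S}

namespace DualPair

variable (adj : DualPair σ F G)

lemma unit_stable {X Y : S} (f : X ⟶ Y) (a : (yo (k := k).obj (σ.prod F G)).val Y)
    (ha : a ∈ LinearMap.range (PSh.app (yo (k := k).map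
      (adj.epsL (σ.prod F G) - adj.epsR (σ.prod F G))) Y)) :
    (yo (k := k).obj (σ.prod F G)).res f a ∈ LinearMap.range (PSh.app (yo (k := k).map
      (adj.epsL (σ.prod F G) - adj.epsR (σ.prod F G))) X) := by
  obtain ⟨b, rfl⟩ := ha
  exact ⟨_, PSh.app_res _ f b⟩

/-- The unit presheaf: the coequalizer of the two morphisms from
`Hom(-, (F ⊠ G) ⊠ (F ⊠ G))` to `Hom(-, F ⊠ G)` given by the counits. -/
def unitObj : PSh k S :=
  PSh.quotient (yo.obj (σ.prod F G))
    (fun X => LinearMap.range (PSh.app (yo (k := k).map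
      (adj.epsL (σ.prod F G) - adj.epsR (σ.prod F G))) X)) adj.unit_stable

/-- The class of a morphism to `F ⊠ G`. -/
def unitCls {X : S} (a : X ⟶ σ.prod F G) : (adj.unitObj (k := k)).val X :=
  PSh.app (PSh.quotientMk adj.unit_stable) X (yoEl k a)

variable {adj}

lemma exists_unitCls {X : S} (x : (adj.unitObj (k := k)).val X) : ∃ a, adj.unitCls a = x :=
  PSh.quotientMk_surjective adj.unit_stable X x

lemma res_unitCls {X Y : S} (f : X ⟶ Y) (a : Y ⟶ σ.prod F G) :
    (adj.unitObj (k := k)).res f (adj.unitCls a) = adj.unitCls (f ≫ a) :=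
  (PSh.app_res (PSh.quotientMk adj.unit_stable) f (yoEl k a)).symm

lemma unitCls_eps {X : S} (b : X ⟶ σ.prod (σ.prod F G) (σ.prod F G)) :
    adj.unitCls (k := k) (b ≫ adj.epsL (σ.prod F G)) =
      adj.unitCls (b ≫ adj.epsR (σ.prod F G)) := by
  rw [← sub_eq_zero]
  refine (map_sub (PSh.app (PSh.quotientMk adj.unit_stable) X)
    (yoEl k (b ≫ adj.epsL (σ.prod F G))) (yoEl k (b ≫ adj.epsR (σ.prod F G)))).symm.trans ?_
  exact (PSh.quotientMk_eq_zero adj.unit_stable).2 ⟨yoEl k b, Preadditive.comp_sub b _ _⟩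

/-- Linear maps out of the unit presheaf. -/
def unitLift {X : S} {V : Type u} [AddCommGroup V] [Module k V]
    (t : (yo (k := k).obj (σ.prod F G)).val X →ₗ[k] V)
    (ht : ∀ b : X ⟶ σ.prod (σ.prod F G) (σ.prod F G),
      t (yoEl k (b ≫ adj.epsL (σ.prod F G))) = t (yoEl k (b ≫ adj.epsR (σ.prod F G)))) :
    (adj.unitObj (k := k)).val X →ₗ[k] V :=
  (LinearMap.range (PSh.app (yo (k := k).map
    (adj.epsL (σ.prod F G) - adj.epsR (σ.prod F G))) X)).liftQ t (by
      rintro _ ⟨b, rfl⟩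
      have e : PSh.app (yo (k := k).map (adj.epsL (σ.prod F G) - adj.epsR (σ.prod F G))) X b =
        yoEl k ((b : X ⟶ _) ≫ adj.epsL (σ.prod F G)) - yoEl k ((b : X ⟶ _) ≫
          adj.epsR (σ.prod F G)) := Preadditive.comp_sub b _ _
      refine LinearMap.mem_ker.2 ((congrArg t e).trans ?_)
      exact (map_sub t _ _).trans (sub_eq_zero.2 (ht b)))

section Left

variable {μ : ModuleStr σ M} (c : adj.CounitOn μ) (P : PSh k M)

/-- The action of an element of the unit presheaf, as a map `P(K) → P(H ⋆ K)`. -/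
def unitActVal (H : S) (K : M) (p : P.val K) :
    (adj.unitObj (k := k)).val H →ₗ[k] P.val ((μ.act.obj H).obj K) :=
  unitLift
    { toFun := fun a : H ⟶ σ.prod F G => P.res ((μ.act.map a).app K ≫ c.e K) p
      map_add' := fun (a b : H ⟶ σ.prod F G) =>
        show P.res ((μ.act.map (a + b)).app K ≫ c.e K) p = _ by
          rw [μ.bilinear.add_left, Preadditive.add_comp, PSh.res_add]
      map_smul' := fun r (a : H ⟶ σ.prod F G) =>
        show P.res ((μ.act.map (r • a)).app K ≫ c.e K) p = r • _ by
          rw [μ.bilinear.smul_left, Linear.smul_comp, PSh.res_smul] }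
    -- The two counit maps become equal after `c.e K`: by `c.left` and `c.right` they are `D ⋆ c_K`
    -- and `c_(D ⋆ K)` up to the associator, where `D = F ⊠ G`, and naturality of `c` at `c_K`
    -- equates the composites with `c_K`.
    (fun b => by
      change P.res ((μ.act.map (b ≫ adj.epsL _)).app K ≫ c.e K) p =
        P.res ((μ.act.map (b ≫ adj.epsR _)).app K ≫ c.e K) p
      rw [map_app_comp, map_app_comp, Category.assoc, Category.assoc, ← c.left, Category.assoc,
        c.nat, ← c.right, Category.assoc])

lemma unitActVal_cls (H : S) (K : M) (p : P.val K) (a : H ⟶ σ.prod F G) :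
    unitActVal c P H K p (adj.unitCls a) = P.res ((μ.act.map a).app K ≫ c.e K) p := rfl

/-- The unit presheaf acts by the identity: the morphism `1 ⋆ P ⟶ P`. -/
def unitAct : dayObj μ.act (adj.unitObj (k := k)) P ⟶ P :=
  desc (fun H K x p => unitActVal c P H K p x)
    (fun _ _ _ _ _ => map_add _ _ _) (fun _ _ _ _ _ => map_smul _ _ _)
    (fun H K x p q => by
      obtain ⟨a, rfl⟩ := exists_unitCls x
      simp only [unitActVal_cls, map_add])
    (fun H K r x p => by
      obtain ⟨a, rfl⟩ := exists_unitCls x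
      simp only [unitActVal_cls, map_smul])
    (fun H H' K K' h l x p => by
      obtain ⟨a, rfl⟩ := exists_unitCls x
      rw [res_unitCls, unitActVal_cls, unitActVal_cls, ← PSh.res_comp, ← PSh.res_comp,
        map_app_comp]
      congr 2
      have h1 := (μ.act.map a).naturality l
      simp only [Category.assoc]
      rw [reassoc_of% h1, c.nat])

lemma unitAct_el {X K : M} {H : S} (f : X ⟶ (μ.act.obj H).obj K) (a : H ⟶ σ.prod F G)
    (p : P.val K) : PSh.app (unitAct c P) X (el f (adj.unitCls a) p) =
      P.res (f ≫ (μ.act.map a).app K ≫ c.e K) p := by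
  rw [unitAct, desc_el, unitActVal_cls, ← PSh.res_comp]

/-- In `1 ⋆ P`, elements only depend on their image under the counit. -/
lemma el_unitCls_eq {X K : M} (p : P.val K) (t : X ⟶ (μ.act.obj (σ.prod F G)).obj K)
    (s : K ⟶ (μ.act.obj (σ.prod F G)).obj K) (hs : s ≫ c.e K = 𝟙 K) :
    el t (adj.unitCls (k := k) (𝟙 _)) p = el (t ≫ c.e K ≫ s) (adj.unitCls (𝟙 _)) p := by
  -- The section lifts `t` to `(D ⊠ D) ⋆ K` with `D = F ⊠ G`. Applying `εˡ` recovers `t`, applying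
  -- `εʳ` gives `t ≫ c.e K ≫ s`, and the unit presheaf identifies the two.
  let t' := t ≫ (μ.act.obj (σ.prod F G)).map s ≫ (μ.assoc (σ.prod F G) (σ.prod F G) K).inv
  have h1 : t ≫ c.e K ≫ s = t' ≫ (μ.act.map (adj.epsR (σ.prod F G))).app K := by
    rw [← c.nat, ← c.right]; simp [t']
  have h2 : t = t' ≫ (μ.act.map (adj.epsL (σ.prod F G))).app K := by
    rw [← c.left]
    simp only [t', Category.assoc, Iso.inv_hom_id_assoc]
    rw [← Functor.map_comp, hs, CategoryTheory.Functor.map_id, Category.comp_id]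
  rw [h1, el_comp_left, res_unitCls, Category.comp_id]
  conv_lhs => rw [h2, el_comp_left, res_unitCls, Category.comp_id]
  have := unitCls_eps (adj := adj) (k := k) (𝟙 _)
  rw [Category.id_comp, Category.id_comp] at this
  rw [this]

/-- The inverse sends `p` to the class of `s X ⊗ 𝟙 ⊗ p`. It is a right inverse because `s X` is a
section, and a left inverse because `el_unitCls_eq` lets an element depend only on its image under
the counit. -/
lemma isIso_unitAct (hs : ∀ X, ∃ s, s ≫ c.e X = 𝟙 X) : IsIso (unitAct c P) := by
  choose s hs using hs
  refine PSh.isIso_of_bijective _ fun X => ⟨?_, fun p => ?_⟩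
  · refine Function.LeftInverse.injective
      (g := elRight P (s X) (adj.unitCls (k := k) (𝟙 (σ.prod F G)))) fun y => ?_
    refine LinearMap.congr_fun (f := (elRight P (s X)
      (adj.unitCls (k := k) (𝟙 (σ.prod F G)))).comp (PSh.app (unitAct c P) X))
      (g := LinearMap.id) (el_ext fun H K f x p => ?_) y
    obtain ⟨a, rfl⟩ := exists_unitCls x
    rw [LinearMap.comp_apply, unitAct_el, elRight_apply, ← el_comp_right, LinearMap.id_apply]
    have h1 : el (T := μ.act) f (adj.unitCls (k := k) a) p =
        el (f ≫ (μ.act.map a).app K) (adj.unitCls (𝟙 _)) p := by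
      rw [el_comp_left, res_unitCls, Category.comp_id]
    rw [h1, el_unitCls_eq c P p _ (s K) (hs K),
      el_unitCls_eq c P p (f ≫ (μ.act.map a).app K) (s K) (hs K)]
    congr 1
    have h := c.nat (f ≫ (μ.act.map a).app K ≫ c.e K)
    simp only [Category.assoc] at h ⊢
    rw [reassoc_of% h, reassoc_of% (hs X)]
  · refine ⟨el (s X) (adj.unitCls (𝟙 _)) p, ?_⟩
    rw [unitAct_el]
    simp [hs]

lemma unitAct_nat {P Q : PSh k M} (φ : P ⟶ Q) :
    Day.map μ.act (𝟙 (adj.unitObj (k := k))) φ ≫ unitAct c Q = unitAct c P ≫ φ :=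
  hom_ext fun H K x p => by
    obtain ⟨a, rfl⟩ := exists_unitCls x
    rw [PSh.app_comp, PSh.app_comp, map_el, PSh.app_id, unitAct_el, unitAct_el, PSh.app_res]

/-- The unit presheaf acts by the identity. -/
def unitActIso (hs : ∀ X, ∃ s, s ≫ c.e X = 𝟙 X) :
    (dayExt μ.act).obj (adj.unitObj (k := k)) ≅ 𝟭 (PSh k M) :=
  NatIso.ofComponents (fun P => @asIso _ _ _ _ (unitAct c P) (isIso_unitAct c P hs))
    fun φ => unitAct_nat c φ

end Left

section Right

variable (adj) (P : PSh k S)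

/-- The right action of an element of the unit presheaf, as a map `P(H) → P(H ⊠ K)`. -/
def unitRightVal (H K : S) (p : P.val H) :
    (adj.unitObj (k := k)).val K →ₗ[k] P.val (σ.prod H K) :=
  unitLift
    { toFun := fun a : K ⟶ σ.prod F G => P.res (σ.wl H a ≫ adj.epsL H) p
      map_add' := fun (a b : K ⟶ σ.prod F G) =>
        show P.res ((σ.tensor.obj H).map (a + b) ≫ adj.epsL H) p = _ by
          rw [σ.bilinear.add_right, Preadditive.add_comp, PSh.res_add]
      map_smul' := fun r (a : K ⟶ σ.prod F G) =>
        show P.res ((σ.tensor.obj H).map (r • a) ≫ adj.epsL H) p = r • _ by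
          rw [σ.bilinear.smul_right, Linear.smul_comp, PSh.res_smul] }
    (fun b => by
      change P.res ((σ.tensor.obj H).map (b ≫ adj.epsL _) ≫ adj.epsL H) p =
        P.res ((σ.tensor.obj H).map (b ≫ adj.epsR _) ≫ adj.epsL H) p
      -- With `D = F ⊠ G`, cancelling the associator turns both sides into maps out of `(H ⊠ D) ⊠
      -- D`, equal by naturality of `εˡ` at `εˡ_H`.
      have h : σ.wl H (adj.epsL (σ.prod F G)) ≫ adj.epsL H =
          σ.wl H (adj.epsR (σ.prod F G)) ≫ adj.epsL H := by
        rw [← cancel_epi (σ.assoc H (σ.prod F G) (σ.prod F G)).hom,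
          reassoc_of% (adj.eps_compat H (σ.prod F G)),
          reassoc_of% (adj.epsL_module H (σ.prod F G)), adj.epsL_nat]
      rw [Functor.map_comp, Functor.map_comp, Category.assoc, Category.assoc, h])

lemma unitRightVal_cls (H K : S) (p : P.val H) (a : K ⟶ σ.prod F G) :
    unitRightVal adj P H K p (adj.unitCls a) = P.res (σ.wl H a ≫ adj.epsL H) p := rfl

/-- The morphism `P ⊛ 1 ⟶ P`. -/
def unitRight : dayObj σ.tensor P (adj.unitObj (k := k)) ⟶ P :=
  desc (fun H K p x => unitRightVal adj P H K p x)
    (fun H K p q x => by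
      obtain ⟨a, rfl⟩ := exists_unitCls x
      simp only [unitRightVal_cls, map_add])
    (fun H K r p x => by
      obtain ⟨a, rfl⟩ := exists_unitCls x
      simp only [unitRightVal_cls, map_smul])
    (fun _ _ _ _ _ => map_add _ _ _) (fun _ _ _ _ _ => map_smul _ _ _)
    (fun H H' K K' h l p x => by
      obtain ⟨a, rfl⟩ := exists_unitCls x
      rw [res_unitCls, unitRightVal_cls, unitRightVal_cls, ← PSh.res_comp, ← PSh.res_comp]
      congr 2
      have h1 := adj.epsL_nat h
      have h2 := (σ.tensor.map h).naturality (l ≫ a)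
      rw [Category.assoc, Category.assoc, ← h1, reassoc_of% h2, Functor.map_comp,
        Category.assoc])

lemma unitRight_el {X K H : S} (f : X ⟶ σ.prod H K) (a : K ⟶ σ.prod F G)
    (p : P.val H) : PSh.app (unitRight adj P) X (el f p (adj.unitCls a)) =
      P.res (f ≫ σ.wl H a ≫ adj.epsL H) p := by
  rw [unitRight, desc_el, unitRightVal_cls, ← PSh.res_comp]

/-- The mirror image of `el_unitCls_eq`: the lift of `t` now goes to `H ⊠ (D ⊠ D)` for `D = F ⊠ G`,
and the roles of `εˡ` and `εʳ` are exchanged. -/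
lemma el_unitCls_right_eq {X H : S} (p : P.val H) (t : X ⟶ σ.prod H (σ.prod F G))
    (s : H ⟶ σ.prod H (σ.prod F G)) (hs : s ≫ adj.epsL H = 𝟙 H) :
    el (T := σ.tensor) t p (adj.unitCls (k := k) (𝟙 _)) =
      el (T := σ.tensor) (t ≫ adj.epsL H ≫ s) p (adj.unitCls (𝟙 _)) := by
  let t' := t ≫ σ.wr s (σ.prod F G) ≫ (σ.assoc H (σ.prod F G) (σ.prod F G)).hom
  have h1 : t ≫ adj.epsL H ≫ s = t' ≫ σ.wl H (adj.epsL (σ.prod F G)) := by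
    rw [← adj.epsL_nat s, ← adj.epsL_module]; simp only [t', Category.assoc]
  have h2 : t = t' ≫ σ.wl H (adj.epsR (σ.prod F G)) := by
    simp only [t', Category.assoc]
    rw [adj.eps_compat, ← NatTrans.comp_app, ← Functor.map_comp, hs,
      CategoryTheory.Functor.map_id, NatTrans.id_app, Category.comp_id]
  rw [h1, el_comp_right, res_unitCls, Category.comp_id]
  conv_lhs => rw [h2, el_comp_right, res_unitCls, Category.comp_id]
  have := unitCls_eps (adj := adj) (k := k) (𝟙 _)
  rw [Category.id_comp, Category.id_comp] at this
  rw [this]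

/-- As for `isIso_unitAct`, with sections of `εˡ`; this is where rigidity is felt, through
`exists_section_epsL`. -/
lemma isIso_unitRight (hs : ∀ X, ∃ s, s ≫ adj.epsL X = 𝟙 X) : IsIso (unitRight adj P) := by
  choose s hs using hs
  refine PSh.isIso_of_bijective _ fun X => ⟨?_, fun p => ?_⟩
  · refine Function.LeftInverse.injective
      (g := elMid (T := σ.tensor) P (s X) (adj.unitCls (k := k) (𝟙 (σ.prod F G)))) fun y => ?_
    refine LinearMap.congr_fun (f := (elMid (T := σ.tensor) P (s X)
      (adj.unitCls (k := k) (𝟙 (σ.prod F G)))).comp (PSh.app (unitRight adj P) X))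
      (g := LinearMap.id) (el_ext fun H K f p x => ?_) y
    obtain ⟨a, rfl⟩ := exists_unitCls x
    rw [LinearMap.comp_apply, unitRight_el, elMid_apply, ← el_comp_left, LinearMap.id_apply]
    have h1 : el (T := σ.tensor) f p (adj.unitCls (k := k) a) =
        el (T := σ.tensor) (f ≫ σ.wl H a) p (adj.unitCls (𝟙 _)) := by
      rw [el_comp_right, res_unitCls, Category.comp_id]
    rw [h1, el_unitCls_right_eq adj P p _ (s H) (hs H),
      el_unitCls_right_eq adj P p (f ≫ σ.wl H a) (s H) (hs H)]
    congr 1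
    have h := adj.epsL_nat (f ≫ σ.wl H a ≫ adj.epsL H)
    simp only [Category.assoc] at h ⊢
    rw [reassoc_of% h, reassoc_of% (hs X)]
  · refine ⟨el (T := σ.tensor) (s X) p (adj.unitCls (𝟙 _)), ?_⟩
    rw [unitRight_el]
    simp [hs]

lemma unitRight_nat {P Q : PSh k S} (φ : P ⟶ Q) :
    Day.map σ.tensor φ (𝟙 (adj.unitObj (k := k))) ≫ unitRight adj Q = unitRight adj P ≫ φ :=
  hom_ext fun H K p x => by
    obtain ⟨a, rfl⟩ := exists_unitCls x
    rw [PSh.app_comp, PSh.app_comp, map_el, PSh.app_id, unitRight_el, unitRight_el, PSh.app_res]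

/-- The unit presheaf is a right unit. -/
def unitRightIso (hs : ∀ X, ∃ s, s ≫ adj.epsL X = 𝟙 X) :
    (dayExt σ.tensor).flip.obj (adj.unitObj (k := k)) ≅ 𝟭 (PSh k S) :=
  NatIso.ofComponents (fun P => @asIso _ _ _ _ (unitRight adj P) (isIso_unitRight adj P hs))
    fun φ => unitRight_nat adj φ

end Right

/-- On universal elements the two sides differ by exactly the compatibility `c.left` of the acting
counit with `εˡ`. -/
lemma unit_triangle {μ : ModuleStr σ M} (c : adj.CounitOn μ) (P : PSh k S) (Q : PSh k M) :
    μ.assocHom P (adj.unitObj (k := k)) Q ≫ Day.map μ.act (𝟙 P) (unitAct c Q) =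
      Day.map μ.act (unitRight adj P) (𝟙 Q) :=
  hom_ext_left fun H K Z p x q => by
    obtain ⟨a, rfl⟩ := exists_unitCls x
    rw [PSh.app_comp, μ.assocHom_el, map_el, map_el, unitRight_el, unitAct_el, PSh.app_id,
      PSh.app_id, ← el_comp_right, ← el_comp_left]
    congr 1
    have h1 := μ.assoc_nat_mid H a Z
    have h2 := c.left H Z
    simp only [Category.id_comp, map_app_comp, CategoryTheory.Functor.map_id, NatTrans.id_app]
    rw [Functor.map_comp, ← reassoc_of% h1, h2]

/-- The unit of Day convolution. -/
def unitStr (adj : DualPair σ F G) (hσ : IsRigid σ) (hF : IsLiberal (σ.tensor.obj F)) :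
    UnitStr (σ.psh (k := k)) where
  unit := adj.unitObj
  leftUnitor := unitActIso (μ := σ.regular) adj.regularCounitOn (adj.exists_section_epsR hF)
  rightUnitor := unitRightIso adj (adj.exists_section_epsL hσ hF)
  triangle P Q := unit_triangle (μ := σ.regular) adj.regularCounitOn P Q

/-- Presheaves on a module category which respects the adjunction and is spanned by the action form
a monoidal module category. -/
lemma isMonoidalModule_psh (adj : DualPair σ F G) (hσ : IsRigid σ)
    (hF : IsLiberal (σ.tensor.obj F)) (U : UnitStr (σ.psh (k := k))) {μ : ModuleStr σ M}
    (hμ : μ.Spans) (h : adj.Respected μ) : U.IsMonoidalModule μ.psh := by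
  obtain ⟨c, hc⟩ := h.exists_counitOn hF hμ
  -- Units are unique up to isomorphism, so an arbitrary `U` also acts as the identity; the triangle
  -- axiom needs no separate check.
  exact U.isMonoidalModule_of_iso μ.psh
    (μ.psh.act.mapIso (U.unitIso (adj.unitStr hσ hF)) ≪≫ unitActIso c hc)

end DualPair

end UnitPresheaf

end SemigroupModule

end

noncomputable section

namespace SemigroupModule

/-! ### Module transformations as morphisms to and from the unit -/

section UnitTransformations

variable {k : Type u} [Field k] {S : Type u₁} [Category.{v₁} S] [Preadditive S] [Linear k S]
  {σ : SemigroupStr k S}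

lemma SemigroupStr.wl_comp (σ : SemigroupStr k S) (X : S) {Y Y' Y'' : S} (f : Y ⟶ Y')
    (g : Y' ⟶ Y'') : σ.wl X (f ≫ g) = σ.wl X f ≫ σ.wl X g := (σ.tensor.obj X).map_comp f g

lemma SemigroupStr.wr_comp (σ : SemigroupStr k S) {X X' X'' : S} (f : X ⟶ X') (g : X' ⟶ X'')
    (Y : S) : σ.wr (f ≫ g) Y = σ.wr f Y ≫ σ.wr g Y := by
  rw [SemigroupStr.wr, Functor.map_comp, NatTrans.comp_app]

lemma SemigroupStr.wr_id (σ : SemigroupStr k S) (X Y : S) : σ.wr (𝟙 X) Y = 𝟙 _ := by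
  rw [SemigroupStr.wr, CategoryTheory.Functor.map_id, NatTrans.id_app]

namespace UnitStr

variable (U : UnitStr σ)

lemma rightUnitor_naturality {X Y : S} (f : X ⟶ Y) :
    σ.wr f U.unit ≫ U.rightUnitor.hom.app Y = U.rightUnitor.hom.app X ≫ f :=
  U.rightUnitor.hom.naturality f

/-- The morphism `D ⟶ 1` given by a transformation `D ⊠ - ⟶ Id`. -/
def counitHom {D : S} (E : ∀ P : S, σ.prod D P ⟶ P) : D ⟶ U.unit :=
  (U.rightUnitor.app D).inv ≫ E U.unit

/-- A right module transformation is determined by its component at the unit; the triangle axiom and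
naturality at the left unitor recover `E K`. -/
lemma counitHom_left {D : S} (E : ∀ P : S, σ.prod D P ⟶ P)
    (hE : ∀ {P Q : S} (f : P ⟶ Q), σ.wl D f ≫ E Q = E P ≫ f)
    (hE' : ∀ P Q : S, (σ.assoc D P Q).hom ≫ E (σ.prod P Q) = σ.wr (E P) Q) (K : S) :
    σ.wr (U.counitHom E) K ≫ U.leftUnitor.hom.app K = E K := by
  have e : σ.wr (U.rightUnitor.app D).hom K ≫ σ.wr (U.counitHom E) K = σ.wr (E U.unit) K := by
    rw [← σ.wr_comp, counitHom, Iso.hom_inv_id_assoc]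
  have hi : IsIso (σ.wr (U.rightUnitor.app D).hom K) :=
    NatIso.isIso_app_of_isIso (σ.tensor.map (U.rightUnitor.app D).hom) K
  rw [← cancel_epi (σ.wr (U.rightUnitor.app D).hom K), reassoc_of% e, ← hE', Category.assoc]
  have h := hE (U.leftUnitor.hom.app K)
  have ht := U.triangle D K
  refine (congrArg (fun t => _ ≫ t) h.symm).trans ?_
  exact (reassoc_of% ht) _

/-- The hypothesis `h` is the compatibility of a left and a right counit, needed at the unit only.
Thus the same morphism `D ⟶ 1` induces both transformations. -/
lemma counitHom_right {D : S} (E : ∀ P : S, σ.prod D P ⟶ P) {K : S} (e : σ.prod K D ⟶ K)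
    (h : (σ.assoc K D U.unit).hom ≫ σ.wl K (E U.unit) = σ.wr e U.unit) :
    σ.wl K (U.counitHom E) ≫ U.rightUnitor.hom.app K = e := by
  have h1 := U.rightUnitor_prod K D
  have h2 := U.rightUnitor_naturality e
  have h3 : σ.wl K (U.rightUnitor.hom.app D) ≫ σ.wl K (U.counitHom E) = σ.wl K (E U.unit) := by
    rw [← σ.wl_comp, counitHom]
    congr 1
    exact (U.rightUnitor.app D).hom_inv_id_assoc _
  have hi : IsIso (U.rightUnitor.hom.app (σ.prod K D)) := inferInstance
  rw [← cancel_epi (U.rightUnitor.hom.app (σ.prod K D))]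
  refine Eq.trans ?_ h2
  rw [h1, Category.assoc, reassoc_of% h3, reassoc_of% h]

/-- The morphism `1 ⟶ D` given by a transformation `Id ⟶ D ⊠ -`. -/
def unitHom {D : S} (E : ∀ P : S, P ⟶ σ.prod D P) : U.unit ⟶ D :=
  E U.unit ≫ (U.rightUnitor.app D).hom

/-- The counterpart of `counitHom_left` for units of adjunctions; `unitHom_right` is that of
`counitHom_right`. -/
lemma unitHom_left {D : S} (E : ∀ P : S, P ⟶ σ.prod D P)
    (hE : ∀ {P Q : S} (f : P ⟶ Q), f ≫ E Q = E P ≫ σ.wl D f)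
    (hE' : ∀ P Q : S, σ.wr (E P) Q ≫ (σ.assoc D P Q).hom = E (σ.prod P Q)) (K : S) :
    σ.wr (U.unitHom E) K = U.leftUnitor.hom.app K ≫ E K := by
  have h := hE (U.leftUnitor.hom.app K)
  have ht := U.triangle D K
  rw [unitHom, σ.wr_comp]
  refine Eq.trans ?_ h.symm
  refine Eq.trans ?_ (congrArg (fun t => t ≫ _) (hE' U.unit K))
  rw [Category.assoc]
  exact congrArg (fun t => _ ≫ t) ht.symm

lemma unitHom_right {D : S} (E : ∀ P : S, P ⟶ σ.prod D P) {K : S} (e : K ⟶ σ.prod K D)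
    (h : σ.wl K (E U.unit) ≫ (σ.assoc K D U.unit).inv = σ.wr e U.unit) :
    σ.wl K (U.unitHom E) = U.rightUnitor.hom.app K ≫ e := by
  have h1 := U.rightUnitor_prod K D
  have h2 := U.rightUnitor_naturality e
  refine Eq.trans ?_ h2
  rw [h1, ← h, Category.assoc, Iso.inv_hom_id_assoc, unitHom, σ.wl_comp]
  rfl

end UnitStr

end UnitTransformations

/-! ### Adjunctions in the semigroup category acting on monoidal module categories -/

section RepresentableDuals

open Day

variable {k : Type u} [Field k] {S : Type u} [SmallCategory S] [Preadditive S] [Linear k S]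
  {σ : SemigroupStr k S} {F G : S} (adj : DualPair σ F G)

namespace DualPair

/-- The extension of the right module transformation `εʳ` to presheaves. -/
def epsRExt (P : PSh k S) : dayObj σ.tensor (yo.obj (σ.prod F G)) P ⟶ P :=
  desc (fun H K (a : H ⟶ σ.prod F G) p => P.res (σ.wr a K ≫ adj.epsR K) p)
    (fun H K (a b : H ⟶ σ.prod F G) p =>
      show P.res ((σ.tensor.map (a + b)).app K ≫ adj.epsR K) p = _ by
        rw [σ.bilinear.add_left, Preadditive.add_comp, PSh.res_add])
    (fun H K r (a : H ⟶ σ.prod F G) p =>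
      show P.res ((σ.tensor.map (r • a)).app K ≫ adj.epsR K) p = _ by
        rw [σ.bilinear.smul_left, Linear.smul_comp, PSh.res_smul])
    (fun _ _ _ _ _ => map_add _ _ _) (fun _ _ _ _ _ => map_smul _ _ _)
    (fun H H' K K' h l (a : H' ⟶ σ.prod F G) p => by
      change P.res _ _ = P.res (σ.wr (h ≫ a) K ≫ adj.epsR K) _
      rw [← PSh.res_comp, ← PSh.res_comp]
      congr 2
      have h1 := (σ.tensor.map a).naturality l
      have h2 := adj.epsR_nat l
      rw [σ.wr_comp, Category.assoc, Category.assoc, Category.assoc, ← h2, reassoc_of% h1])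

lemma epsRExt_el (P : PSh k S) {X H K : S} (f : X ⟶ σ.prod H K) (a : H ⟶ σ.prod F G)
    (p : P.val K) : PSh.app (adj.epsRExt P) X (el f (yoEl k a) p) =
      P.res (f ≫ σ.wr a K ≫ adj.epsR K) p := by
  rw [PSh.res_comp]
  exact desc_el ..

lemma epsRExt_nat {P Q : PSh k S} (φ : P ⟶ Q) :
    Day.map σ.tensor (𝟙 (yo.obj (σ.prod F G))) φ ≫ adj.epsRExt Q = adj.epsRExt P ≫ φ :=
  hom_ext fun H K (a : H ⟶ σ.prod F G) p => by
    change PSh.app (adj.epsRExt Q) _ (PSh.app (Day.map σ.tensor (𝟙 _) φ) _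
      (el (𝟙 _) (yoEl k a) p)) = PSh.app φ _ (PSh.app (adj.epsRExt P) _ (el (𝟙 _) (yoEl k a) p))
    rw [map_el, PSh.app_id, epsRExt_el, epsRExt_el, PSh.app_res]

/-- On universal elements this is `epsR_module`; it is the module condition required by
`counitHom_left`. -/
lemma epsRExt_assoc (P Q : PSh k S) :
    (σ.psh.assoc (yo.obj (σ.prod F G)) P Q).hom ≫ adj.epsRExt (σ.psh.prod P Q) =
      Day.map σ.tensor (adj.epsRExt P) (𝟙 Q) :=
  hom_ext_left fun H K Z (a : H ⟶ σ.prod F G) p q => by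
    have e1 := σ.regular.assocHom_el (yo.obj (σ.prod F G)) P Q _ _ Z
      (𝟙 (σ.prod (σ.prod H K) Z)) (𝟙 (σ.prod H K)) (yoEl k a) p q
    refine (congrArg (PSh.app (adj.epsRExt (dayObj σ.tensor P Q)) _) e1).trans ?_
    refine (adj.epsRExt_el (dayObj σ.tensor P Q) _ a (el (T := σ.tensor) (𝟙 _) p q)).trans ?_
    have e2 : PSh.app (adj.epsRExt P) _ (el (T := σ.tensor) (𝟙 (σ.prod H K)) (yoEl k a) p) =
        P.res (σ.wr a K ≫ adj.epsR K) p := by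
      rw [epsRExt_el, Category.id_comp]
    refine Eq.trans ?_ ((map_el (T := σ.tensor) (adj.epsRExt P) (𝟙 Q) _ _ q).trans
      (congrArg (fun t => el (T := σ.tensor) _ t q) e2)).symm
    rw [res_el]
    refine Eq.trans ?_ (el_comp_left _ _ p q)
    congr 1
    have h1 := σ.assoc_nat_left a K Z
    have h2 := adj.epsR_module K Z
    have key : (σ.assoc H K Z).hom ≫ σ.wr a (σ.prod K Z) ≫ adj.epsR (σ.prod K Z) =
        σ.wr (σ.wr a K ≫ adj.epsR K) Z := by
      rw [σ.wr_comp, ← h2, reassoc_of% h1]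
    simp only [CategoryTheory.Functor.map_id, NatTrans.id_app, Category.id_comp, Category.comp_id]
    refine Eq.trans ?_ key
    simp [SemigroupStr.regular]

lemma epsRExt_yo (K : S) : adj.epsRExt (k := k) (yo.obj K) =
    (yoCmp σ (σ.prod F G) K).inv ≫ yo.map (adj.epsR K) :=
  hom_ext fun H L (a : H ⟶ σ.prod F G) (p : L ⟶ K) => by
    change PSh.app (adj.epsRExt (k := k) (yo.obj K)) _ (el (𝟙 _) (yoEl k a) (yoEl k p)) =
      PSh.app (yo.map (adj.epsR K)) _ (PSh.app (yoHom σ.bilinear (σ.prod F G) K) _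
        (el (𝟙 _) (yoEl k a) (yoEl k p)))
    rw [epsRExt_el, yoHom_el, app_yoEl, res_yoEl, pairMap]
    have h := adj.epsR_nat p
    simp only [Category.assoc]
    rw [← h]

/-- The extension of `eps_compat` in which the right-hand object becomes a presheaf. At the unit
presheaf it is the hypothesis of `counitHom_right`, which ties the morphism to the unit back to
`εˡ`. -/
lemma wl_epsRExt (K : S) (Q : PSh k S) :
    (σ.psh.assoc (yo.obj K) (yo.obj (σ.prod F G)) Q).hom ≫
        Day.map σ.tensor (𝟙 (yo.obj K)) (adj.epsRExt Q) =
      Day.map σ.tensor ((yoCmp σ K (σ.prod F G)).inv ≫ yo.map (adj.epsL K)) (𝟙 Q) :=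
  hom_ext_left fun H X Z (p : H ⟶ K) (a : X ⟶ σ.prod F G) q => by
    have e1 := σ.regular.assocHom_el (yo.obj K) (yo.obj (σ.prod F G)) Q _ _ Z
      (𝟙 (σ.prod (σ.prod H X) Z)) (𝟙 (σ.prod H X)) (yoEl k p) (yoEl k a) q
    refine (congrArg (PSh.app (Day.map σ.tensor (𝟙 (yo.obj K)) (adj.epsRExt Q)) _) e1).trans ?_
    refine (map_el (T := σ.tensor) _ _ _ _ _).trans ?_
    refine (congrArg (fun t => el (T := σ.tensor) _ _ t)
      (adj.epsRExt_el Q (𝟙 _) a q)).trans ?_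
    have e2 : PSh.app ((yoCmp σ K (σ.prod F G)).inv ≫ yo.map (adj.epsL K)) _
        (el (T := σ.tensor) (𝟙 (σ.prod H X)) (yoEl k p) (yoEl k a)) =
        (yo (k := k).obj K).res (pairMap σ.tensor p a ≫ adj.epsL K) (yoEl k (𝟙 K)) := by
      refine (congrArg (PSh.app (yo.map (adj.epsL K)) _) (yoHom_el σ.bilinear K (σ.prod F G)
        (𝟙 _) p a)).trans ?_
      rw [app_yoEl, res_yoEl, Category.id_comp, Category.comp_id]
    refine Eq.trans ?_ ((map_el (T := σ.tensor) _ (𝟙 Q) _ _ q).trans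
      (congrArg (fun t => el (T := σ.tensor) _ t q) e2)).symm
    refine Eq.trans ?_ (el_comp_left _ _ _ q)
    refine (el_comp_right _ _ _ q).symm.trans ?_
    have e3 : PSh.app (𝟙 (yo (k := k).obj K)) H (yoEl k p) =
      (yo (k := k).obj K).res p (yoEl k (𝟙 K)) := by
      rw [res_yoEl, Category.comp_id, PSh.app_id]
    rw [e3, ← el_comp_left]
    congr 1
    have h1 := σ.assoc_nat_mid H a Z
    have h2 := adj.eps_compat H Z
    have h3 := adj.epsL_nat p
    have key : (σ.assoc H X Z).hom ≫ σ.wl H (σ.wr a Z ≫ adj.epsR Z) ≫ σ.wr p Z =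
        σ.wr (pairMap σ.tensor p a ≫ adj.epsL K) Z := by
      have h4 : pairMap σ.tensor p a = σ.wl H a ≫ σ.wr p (σ.prod F G) :=
        ((σ.tensor.map p).naturality a).symm
      rw [h4, Category.assoc, h3, σ.wr_comp, σ.wr_comp, ← h2, σ.wl_comp, Category.assoc,
        Category.assoc, reassoc_of% h1]
    simp only [Category.id_comp]
    refine Eq.trans ?_ key
    simp [SemigroupStr.regular]

/-- The extension of the right module transformation `ηʳ` to presheaves. -/
def etaRExt (P : PSh k S) : P ⟶ dayObj σ.tensor (yo.obj (σ.prod G F)) P :=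
  PSh.homMk' (fun K => elRight (T := σ.tensor) P (adj.etaR K) (yoEl k (𝟙 (σ.prod G F))))
    (fun {K L} f p => by
      rw [elRight_apply, elRight_apply, res_el, ← el_comp_right, adj.etaR_nat])

lemma app_etaRExt (P : PSh k S) {K : S} (p : P.val K) : PSh.app (adj.etaRExt P) K p =
    el (T := σ.tensor) (adj.etaR K) (yoEl k (𝟙 (σ.prod G F))) p := rfl

lemma etaRExt_nat {P Q : PSh k S} (φ : P ⟶ Q) :
    φ ≫ adj.etaRExt Q = adj.etaRExt P ≫ Day.map σ.tensor (𝟙 (yo.obj (σ.prod G F))) φ :=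
  PSh.hom_ext fun K p => by
    rw [PSh.app_comp, PSh.app_comp, app_etaRExt, app_etaRExt, map_el, PSh.app_id]

lemma etaRExt_assoc (P Q : PSh k S) :
    σ.psh.wr (adj.etaRExt P) Q ≫ (σ.psh.assoc (yo.obj (σ.prod G F)) P Q).hom =
      adj.etaRExt (σ.psh.prod P Q) :=
  hom_ext (T := σ.tensor) (P := P) (Q := Q) fun K Z p q => by
    have e1 := σ.regular.assocHom_el (yo.obj (σ.prod G F)) P Q (σ.prod K Z) _ Z
      (𝟙 (σ.prod K Z)) (adj.etaR K) (yoEl k (𝟙 (σ.prod G F))) p q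
    have e2 := map_el (T := σ.tensor) (adj.etaRExt P) (𝟙 Q) (𝟙 (σ.prod K Z)) p q
    have e3 := adj.app_etaRExt (dayObj σ.tensor P Q) (el (T := σ.tensor) (𝟙 (σ.prod K Z)) p q)
    have key : 𝟙 (σ.prod K Z) ≫ σ.wr (adj.etaR K) Z ≫ (σ.assoc (σ.prod G F) K Z).hom =
        adj.etaR (σ.prod K Z) := (Category.id_comp _).trans (adj.etaR_module K Z)
    have e4 := congrArg (fun t => el (T := σ.tensor) (P := yo.obj (σ.prod G F))
      (Q := dayObj σ.tensor P Q) t (yoEl k (𝟙 (σ.prod G F)))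
      (el (T := σ.tensor) (𝟙 (σ.prod K Z)) p q)) key
    refine (congrArg (PSh.app (σ.psh.assoc (yo.obj (σ.prod G F)) P Q).hom _) e2).trans ?_
    exact e1.trans (e4.trans e3.symm)

lemma etaRExt_yo (K : S) : adj.etaRExt (k := k) (yo.obj K) =
    yo.map (adj.etaR K) ≫ (yoCmp σ (σ.prod G F) K).hom :=
  PSh.hom_ext fun L (p : L ⟶ K) => by
    have h : PSh.app (yo.map (adj.etaR K) ≫ (yoCmp σ (σ.prod G F) K).hom) L (yoEl k p) =
        el (T := σ.tensor) (p ≫ adj.etaR K) (yoEl k (𝟙 _)) (yoEl k (𝟙 _)) := rfl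
    refine (adj.app_etaRExt (yo.obj K) (yoEl k p)).trans (Eq.trans ?_ h.symm)
    have e : yoEl k p = (yo (k := k).obj K).res p (yoEl k (𝟙 K)) := by
      rw [res_yoEl, Category.comp_id]
    rw [e, ← el_comp_right, adj.etaR_nat]

/-- The corresponding extension of `eta_compat`, to be fed into `unitHom_right`. -/
lemma wl_etaRExt (K : S) (Q : PSh k S) :
    Day.map σ.tensor (𝟙 (yo.obj K)) (adj.etaRExt Q) ≫
        (σ.psh.assoc (yo.obj K) (yo.obj (σ.prod G F)) Q).inv =
      Day.map σ.tensor (yo.map (adj.etaL K) ≫ (yoCmp σ K (σ.prod G F)).hom) (𝟙 Q) :=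
  hom_ext fun H Z (p : H ⟶ K) q => by
    have e1 := σ.regular.assocInv_el (yo.obj K) (yo.obj (σ.prod G F)) Q _ _ _
      (𝟙 (σ.prod H Z)) (adj.etaR Z) (yoEl k p) (yoEl k (𝟙 _)) q
    refine (congrArg (PSh.app (σ.psh.assoc (yo.obj K) (yo.obj (σ.prod G F)) Q).inv _)
      (map_el (T := σ.tensor) (𝟙 (yo.obj K)) (adj.etaRExt Q) _ (yoEl k p) q)).trans ?_
    refine e1.trans ?_
    have e2 : PSh.app (yo.map (adj.etaL K) ≫ (yoCmp σ K (σ.prod G F)).hom) _ (yoEl k p) =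
        el (T := σ.tensor) (p ≫ adj.etaL K) (yoEl k (𝟙 _)) (yoEl k (𝟙 _)) := rfl
    have e3 : el (T := σ.tensor) (p ≫ adj.etaL K) (yoEl k (𝟙 K)) (yoEl k (𝟙 (σ.prod G F))) =
        (dayObj σ.tensor (yo.obj K) (yo.obj (σ.prod G F))).res (adj.etaL H)
          (el (T := σ.tensor) (𝟙 _) (yoEl k p) (yoEl k (𝟙 (σ.prod G F)))) := by
      have e : yoEl k p = (yo (k := k).obj K).res p (yoEl k (𝟙 K)) := by
        rw [res_yoEl, Category.comp_id]
      rw [e, res_el, Category.comp_id, ← el_comp_left, adj.etaL_nat]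
    refine Eq.trans ?_ ((map_el (T := σ.tensor) _ (𝟙 Q) _ (yoEl k p) q).trans
      (congrArg (fun t => el (T := σ.tensor) _ t q) (e2.trans e3))).symm
    refine Eq.trans ?_ (el_comp_left _ _ _ q)
    have key := adj.eta_compat H Z
    refine congrArg (fun t => el (T := σ.tensor) t
      (el (T := σ.tensor) (𝟙 _) (yoEl k p) (yoEl k (𝟙 (σ.prod G F)))) q) ?_
    refine Eq.trans ?_ (key.trans (Category.id_comp _).symm)
    simp [SemigroupStr.regular]

section Action

variable {N : Type u₃} [Category.{v₃} N] [Preadditive N] [Linear k N] {ν : ModuleStr σ.psh N}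
  (U : UnitStr (σ.psh (k := k)))

/-- The presheaf morphism `Hom(-, F ⊠ G) ⟶ 1` given by the counit of an adjunction. -/
def counitHom : yo.obj (σ.prod F G) ⟶ U.unit := U.counitHom (σ := σ.psh) adj.epsRExt

/-- The presheaf morphism `1 ⟶ Hom(-, G ⊠ F)` given by the unit of an adjunction. -/
def unitHom : U.unit ⟶ yo.obj (σ.prod G F) := U.unitHom (σ := σ.psh) adj.etaRExt

variable {U}

/-- The action of the counit of an adjunction on a monoidal module category. -/
def counitOnRestrict (l : ν.act.obj U.unit ≅ 𝟭 N)
    (h : ∀ (X : PSh k S) (Y : N), (ν.assoc X U.unit Y).hom ≫ (ν.act.obj X).map (l.hom.app Y) =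
      (ν.act.map (U.rightUnitor.hom.app X)).app Y) : adj.CounitOn ν.restrict where
  e X := (ν.act.map (adj.counitHom U)).app X ≫ l.hom.app X
  nat {X Y} f := by
    have key : (ν.act.obj (yo.obj (σ.prod F G))).map f ≫
        (ν.act.map (adj.counitHom U)).app Y ≫ l.hom.app Y =
          ((ν.act.map (adj.counitHom U)).app X ≫ l.hom.app X) ≫ f := by
      rw [NatTrans.naturality_assoc, l.hom.naturality, Functor.id_map, Category.assoc]
    exact key
  left H X := by
    have key : ((ν.act.map (yoCmp σ H (σ.prod F G)).hom).app X ≫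
        (ν.assoc (yo.obj H) (yo.obj (σ.prod F G)) X).hom) ≫
          (ν.act.obj (yo.obj H)).map ((ν.act.map (adj.counitHom U)).app X ≫ l.hom.app X) =
        (ν.act.map (yo.map (adj.epsL H))).app X := by
      have h1 := ν.assoc_nat_mid (yo.obj H) (adj.counitHom U) X
      have h2 := U.counitHom_right (σ := σ.psh) adj.epsRExt _ (adj.wl_epsRExt H U.unit)
      rw [Functor.map_comp, Category.assoc, ← reassoc_of% h1, h, ← map_app_comp, ← map_app_comp]
      refine congrArg (fun t => (ν.act.map t).app X) ?_
      exact (congrArg (fun t => _ ≫ t) h2).trans (Iso.hom_inv_id_assoc _ _)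
    exact key
  right H X := by
    have key : ((ν.act.map (yoCmp σ (σ.prod F G) H).hom).app X ≫
        (ν.assoc (yo.obj (σ.prod F G)) (yo.obj H) X).hom) ≫
          (ν.act.map (adj.counitHom U)).app ((ν.act.obj (yo.obj H)).obj X) ≫ l.hom.app _ =
        (ν.act.map (yo.map (adj.epsR H))).app X := by
      have h1 := ν.assoc_nat_left (adj.counitHom U) (yo.obj H) X
      have h2 := (U.counitHom_left (σ := σ.psh) adj.epsRExt adj.epsRExt_nat adj.epsRExt_assoc
        (yo.obj H)).trans (adj.epsRExt_yo H)
      rw [Category.assoc, ← reassoc_of% h1, U.module_leftUnitor l h, ← map_app_comp,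
        ← map_app_comp]
      refine congrArg (fun t => (ν.act.map t).app X) ?_
      exact (congrArg (fun t => _ ≫ t) h2).trans (Iso.hom_inv_id_assoc _ _)
    exact key

/-- The action of the unit of an adjunction on a monoidal module category. -/
def unitOnRestrict (l : ν.act.obj U.unit ≅ 𝟭 N)
    (h : ∀ (X : PSh k S) (Y : N), (ν.assoc X U.unit Y).hom ≫ (ν.act.obj X).map (l.hom.app Y) =
      (ν.act.map (U.rightUnitor.hom.app X)).app Y) : adj.UnitOn ν.restrict where
  n X := l.inv.app X ≫ (ν.act.map (adj.unitHom U)).app X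
  nat {X Y} f := by
    have key : f ≫ l.inv.app Y ≫ (ν.act.map (adj.unitHom U)).app Y =
        (l.inv.app X ≫ (ν.act.map (adj.unitHom U)).app X) ≫
          (ν.act.obj (yo.obj (σ.prod G F))).map f := by
      have := l.inv.naturality f
      simp only [Functor.id_map] at this
      rw [reassoc_of% this, Category.assoc, NatTrans.naturality]
    exact key
  left H X := by
    have key : (ν.act.map (yo.map (adj.etaL H))).app X ≫
        (ν.act.map (yoCmp σ H (σ.prod G F)).hom).app X ≫
          (ν.assoc (yo.obj H) (yo.obj (σ.prod G F)) X).hom =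
        (ν.act.obj (yo.obj H)).map (l.inv.app X ≫ (ν.act.map (adj.unitHom U)).app X) := by
      have h1 := ν.assoc_nat_mid (yo.obj H) (adj.unitHom U) X
      have h2 := U.unitHom_right (σ := σ.psh) adj.etaRExt _ (adj.wl_etaRExt H U.unit)
      have h3 := congrArg (fun t => (ν.act.map t).app X) h2
      simp only [map_app_comp] at h3
      have h4 : (ν.act.map (U.rightUnitor.hom.app (yo.obj H))).app X ≫
          (ν.act.obj (yo.obj H)).map (l.inv.app X ≫ (ν.act.map (adj.unitHom U)).app X) =
            (ν.assoc (yo.obj H) U.unit X).hom ≫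
              (ν.act.obj (yo.obj H)).map ((ν.act.map (adj.unitHom U)).app X) := by
        rw [← h, Category.assoc, ← Functor.map_comp, Iso.hom_inv_id_app_assoc]
      have hi : IsIso ((ν.act.map (U.rightUnitor.hom.app (yo.obj H))).app X) := inferInstance
      rw [← cancel_epi ((ν.act.map (U.rightUnitor.hom.app (yo.obj H))).app X)]
      refine Eq.trans ?_ (h1.trans h4.symm)
      refine Eq.trans ?_ (congrArg (fun t => t ≫ _) h3.symm)
      simp only [Category.assoc]
    exact key
  right H X := by
    have key : (ν.act.map (yo.map (adj.etaR H))).app X ≫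
        (ν.act.map (yoCmp σ (σ.prod G F) H).hom).app X ≫
          (ν.assoc (yo.obj (σ.prod G F)) (yo.obj H) X).hom =
        l.inv.app ((ν.act.obj (yo.obj H)).obj X) ≫
          (ν.act.map (adj.unitHom U)).app ((ν.act.obj (yo.obj H)).obj X) := by
      have h1 := ν.assoc_nat_left (adj.unitHom U) (yo.obj H) X
      have h2 := (U.unitHom_left (σ := σ.psh) adj.etaRExt adj.etaRExt_nat adj.etaRExt_assoc
        (yo.obj H)).trans (congrArg (fun t => _ ≫ t) (adj.etaRExt_yo H))
      have hl := U.module_leftUnitor l h (yo.obj H) X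
      have h3 := congrArg (fun t => (ν.act.map t).app X) h2
      simp only [map_app_comp] at h3
      rw [← cancel_epi (l.hom.app ((ν.act.obj (yo.obj H)).obj X)),
        ← cancel_epi (ν.assoc U.unit (yo.obj H) X).hom, reassoc_of% hl, Iso.hom_inv_id_app_assoc,
        ← h1]
      refine Eq.trans ?_ (congrArg (fun t => t ≫ _) h3.symm)
      simp only [Category.assoc]
    exact key

end Action

/-- A section `s` of `εʳ_X` exhibits `p` as the image of `s ⊗ 𝟙 ⊗ p`. -/
lemma epi_epsRExt (hs : ∀ X, ∃ s, s ≫ adj.epsR X = 𝟙 X) (P : PSh k S) :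
    Epi (adj.epsRExt P) := by
  refine PSh.epi_of_surjective _ fun X p => ?_
  obtain ⟨s, hs⟩ := hs X
  refine ⟨el (T := σ.tensor) s (yoEl k (𝟙 (σ.prod F G))) p, ?_⟩
  rw [epsRExt_el, σ.wr_id, Category.id_comp, hs, PSh.res_id]

lemma epi_counitHom (hs : ∀ X, ∃ s, s ≫ adj.epsR X = 𝟙 X) (U : UnitStr (σ.psh (k := k))) :
    Epi (adj.counitHom U) := by
  exact epi_comp' inferInstance (adj.epi_epsRExt hs U.unit)

section

variable {N : Type u₃} [Category.{v₃} N] [Preadditive N] [Linear k N] {ν : ModuleStr σ.psh N}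
  {U : UnitStr (σ.psh (k := k))}

/-- Every adjunction is respected by the restriction of a monoidal module category. -/
lemma respected_restrict (hν : U.IsMonoidalModule ν) : adj.Respected ν.restrict := by
  obtain ⟨l, h⟩ := hν
  exact respected_of_counitOn (adj.counitOnRestrict l h) (adj.unitOnRestrict l h)

/-- The counit acts by epimorphisms. -/
lemma exists_counitOn_epi (hs : ∀ X, ∃ s, s ≫ adj.epsR X = 𝟙 X) (hν : U.IsMonoidalModule ν)
    (hc : ∀ X : N, Limits.PreservesColimitsOfSize.{u, u} (ν.act.flip.obj X)) :
    ∃ (c : adj.CounitOn ν.restrict) (_ : adj.UnitOn ν.restrict), ∀ X, Epi (c.e X) := by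
  obtain ⟨l, h⟩ := hν
  refine ⟨adj.counitOnRestrict l h, adj.unitOnRestrict l h, fun X => ?_⟩
  have := adj.epi_counitHom hs U
  have := hc X
  have : Limits.PreservesColimitsOfSize.{0, 0} (ν.act.flip.obj X) :=
    Limits.preservesColimitsOfSize_shrink _
  -- Acting on a fixed `X` is cocontinuous, hence preserves the epimorphism from the representable
  -- to the unit.
  have : Epi ((ν.act.map (adj.counitHom U)).app X) :=
    inferInstanceAs (Epi ((ν.act.flip.obj X).map (adj.counitHom U)))
  exact epi_comp' this inferInstance

/-- Right duals of generating objects act faithfully. -/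
lemma faithful_restrict (hs : ∀ X, ∃ s, s ≫ adj.epsR X = 𝟙 X) (hν : U.IsMonoidalModule ν)
    (hc : ∀ X : N, Limits.PreservesColimitsOfSize.{u, u} (ν.act.flip.obj X)) :
    (ν.act.obj (yo.obj G)).Faithful := by
  obtain ⟨c, d, h⟩ := adj.exists_counitOn_epi hs hν hc
  have : ∀ X, Epi ((adjunctionOn c d).counit.app X) := fun X => by
    rw [adjunctionOn_counit_app]
    exact epi_comp' inferInstance (h X)
  exact (adjunctionOn c d).faithful_R_of_epi_counit_app

end

end DualPair

end RepresentableDuals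

end SemigroupModule

end

noncomputable section

namespace SemigroupModule

/-! ### Constructions with module functors -/

section ModuleFunctors

variable {k : Type u} [Field k] {S : Type u₁} [Category.{v₁} S] [Preadditive S] [Linear k S]
  {σ : SemigroupStr k S}
  {M : Type u₂} [Category.{v₂} M] [Preadditive M] [Linear k M]
  {N : Type u₃} [Category.{v₃} N] [Preadditive N] [Linear k N]
  {L : Type u₄} [Category.{v₄} L] [Preadditive L] [Linear k L]
  {μ : ModuleStr σ M} {ν : ModuleStr σ N} {l : ModuleStr σ L}

namespace ModuleFunctor

attribute [instance] ModuleFunctor.additive ModuleFunctor.linear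

/-- The composite of two module functors. -/
def comp (Φ : ModuleFunctor μ ν) (Ψ : ModuleFunctor ν l) : ModuleFunctor μ l where
  toFunctor := Φ.toFunctor ⋙ Ψ.toFunctor
  additive := inferInstance
  linear := inferInstance
  iso G X := Ψ.toFunctor.mapIso (Φ.iso G X) ≪≫ Ψ.iso G (Φ.toFunctor.obj X)
  nat_left f X := by
    have h := congrArg Ψ.toFunctor.map (Φ.nat_left f X)
    simp only [Functor.map_comp] at h
    simp [reassoc_of% h, Ψ.nat_left]
  nat_right G _ _ f := by
    have h := congrArg Ψ.toFunctor.map (Φ.nat_right G f)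
    simp only [Functor.map_comp] at h
    simp [reassoc_of% h, Ψ.nat_right]
  coherence G H X := by
    have h := congrArg Ψ.toFunctor.map (Φ.coherence G H X)
    have h1 := Ψ.nat_right G (Φ.iso H X).hom
    simp only [Functor.map_comp] at h
    simp only [Functor.comp_map, Functor.comp_obj, Iso.trans_hom, Functor.mapIso_hom,
      Functor.map_comp, Category.assoc]
    rw [← reassoc_of% h1, reassoc_of% h, Ψ.coherence]

variable (ν) in
/-- The inclusion of a full subcategory which is closed under the action. -/
def ofFullSub (W : ObjectProperty N) (hW : ∀ (G : S) (X : N), W X → W ((ν.act.obj G).obj X)) :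
    ModuleFunctor (ν.fullSub W hW) ν where
  toFunctor := W.ι
  additive := ⟨rfl⟩
  linear := ⟨fun _ _ => rfl⟩
  iso _ _ := Iso.refl _
  nat_left _ _ := (Category.comp_id _).trans (Category.id_comp _).symm
  nat_right _ _ _ _ := (Category.comp_id _).trans (Category.id_comp _).symm
  coherence G H X := by
    change (ν.assoc G H X.obj).hom ≫ 𝟙 _ ≫ (ν.act.obj G).map (𝟙 _) =
      𝟙 _ ≫ (ν.assoc G H X.obj).hom
    simp

/-- The corestriction of a module functor to a full subcategory containing its image. -/
def toFullSub (Φ : ModuleFunctor μ ν) (W : ObjectProperty N)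
    (hW : ∀ (G : S) (X : N), W X → W ((ν.act.obj G).obj X))
    (h : ∀ X, W (Φ.toFunctor.obj X)) : ModuleFunctor μ (ν.fullSub W hW) where
  toFunctor := W.lift Φ.toFunctor h
  additive := ⟨fun {_ _ f g} => W.hom_ext (Φ.additive.map_add (f := f) (g := g))⟩
  linear := ⟨fun f r => W.hom_ext (Φ.linear.map_smul f r)⟩
  iso G X := W.isoMk (Φ.iso G X)
  nat_left f X := W.hom_ext (Φ.nat_left f X)
  nat_right G _ _ f := W.hom_ext (Φ.nat_right G f)
  coherence G H X := W.hom_ext (Φ.coherence G H X)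

/-- A fully faithful module functor reflects the action of the counit. -/
def counitOn (Φ : ModuleFunctor μ ν) [Φ.toFunctor.Full] [Φ.toFunctor.Faithful] {F G : S}
    {adj : DualPair σ F G} (c : adj.CounitOn ν) : adj.CounitOn μ where
  e X := Φ.toFunctor.preimage ((Φ.iso _ X).hom ≫ c.e _)
  nat {X Y} f := Φ.toFunctor.map_injective (by
    rw [Functor.map_comp, Functor.map_comp, Functor.map_preimage, Functor.map_preimage,
      reassoc_of% (Φ.nat_right (σ.prod F G) f), c.nat, Category.assoc])
  left H X := Φ.toFunctor.map_injective (by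
    rw [Functor.map_comp, ← cancel_mono (Φ.iso H X).hom, Category.assoc, Φ.nat_right,
      Functor.map_preimage, Functor.map_comp, reassoc_of% (Φ.coherence H (σ.prod F G) X), c.left,
      Φ.nat_left])
  right H X := Φ.toFunctor.map_injective (by
    rw [Functor.map_comp, ← cancel_mono (Φ.iso H X).hom, Category.assoc,
      Functor.map_preimage, Category.assoc, ← c.nat, reassoc_of% (Φ.coherence (σ.prod F G) H X),
      c.right, Φ.nat_left])

lemma map_counitOn (Φ : ModuleFunctor μ ν) [Φ.toFunctor.Full] [Φ.toFunctor.Faithful] {F G : S}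
    {adj : DualPair σ F G} (c : adj.CounitOn ν) (X : M) :
    Φ.toFunctor.map ((Φ.counitOn c).e X) = (Φ.iso _ X).hom ≫ c.e _ :=
  Φ.toFunctor.map_preimage _

/-- A fully faithful module functor reflects the action of the unit. -/
def unitOn (Φ : ModuleFunctor μ ν) [Φ.toFunctor.Full] [Φ.toFunctor.Faithful] {F G : S}
    {adj : DualPair σ F G} (d : adj.UnitOn ν) : adj.UnitOn μ where
  n X := Φ.toFunctor.preimage (d.n _ ≫ (Φ.iso _ X).inv)
  nat {X Y} f := Φ.toFunctor.map_injective (by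
    rw [Functor.map_comp, Functor.map_comp, Functor.map_preimage, Functor.map_preimage,
      reassoc_of% (d.nat (Φ.toFunctor.map f)), ← cancel_mono (Φ.iso (σ.prod G F) Y).hom]
    simp only [Category.assoc, Iso.inv_hom_id, Category.comp_id, Φ.nat_right,
      Iso.inv_hom_id_assoc])
  left H X := Φ.toFunctor.map_injective (by
    have h : (Φ.iso (σ.prod G F) X).inv ≫ (Φ.iso (σ.prod G F) X).hom = 𝟙 _ := Iso.inv_hom_id _
    rw [Functor.map_comp, ← cancel_mono (Φ.iso H _).hom, Φ.nat_right, Functor.map_preimage,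
      ← cancel_mono ((ν.act.obj H).map (Φ.iso _ X).hom)]
    simp only [Category.assoc]
    rw [Φ.coherence, reassoc_of% (Φ.nat_left (adj.etaL H) X), d.left, ← Functor.map_comp,
      Category.assoc, h, Category.comp_id])
  right H X := Φ.toFunctor.map_injective (by
    rw [Functor.map_comp, ← cancel_mono (Φ.iso (σ.prod G F) _).hom, Functor.map_preimage,
      ← cancel_mono ((ν.act.obj (σ.prod G F)).map (Φ.iso H X).hom)]
    simp only [Category.assoc, Iso.inv_hom_id_assoc]
    rw [Φ.coherence, reassoc_of% (Φ.nat_left (adj.etaR H) X), d.right, d.nat])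

end ModuleFunctor

/-- A module structure on a category which is embedded as a full subcategory which is closed under
the action, up to isomorphism. -/
def ModuleStr.transport (ν : ModuleStr σ N) (E : M ⥤ N) [E.Full] [E.Faithful] [E.Additive]
    [E.Linear k] (o : S → M → M) (θ : ∀ G X, E.obj (o G X) ≅ (ν.act.obj G).obj (E.obj X)) :
    ModuleStr σ M where
  act :=
    { obj := fun G =>
        { obj := o G
          map := fun {X Y} f =>
            E.preimage ((θ G X).hom ≫ (ν.act.obj G).map (E.map f) ≫ (θ G Y).inv)
          map_id := fun X => E.map_injective (by simp)
          map_comp := fun f g => E.map_injective (by simp) }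
      map := fun {G H} g =>
        { app := fun X => E.preimage ((θ G X).hom ≫ (ν.act.map g).app (E.obj X) ≫ (θ H X).inv)
          naturality := fun X Y f => E.map_injective (by simp) }
      map_id := fun G => by ext X; exact E.map_injective (by simp)
      map_comp := fun f g => by ext X; exact E.map_injective (by simp) }
  bilinear :=
    { add_left := fun f g X => E.map_injective (by simp [ν.bilinear.add_left])
      smul_left := fun c f X => E.map_injective (by simp [ν.bilinear.smul_left])
      add_right := fun G _ _ f g => E.map_injective (by simp [ν.bilinear.add_right])
      smul_right := fun G _ _ c f => E.map_injective (by simp [ν.bilinear.smul_right]) }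
  assoc G H X := E.preimageIso (θ _ X ≪≫ ν.assoc G H (E.obj X) ≪≫
    (ν.act.obj G).mapIso (θ H X).symm ≪≫ (θ G (o H X)).symm)
  assoc_nat_left f H X := E.map_injective (by
    simp [reassoc_of% (ν.assoc_nat_left f H (E.obj X))])
  assoc_nat_mid G _ _ f X := E.map_injective (by
    have := ν.assoc_nat_mid G f (E.obj X)
    simp only [Functor.map_comp, Functor.map_preimage, Category.assoc, Iso.inv_hom_id_assoc,
      Functor.preimageIso_hom, Iso.trans_hom, Functor.mapIso_hom, Iso.symm_hom]
    rw [reassoc_of% this, ← Functor.map_comp_assoc (ν.act.obj G) (θ _ X).inv, Iso.inv_hom_id,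
      CategoryTheory.Functor.map_id, Category.id_comp])
  assoc_nat_right G H X Y f := E.map_injective (by
    have := ν.assoc_nat_right G H (E.map f)
    simp only [Functor.map_comp, Functor.map_preimage, Category.assoc, Iso.inv_hom_id_assoc,
      Functor.preimageIso_hom, Iso.trans_hom, Functor.mapIso_hom, Iso.symm_hom]
    rw [reassoc_of% this, ← Functor.map_comp_assoc (ν.act.obj G) (θ H X).inv,
      Iso.inv_hom_id, CategoryTheory.Functor.map_id, Category.id_comp])
  pentagon G H K X := E.map_injective (by
    have h1 := ν.pentagon G H K (E.obj X)
    have h2 := ν.assoc_nat_right G H (θ K X).inv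
    have h3 : (ν.act.obj G).map (θ (σ.prod H K) X).inv ≫
        (ν.act.obj G).map (θ (σ.prod H K) X).hom = 𝟙 _ := by
      rw [← Functor.map_comp, Iso.inv_hom_id, CategoryTheory.Functor.map_id]
    simp only [Functor.map_comp, Functor.map_preimage, Category.assoc, Iso.inv_hom_id_assoc,
      Functor.preimageIso_hom, Iso.trans_hom, Functor.mapIso_hom, Iso.symm_hom]
    rw [reassoc_of% h3, reassoc_of% h1, reassoc_of% h2])

/-- The embedding of a full subcategory with the transported module structure. -/
def ModuleFunctor.ofTransport (ν : ModuleStr σ N) (E : M ⥤ N) [E.Full] [E.Faithful] [E.Additive]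
    [E.Linear k] (o : S → M → M) (θ : ∀ G X, E.obj (o G X) ≅ (ν.act.obj G).obj (E.obj X)) :
    ModuleFunctor (ν.transport E o θ) ν where
  toFunctor := E
  additive := inferInstance
  linear := inferInstance
  iso := θ
  nat_left f X := by simp [ModuleStr.transport]
  nat_right G _ _ f := by simp [ModuleStr.transport]
  coherence G H X := by
    have h3 : (ν.act.obj G).map (θ H X).inv ≫ (ν.act.obj G).map (θ H X).hom = 𝟙 _ := by
      rw [← Functor.map_comp, Iso.inv_hom_id, CategoryTheory.Functor.map_id]
    simp [ModuleStr.transport, h3]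

end ModuleFunctors

/-! ### The Yoneda embedding as a module functor -/

section PresheafFunctors

open Day Limits

variable {k : Type u} [Field k] {S : Type u} [SmallCategory S] [Preadditive S] [Linear k S]
  {σ : SemigroupStr k S}

/-- Formal bookkeeping: it turns a coherence square such as `yo_assoc`, stated for maps out of
convolutions, into the square for their inverses, the direction a module functor requires. -/
lemma comp_inv_comp_inv {C : Type u₁} [Category.{v₁} C] {X₁ X₂ X₃ X₄ X₅ X₆ : C} {a : X₁ ⟶ X₂}
    {a' : X₂ ⟶ X₁} {b : X₂ ⟶ X₃} {b' : X₃ ⟶ X₂} {c : X₃ ⟶ X₄} {d : X₁ ⟶ X₅} {e : X₅ ⟶ X₆}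
    {e' : X₆ ⟶ X₅} {g : X₆ ⟶ X₄} {g' : X₄ ⟶ X₆} (h : a ≫ b ≫ c = d ≫ e ≫ g)
    (ha : a' ≫ a = 𝟙 _) (hb : b' ≫ b = 𝟙 _) (he : e ≫ e' = 𝟙 _) (hg : g ≫ g' = 𝟙 _) :
    c ≫ g' ≫ e' = b' ≫ a' ≫ d := by
  have h' := congrArg (fun t => b' ≫ a' ≫ t ≫ g' ≫ e') h
  simp only [Category.assoc, reassoc_of% ha, reassoc_of% hb, reassoc_of% hg, he,
    Category.comp_id] at h'
  exact h'

/-- The Yoneda embedding of a module category is a module functor. -/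
def ModuleStr.yoFunctor {M : Type u} [SmallCategory M] [Preadditive M] [Linear k M]
    (μ : ModuleStr σ M) : ModuleFunctor μ μ.psh.restrict where
  toFunctor := yo
  additive := inferInstance
  linear := inferInstance
  iso G X := (yoIso μ.bilinear G X).symm
  nat_left {G G'} f X := by
    have key : yo.map ((μ.act.map f).app X) ≫ (yoIso μ.bilinear G' X).inv =
        (yoIso μ.bilinear G X).inv ≫ Day.map μ.act (yo.map f) (𝟙 (yo.obj X)) := by
      rw [Iso.comp_inv_eq, Category.assoc, Iso.eq_inv_comp]
      exact (yoHom_nat_left μ.bilinear f X).symm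
    exact key
  nat_right G {X X'} f := by
    have key : yo.map ((μ.act.obj G).map f) ≫ (yoIso μ.bilinear G X').inv =
        (yoIso μ.bilinear G X).inv ≫ Day.map μ.act (𝟙 (yo.obj G)) (yo.map f) := by
      rw [Iso.comp_inv_eq, Category.assoc, Iso.eq_inv_comp]
      exact (yoHom_nat_right μ.bilinear G f).symm
    exact key
  coherence G H X := by
    have key : yo.map (μ.assoc G H X).hom ≫ (yoIso μ.bilinear G ((μ.act.obj H).obj X)).inv ≫
        ((dayExt μ.act).obj (yo.obj G)).map (yoIso μ.bilinear H X).inv =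
      (yoIso μ.bilinear (σ.prod G H) X).inv ≫
        ((dayExt μ.act).map (yoIso σ.bilinear G H).inv).app (yo.obj X) ≫
          μ.assocHom (yo.obj G) (yo.obj H) (yo.obj X) := by
      have h := μ.yo_assoc (k := k) G H X
      have h1 : ((dayExt μ.act).map (yoIso (k := k) σ.bilinear G H).inv).app (yo.obj X) ≫
          Day.map μ.act (yoHom σ.bilinear G H) (𝟙 (yo.obj X)) = 𝟙 _ := by
        refine (NatTrans.comp_app ((dayExt μ.act).map (yoIso (k := k) σ.bilinear G H).inv)
          ((dayExt μ.act).map (yoIso (k := k) σ.bilinear G H).hom) (yo.obj X)).symm.trans ?_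
        rw [← Functor.map_comp, Iso.inv_hom_id, CategoryTheory.Functor.map_id]
        rfl
      have h2 : Day.map μ.act (𝟙 (yo.obj G)) (yoHom (k := k) μ.bilinear H X) ≫
          ((dayExt μ.act).obj (yo.obj G)).map (yoIso μ.bilinear H X).inv = 𝟙 _ := by
        refine (Functor.map_comp ((dayExt μ.act).obj (yo (k := k).obj G))
          (yoIso μ.bilinear H X).hom (yoIso μ.bilinear H X).inv).symm.trans ?_
        rw [Iso.hom_inv_id, CategoryTheory.Functor.map_id]
        rfl
      have h3 : yoHom (k := k) μ.bilinear G ((μ.act.obj H).obj X) ≫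
        (yoIso μ.bilinear G ((μ.act.obj H).obj X)).inv = 𝟙 _ :=
        (yoIso (k := k) μ.bilinear G ((μ.act.obj H).obj X)).hom_inv_id
      have h4 : (yoIso (k := k) μ.bilinear (σ.prod G H) X).inv ≫
        yoHom μ.bilinear (σ.prod G H) X = 𝟙 _ :=
        (yoIso (k := k) μ.bilinear (σ.prod G H) X).inv_hom_id
      exact comp_inv_comp_inv h h1 h4 h2 h3
    exact key

/-- The restriction of a module functor along the Yoneda embedding. -/
def ModuleFunctor.restrict {N : Type u₃} [Category.{v₃} N] [Preadditive N] [Linear k N]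
    {N' : Type u₄} [Category.{v₄} N'] [Preadditive N'] [Linear k N'] {ν : ModuleStr σ.psh N}
    {ν' : ModuleStr σ.psh N'} (Φ : ModuleFunctor ν ν') : ModuleFunctor ν.restrict ν'.restrict where
  toFunctor := Φ.toFunctor
  additive := inferInstance
  linear := inferInstance
  iso G X := Φ.iso (yo.obj G) X
  nat_left f X := Φ.nat_left (yo.map f) X
  nat_right G _ _ f := Φ.nat_right (yo.obj G) f
  coherence G H X := by
    have h1 := Φ.coherence (yo.obj G) (yo.obj H) X
    have h2 := Φ.nat_left (yoCmp σ G H).hom X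
    have key : Φ.toFunctor.map ((ν.act.map (yoCmp σ G H).hom).app X ≫
        (ν.assoc (yo.obj G) (yo.obj H) X).hom) ≫ (Φ.iso (yo.obj G) _).hom ≫
          (ν'.act.obj (yo.obj G)).map (Φ.iso (yo.obj H) X).hom =
        (Φ.iso (yo.obj (σ.prod G H)) X).hom ≫ (ν'.act.map (yoCmp σ G H).hom).app _ ≫
          (ν'.assoc (yo.obj G) (yo.obj H) _).hom := by
      rw [Functor.map_comp, Category.assoc, h1, reassoc_of% h2]
    exact key

end PresheafFunctors

end SemigroupModule

end

noncomputable section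

namespace SemigroupModule

open Day Limits

/-! ### The comparison between the nerve and the actions -/

section NerveModule

variable {k : Type u} [Field k] {S : Type u} [SmallCategory S] [Preadditive S] [Linear k S]
  {σ : SemigroupStr k S} {A B : Type u} [SmallCategory A] [Preadditive A] [Linear k A]
  [SmallCategory B] [Preadditive B] [Linear k B] {μ : ModuleStr σ B} {ν : ModuleStr σ.psh (PSh k A)}

lemma yoDesc_add {P : PSh k S} {H : S} (p q : P.val H) : yoDesc (p + q) = yoDesc p + yoDesc q :=
  yo_hom_ext (by rw [PSh.app_add, yoDesc_app_id, yoDesc_app_id, yoDesc_app_id])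

lemma yoDesc_smul {P : PSh k S} {H : S} (c : k) (p : P.val H) : yoDesc (c • p) = c • yoDesc p :=
  yo_hom_ext (by rw [PSh.app_smul, yoDesc_app_id, yoDesc_app_id])

/-- The universal element of a convolution, as a morphism from a representable presheaf. -/
lemma yoDesc_el {P Q : PSh k S} {H K : S} (p : P.val H) (q : Q.val K) :
    yoDesc (el (T := σ.tensor) (𝟙 _) p q) =
      (yoCmp σ H K).hom ≫ σ.psh.wl (yo.obj H) (yoDesc q) ≫ σ.psh.wr (yoDesc p) Q :=
  yo_hom_ext (by
    rw [yoDesc_app_id]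
    have e : PSh.app (Day.map σ.tensor (yoDesc p) (𝟙 Q)) _
        (PSh.app (Day.map σ.tensor (𝟙 (yo.obj H)) (yoDesc q)) _
          (el (T := σ.tensor) (𝟙 (σ.prod H K)) (yoEl k (𝟙 H)) (yoEl k (𝟙 K)))) =
        el (T := σ.tensor) (𝟙 _) p q := by
      rw [map_el, map_el, PSh.app_id, PSh.app_id, yoDesc_app_id, yoDesc_app_id]
    exact e.symm)

namespace ModuleFunctor

variable (E : ModuleFunctor μ ν.restrict)

/-- The structure isomorphism `E(H ⋆ b) ≅ Hom(-, H) ⋆ E(b)`. -/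
def resIso (H : S) (b : B) : E.toFunctor.obj ((μ.act.obj H).obj b) ≅
    (ν.act.obj (yo.obj H)).obj (E.toFunctor.obj b) := E.iso H b

lemma resIso_nat_left {H H' : S} (h : H ⟶ H') (b : B) :
    E.toFunctor.map ((μ.act.map h).app b) ≫ (E.resIso H' b).hom =
      (E.resIso H b).hom ≫ (ν.act.map (yo.map h)).app (E.toFunctor.obj b) := E.nat_left h b

lemma resIso_nat_right (H : S) {b b' : B} (w : b ⟶ b') :
    E.toFunctor.map ((μ.act.obj H).map w) ≫ (E.resIso H b').hom =
      (E.resIso H b).hom ≫ (ν.act.obj (yo.obj H)).map (E.toFunctor.map w) := E.nat_right H w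

lemma resIso_coherence (H K : S) (b : B) :
    E.toFunctor.map (μ.assoc H K b).hom ≫ (E.resIso H ((μ.act.obj K).obj b)).hom ≫
        (ν.act.obj (yo.obj H)).map (E.resIso K b).hom =
      (E.resIso (σ.prod H K) b).hom ≫ (ν.act.map (yoCmp σ H K).hom).app (E.toFunctor.obj b) ≫
        (ν.assoc (yo.obj H) (yo.obj K) (E.toFunctor.obj b)).hom := E.coherence H K b

/-- An element of `Q ⋆ P` indexed by `E(H ⋆ b)`, from elements of `Q` and of the nerve of `P`. -/
def nerveActHom {Q : PSh k S} {P : PSh k A} {H : S} {b : B} (q : Q.val H)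
    (p : E.toFunctor.obj b ⟶ P) : E.toFunctor.obj ((μ.act.obj H).obj b) ⟶ (ν.act.obj Q).obj P :=
  (E.resIso H b).hom ≫ (ν.act.map (yoDesc q)).app (E.toFunctor.obj b) ≫ (ν.act.obj Q).map p

section

variable {Q : PSh k S} {P : PSh k A} {H : S} {b : B}

lemma nerveActHom_add_left (q q' : Q.val H) (p : E.toFunctor.obj b ⟶ P) :
    E.nerveActHom (q + q') p = E.nerveActHom q p + E.nerveActHom q' p := by
  rw [nerveActHom, yoDesc_add, ν.bilinear.add_left, Preadditive.add_comp, Preadditive.comp_add]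
  rfl

lemma nerveActHom_smul_left (c : k) (q : Q.val H) (p : E.toFunctor.obj b ⟶ P) :
    E.nerveActHom (c • q) p = c • E.nerveActHom q p := by
  rw [nerveActHom, yoDesc_smul, ν.bilinear.smul_left, Linear.smul_comp, Linear.comp_smul]
  rfl

lemma nerveActHom_add_right (q : Q.val H) (p p' : E.toFunctor.obj b ⟶ P) :
    E.nerveActHom q (p + p') = E.nerveActHom q p + E.nerveActHom q p' := by
  rw [nerveActHom, ν.bilinear.add_right, Preadditive.comp_add, Preadditive.comp_add]
  rfl

lemma nerveActHom_smul_right (c : k) (q : Q.val H) (p : E.toFunctor.obj b ⟶ P) :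
    E.nerveActHom q (c • p) = c • E.nerveActHom q p := by
  rw [nerveActHom, ν.bilinear.smul_right, Linear.comp_smul, Linear.comp_smul]
  rfl

/-- This is the dinaturality which lets `nerveActHom` descend to the coend. -/
lemma map_nerveActHom {H' : S} {b' : B} (h : H' ⟶ H) (w : b' ⟶ b) (q : Q.val H)
    (p : E.toFunctor.obj b ⟶ P) :
    E.toFunctor.map ((μ.act.map h).app b' ≫ (μ.act.obj H).map w) ≫ E.nerveActHom q p =
      E.nerveActHom (Q.res h q) (E.toFunctor.map w ≫ p) := by
  have h3 := (ν.act.map (yoDesc q)).naturality (E.toFunctor.map w)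
  rw [nerveActHom, nerveActHom, Functor.map_comp, Category.assoc,
    reassoc_of% (E.resIso_nat_right H w), reassoc_of% (E.resIso_nat_left h b'), ← map_yoDesc,
    Functor.map_comp ν.act, NatTrans.comp_app, Functor.map_comp, Category.assoc, reassoc_of% h3]

lemma nerveActHom_app {Q' : PSh k S} (φ : Q ⟶ Q') (q : Q.val H) (p : E.toFunctor.obj b ⟶ P) :
    E.nerveActHom (PSh.app φ H q) p = E.nerveActHom q p ≫ (ν.act.map φ).app P := by
  rw [nerveActHom, nerveActHom, ← yoDesc_comp, Functor.map_comp, NatTrans.comp_app,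
    Category.assoc, Category.assoc, Category.assoc, (ν.act.map φ).naturality]

lemma nerveActHom_comp {P' : PSh k A} (φ : P ⟶ P') (q : Q.val H) (p : E.toFunctor.obj b ⟶ P) :
    E.nerveActHom q (p ≫ φ) = E.nerveActHom q p ≫ (ν.act.obj Q).map φ := by
  rw [nerveActHom, nerveActHom, Functor.map_comp, Category.assoc, Category.assoc]

/-- The associativity of the comparison on universal elements. Factoring `q ⊗ r` through
representables by `yoDesc_el` reduces it to naturality of the associator of `ν` and the coherence of
`E`. -/
lemma nerveActHom_el {R : PSh k S} {K : S} (q : Q.val H) (r : R.val K)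
    (p : E.toFunctor.obj b ⟶ P) :
    E.nerveActHom (Q := dayObj σ.tensor Q R) (el (T := σ.tensor) (𝟙 (σ.prod H K)) q r) p ≫
        (ν.assoc Q R P).hom =
      E.toFunctor.map (μ.assoc H K b).hom ≫ E.nerveActHom q (E.nerveActHom r p) := by
  have h2 := ν.assoc_nat_mid (yo.obj H) (yoDesc r) (E.toFunctor.obj b)
  have h3 := ν.assoc_nat_left (yoDesc q) R (E.toFunctor.obj b)
  have h4 := ν.assoc_nat_right Q R p
  have h5 := (ν.act.map (yoDesc q)).naturality (E.nerveActHom r p)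
  have h6 : (ν.act.map (yoDesc (el (T := σ.tensor) (𝟙 (σ.prod H K)) q r))).app
      (E.toFunctor.obj b) ≫ (ν.assoc Q R (E.toFunctor.obj b)).hom =
      (ν.act.map (yoCmp σ H K).hom).app (E.toFunctor.obj b) ≫
        (ν.assoc (yo.obj H) (yo.obj K) (E.toFunctor.obj b)).hom ≫
        (ν.act.obj (yo.obj H)).map ((ν.act.map (yoDesc r)).app (E.toFunctor.obj b)) ≫
        (ν.act.map (yoDesc q)).app ((ν.act.obj R).obj (E.toFunctor.obj b)) := by
    have h7 := congrArg (fun t => (ν.act.map t).app (E.toFunctor.obj b) ≫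
      (ν.assoc Q R (E.toFunctor.obj b)).hom) (yoDesc_el (σ := σ) q r)
    refine h7.trans ?_
    simp only [Functor.map_comp, NatTrans.comp_app, Category.assoc]
    rw [h3, reassoc_of% h2]
  have h8 : E.nerveActHom (Q := dayObj σ.tensor Q R)
      (el (T := σ.tensor) (𝟙 (σ.prod H K)) q r) p ≫ (ν.assoc Q R P).hom =
      (E.resIso (σ.prod H K) b).hom ≫
        ((ν.act.map (yoDesc (el (T := σ.tensor) (𝟙 (σ.prod H K)) q r))).app
          (E.toFunctor.obj b) ≫ (ν.assoc Q R (E.toFunctor.obj b)).hom) ≫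
            (ν.act.obj Q).map ((ν.act.obj R).map p) := by
    have h9 := congrArg (fun t => (E.resIso (σ.prod H K) b).hom ≫
      (ν.act.map (yoDesc (el (T := σ.tensor) (𝟙 (σ.prod H K)) q r))).app
          (E.toFunctor.obj b) ≫ t) h4
    simp only [← Category.assoc] at h9 ⊢
    exact h9
  rw [h8, h6]
  simp only [Category.assoc]
  rw [← reassoc_of% (E.resIso_coherence H K b), nerveActHom, ← h5, nerveActHom]
  simp only [Functor.map_comp, Category.assoc]
  have h10 := (ν.act.map (yoDesc q)).naturality ((ν.act.obj R).map p)
  rw [h10]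

end

/-- The comparison `Q ⋆ Hom(E -, P) ⟶ Hom(E -, Q ⋆ P)`. -/
def nerveAct (Q : PSh k S) (P : PSh k A) : dayObj μ.act Q ((nerve E.toFunctor).obj P) ⟶
    (nerve E.toFunctor).obj ((ν.act.obj Q).obj P) :=
  desc (fun _ _ q p => nerveEl E.toFunctor (E.nerveActHom q (nerveHom p)))
    (fun _ _ q q' p => congrArg (nerveEl E.toFunctor) (E.nerveActHom_add_left q q' (nerveHom p)))
    (fun _ _ c q p => congrArg (nerveEl E.toFunctor) (E.nerveActHom_smul_left c q (nerveHom p)))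
    (fun _ _ q p p' => congrArg (nerveEl E.toFunctor)
      (E.nerveActHom_add_right q (nerveHom p) (nerveHom p')))
    (fun _ _ c q p => congrArg (nerveEl E.toFunctor)
      (E.nerveActHom_smul_right c q (nerveHom p)))
    (fun _ _ _ _ h w q p => (nerve_res E.toFunctor _ _).trans (congrArg (nerveEl E.toFunctor)
      (E.map_nerveActHom h w q (nerveHom p))))

lemma nerveAct_el (Q : PSh k S) (P : PSh k A) {X b : B} {H : S} (f : X ⟶ (μ.act.obj H).obj b)
    (q : Q.val H) (p : E.toFunctor.obj b ⟶ P) :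
    PSh.app (E.nerveAct Q P) X (el f q (nerveEl E.toFunctor p)) =
      nerveEl E.toFunctor (E.toFunctor.map f ≫ E.nerveActHom q p) := by
  refine (desc_el ..).trans ?_
  rw [nerve_res, nerveHom_nerveEl]

lemma nerveAct_el_id (Q : PSh k S) (P : PSh k A) {b : B} {H : S}
    (q : Q.val H) (p : E.toFunctor.obj b ⟶ P) :
    PSh.app (E.nerveAct Q P) _ (el (𝟙 ((μ.act.obj H).obj b)) q (nerveEl E.toFunctor p)) =
      nerveEl E.toFunctor (E.nerveActHom q p) := by
  rw [nerveAct_el, CategoryTheory.Functor.map_id, Category.id_comp]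

lemma nerveAct_nat_left {Q Q' : PSh k S} (φ : Q ⟶ Q') (P : PSh k A) :
    Day.map μ.act φ (𝟙 ((nerve E.toFunctor).obj P)) ≫ E.nerveAct Q' P =
      E.nerveAct Q P ≫ (nerve E.toFunctor).map ((ν.act.map φ).app P) :=
  hom_ext fun H b q p => by
    rw [← nerveEl_nerveHom E.toFunctor p, PSh.app_comp, PSh.app_comp, map_el, PSh.app_id,
      nerveAct_el_id, nerveAct_el_id, nerve_app, nerveActHom_app]

lemma nerveAct_nat_right (Q : PSh k S) {P P' : PSh k A} (φ : P ⟶ P') :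
    Day.map μ.act (𝟙 Q) ((nerve E.toFunctor).map φ) ≫ E.nerveAct Q P' =
      E.nerveAct Q P ≫ (nerve E.toFunctor).map ((ν.act.obj Q).map φ) :=
  hom_ext fun H b q p => by
    rw [← nerveEl_nerveHom E.toFunctor p, PSh.app_comp, PSh.app_comp, map_el, PSh.app_id,
      nerve_app, nerveAct_el_id, nerveAct_el_id, nerve_app, nerveActHom_comp]

lemma nerveAct_assoc (Q R : PSh k S) (P : PSh k A) :
    E.nerveAct (dayObj σ.tensor Q R) P ≫ (nerve E.toFunctor).map (ν.assoc Q R P).hom =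
      μ.assocHom Q R ((nerve E.toFunctor).obj P) ≫
        Day.map μ.act (𝟙 Q) (E.nerveAct R P) ≫ E.nerveAct Q ((ν.act.obj R).obj P) :=
  hom_ext_left fun H K b q r p => by
    have e1 : PSh.app (μ.assocHom Q R ((nerve E.toFunctor).obj P) ≫
        Day.map μ.act (𝟙 Q) (E.nerveAct R P) ≫ E.nerveAct Q ((ν.act.obj R).obj P)) _
          (el (𝟙 _) (el (𝟙 _) q r) (nerveEl E.toFunctor (nerveHom p))) =
        nerveEl E.toFunctor (E.toFunctor.map (μ.assoc H K b).hom ≫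
          E.nerveActHom q (E.nerveActHom r (nerveHom p))) := by
      rw [PSh.app_comp, PSh.app_comp, μ.assocHom_el, map_el, PSh.app_id, nerveAct_el_id,
        nerveAct_el, Category.id_comp, CategoryTheory.Functor.map_id, NatTrans.id_app,
        Category.id_comp]
    refine Eq.trans ?_ e1.symm
    refine (congrArg (PSh.app ((nerve E.toFunctor).map (ν.assoc Q R P).hom) _)
      (E.nerveAct_el_id (dayObj σ.tensor Q R) P _ (nerveHom p))).trans ?_
    exact (nerve_app E.toFunctor _ _).trans (congrArg (nerveEl E.toFunctor)
      (E.nerveActHom_el q r (nerveHom p)))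

end ModuleFunctor

end NerveModule

end SemigroupModule

end

noncomputable section

namespace SemigroupModule

open Day Limits

/-! ### The nerve as an equivalence of module categories -/

section NerveEquivalence

lemma IsBilinear.additive {k : Type u} [Field k] {C : Type u₁} {D : Type u₂} {E : Type u₃}
    [Category.{v₁} C] [Category.{v₂} D] [Category.{v₃} E] [Preadditive C] [Preadditive D]
    [Preadditive E] [Linear k C] [Linear k D] [Linear k E] {T : C ⥤ D ⥤ E}
    (hT : IsBilinear k T) (X : C) : (T.obj X).Additive where
  map_add {_ _ f g} := hT.add_right X f g

lemma inv_comp_of_comp_eq {C : Type u₁} [Category.{v₁} C] {X₁ X₂ X₃ X₅ X₆ : C} {a : X₁ ⟶ X₂}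
    {a' : X₂ ⟶ X₁} {c : X₂ ⟶ X₃} {d : X₁ ⟶ X₅} {e : X₅ ⟶ X₆} {e' : X₆ ⟶ X₅} {g : X₆ ⟶ X₃}
    {g' : X₃ ⟶ X₆} (h : a ≫ c = d ≫ e ≫ g) (ha : a' ≫ a = 𝟙 _) (he : e ≫ e' = 𝟙 _)
    (hg : g ≫ g' = 𝟙 _) : c ≫ g' ≫ e' = a' ≫ d := by
  have h' := congrArg (fun t => a' ≫ t ≫ g' ≫ e') h
  simp only [Category.assoc, reassoc_of% ha, reassoc_of% hg, he, Category.comp_id] at h'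
  exact h'

variable {k : Type u} [Field k] {S : Type u} [SmallCategory S] [Preadditive S] [Linear k S]
  {σ : SemigroupStr k S} {A B : Type u} [SmallCategory A] [Preadditive A] [Linear k A]
  [SmallCategory B] [Preadditive B] [Linear k B] {μ : ModuleStr σ B} {ν : ModuleStr σ.psh (PSh k A)}

namespace ModuleFunctor

variable (E : ModuleFunctor μ ν.restrict)

/-- At representable arguments the comparison is conjugate to the structure isomorphism of `E`. This
is the base case of the invertibility proof. -/
lemma nerveUnit_nerveAct (H : S) (b : B) :
    Day.map μ.act (𝟙 (yo.obj H)) (nerveUnit E.toFunctor b) ≫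
        E.nerveAct (yo.obj H) (E.toFunctor.obj b) =
      yoHom μ.bilinear H b ≫ nerveUnit E.toFunctor ((μ.act.obj H).obj b) ≫
        (nerve E.toFunctor).map (E.resIso H b).hom :=
  hom_ext fun H' b' (p : H' ⟶ H) (q : b' ⟶ b) => by
    have e : yoDesc (yoEl k p) = yo.map p :=
      yo_hom_ext (by rw [yoDesc_app_id, app_yoEl, Category.id_comp])
    have key : PSh.app (Day.map μ.act (𝟙 (yo.obj H)) (nerveUnit E.toFunctor b) ≫
        E.nerveAct (yo.obj H) (E.toFunctor.obj b)) _ (el (𝟙 _) (yoEl k p) (yoEl k q)) =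
      PSh.app (yoHom μ.bilinear H b ≫ nerveUnit E.toFunctor ((μ.act.obj H).obj b) ≫
        (nerve E.toFunctor).map (E.resIso H b).hom) _ (el (𝟙 _) (yoEl k p) (yoEl k q)) := by
      rw [PSh.app_comp, PSh.app_comp, PSh.app_comp, map_el, PSh.app_id, nerveUnit_app,
        nerveAct_el_id, yoHom_el, Category.id_comp, nerveUnit_app, nerve_app, nerveActHom, e,
        pairMap, Functor.map_comp, Category.assoc, E.resIso_nat_right,
        reassoc_of% (E.resIso_nat_left p b')]
    exact key

/-- The comparison as a transformation of functors of `P`. -/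
def nerveActRight (Q : PSh k S) : nerve E.toFunctor ⋙ (dayExt μ.act).obj Q ⟶
    ν.act.obj Q ⋙ nerve E.toFunctor where
  app := E.nerveAct Q
  naturality _ _ φ := E.nerveAct_nat_right Q φ

/-- The comparison as a transformation of functors of `Q`. -/
def nerveActLeft (P : PSh k A) : (dayExt μ.act).flip.obj ((nerve E.toFunctor).obj P) ⟶
    ν.act.flip.obj P ⋙ nerve E.toFunctor where
  app Q := E.nerveAct Q P
  naturality _ _ φ := E.nerveAct_nat_left φ P

variable [E.toFunctor.Full] [E.toFunctor.Faithful]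

lemma isIso_nerveAct_yo_obj (H : S) (b : B) :
    IsIso (E.nerveAct (yo.obj H) (E.toFunctor.obj b)) := by
  have h := E.nerveUnit_nerveAct H b
  have h1 : IsIso (Day.map μ.act (𝟙 (yo.obj H)) (nerveUnit E.toFunctor b)) :=
    inferInstanceAs (IsIso (((dayExt μ.act).obj (yo.obj H)).map (nerveUnit E.toFunctor b)))
  have h2 : IsIso (yoHom (k := k) μ.bilinear H b) :=
    inferInstanceAs (IsIso (yoIso μ.bilinear H b).hom)
  have h3 : IsIso (Day.map μ.act (𝟙 (yo.obj H)) (nerveUnit E.toFunctor b) ≫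
      E.nerveAct (yo.obj H) (E.toFunctor.obj b)) := by
    rw [h]
    exact IsIso.comp_isIso' h2 inferInstance
  exact @IsIso.of_isIso_comp_left _ _ _ _ _ _ _ h1 h3

/-- Invertibility spreads in three stages: for representable `Q`, from the objects `E b` to
representables by density and additivity, then to all `P` by cocontinuity in `P`; finally to all `Q`
by cocontinuity in `Q`. The nerve, being an equivalence, preserves the colimits involved. -/
lemma isIso_nerveAct (hE : IsDense E.toFunctor) (hproj : ∀ b, fgProj k A (E.toFunctor.obj b))
    (hr : ∀ Q : PSh k S, PreservesColimitsOfSize.{u, u} (ν.act.obj Q))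
    (hl : ∀ P : PSh k A, PreservesColimitsOfSize.{u, u} (ν.act.flip.obj P))
    (Q : PSh k S) (P : PSh k A) : IsIso (E.nerveAct Q P) := by
  have := nerve_isEquivalence hE hproj
  have h1 : ∀ (H : S) (X : A), IsIso (E.nerveAct (yo.obj H) (yo.obj X)) := fun H X => by
    have := ν.bilinear.additive (yo.obj H)
    have := (dayExt_bilinear μ.act).additive ((yo (k := k)).obj H)
    refine (hE X).isIso_app (E.nerveActRight (yo.obj H)) ?_
    rintro _ ⟨b, rfl⟩
    exact E.isIso_nerveAct_yo_obj H b
  have h2 : ∀ (H : S) (P : PSh k A), IsIso (E.nerveAct (yo.obj H) P) := fun H P => by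
    have := hr (yo.obj H)
    have := preservesColimits_right μ.bilinear ((yo (k := k)).obj H)
    exact isIso_app_of_representables (E.nerveActRight (yo.obj H)) (h1 H) P
  have := hl P
  have := preservesColimits_left μ.bilinear ((nerve E.toFunctor).obj P)
  exact isIso_app_of_representables (E.nerveActLeft P) (fun H => h2 H P) Q

/-- A module category with a cocontinuous action on presheaves is equivalent to the presheaves on
any dense full module subcategory of finitely generated projective presheaves. -/
lemma moduleEquivalent_psh (hE : IsDense E.toFunctor)
    (hproj : ∀ b, fgProj k A (E.toFunctor.obj b))
    (hr : ∀ Q : PSh k S, PreservesColimitsOfSize.{u, u} (ν.act.obj Q))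
    (hl : ∀ P : PSh k A, PreservesColimitsOfSize.{u, u} (ν.act.flip.obj P)) :
    ModuleEquivalent ν μ.psh := by
  let c : ∀ (Q : PSh k S) (P : PSh k A), dayObj μ.act Q ((nerve E.toFunctor).obj P) ≅
      (nerve E.toFunctor).obj ((ν.act.obj Q).obj P) := fun Q P =>
    @asIso _ _ _ _ (E.nerveAct Q P) (E.isIso_nerveAct hE hproj hr hl Q P)
  refine ⟨
    { toFunctor := nerve E.toFunctor
      additive := inferInstance
      linear := inferInstance
      iso := fun Q P => (c Q P).symm
      nat_left := fun {Q Q'} φ P => ?_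
      nat_right := fun Q P P' φ => ?_
      coherence := fun Q R P => ?_ }, nerve_isEquivalence hE hproj⟩
  · have key : (nerve E.toFunctor).map ((ν.act.map φ).app P) ≫ (c Q' P).inv =
        (c Q P).inv ≫ Day.map μ.act φ (𝟙 ((nerve E.toFunctor).obj P)) := by
      rw [Iso.comp_inv_eq, Category.assoc, Iso.eq_inv_comp]
      exact (E.nerveAct_nat_left φ P).symm
    exact key
  · have key : (nerve E.toFunctor).map ((ν.act.obj Q).map φ) ≫ (c Q P').inv =
        (c Q P).inv ≫ Day.map μ.act (𝟙 Q) ((nerve E.toFunctor).map φ) := by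
      rw [Iso.comp_inv_eq, Category.assoc, Iso.eq_inv_comp]
      exact (E.nerveAct_nat_right Q φ).symm
    exact key
  · have h : (c (dayObj σ.tensor Q R) P).hom ≫ (nerve E.toFunctor).map (ν.assoc Q R P).hom =
        μ.assocHom Q R ((nerve E.toFunctor).obj P) ≫
          Day.map μ.act (𝟙 Q) (c R P).hom ≫ (c Q ((ν.act.obj R).obj P)).hom :=
      E.nerveAct_assoc Q R P
    have h1 : Day.map μ.act (𝟙 Q) (c R P).hom ≫ ((dayExt μ.act).obj Q).map (c R P).inv = 𝟙 _ := by
      refine (Functor.map_comp ((dayExt μ.act).obj Q) (c R P).hom (c R P).inv).symm.trans ?_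
      rw [Iso.hom_inv_id, CategoryTheory.Functor.map_id]
      rfl
    exact inv_comp_of_comp_eq h (c (dayObj σ.tensor Q R) P).inv_hom_id h1
      (c Q ((ν.act.obj R).obj P)).hom_inv_id

end ModuleFunctor

end NerveEquivalence

end SemigroupModule

end

noncomputable section

namespace SemigroupModule

open Limits

/-! ### Transfer of Cauchy completeness along full embeddings -/

section CauchyCompleteness

variable {C : Type u₁} [Category.{v₁} C] {D : Type u₂} [Category.{v₂} D]

/-- A retract of an object in the image of a fully faithful functor is in the image, if idempotents
split in the source. -/
lemma exists_iso_of_retract (E : C ⥤ D) [E.Full] [E.Faithful] [IsIdempotentComplete C] {X : C}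
    {P : D} (i : P ⟶ E.obj X) (r : E.obj X ⟶ P) (h : i ≫ r = 𝟙 P) :
    ∃ Y, Nonempty (E.obj Y ≅ P) := by
  -- The idempotent `r ≫ i` defining the retract lifts to the source by fullness; both `P` and the
  -- image of its splitting split the same idempotent, so they are isomorphic.
  obtain ⟨Y, j, s, h1, h2⟩ := IsIdempotentComplete.idempotents_split X (E.preimage (r ≫ i))
    (E.map_injective (by simp [reassoc_of% h]))
  have h3 : E.map s ≫ E.map j = r ≫ i := by rw [← Functor.map_comp, h2, Functor.map_preimage]
  have h4 : E.map j ≫ E.map s = 𝟙 _ := by rw [← Functor.map_comp, h1, CategoryTheory.Functor.map_id]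
  refine ⟨Y, ⟨E.map j ≫ r, i ≫ E.map s, ?_, ?_⟩⟩
  · simp only [Category.assoc]
    rw [← reassoc_of% h3, h4, Category.comp_id, h4]
  · simp only [Category.assoc]
    rw [reassoc_of% h3, h, Category.comp_id, h]

lemma isIdempotentComplete_of_fullyFaithful (E : C ⥤ D) [E.Full] [E.Faithful]
    [IsIdempotentComplete D]
    (h : ∀ (X : C) (P : D) (i : P ⟶ E.obj X) (r : E.obj X ⟶ P), i ≫ r = 𝟙 P →
      ∃ Y, Nonempty (E.obj Y ≅ P)) : IsIdempotentComplete C where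
  idempotents_split X p hp := by
    obtain ⟨P, i, r, h1, h2⟩ := IsIdempotentComplete.idempotents_split (E.obj X) (E.map p)
      (by rw [← Functor.map_comp, hp])
    obtain ⟨Y, ⟨e⟩⟩ := h X P i r h1
    exact ⟨Y, E.preimage (e.hom ≫ i), E.preimage (r ≫ e.inv),
      E.map_injective (by simp [reassoc_of% h1]), E.map_injective (by simp [h2])⟩

variable [Preadditive C] [Preadditive D]

/-- The projections and inclusions of a biproduct in the target have preimages, and the biproduct
equations are reflected by the faithful additive functor. -/
lemma hasFiniteBiproducts_of_fullyFaithful (E : C ⥤ D) [E.Full] [E.Faithful] [E.Additive]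
    [HasFiniteBiproducts D]
    (h : ∀ (n : ℕ) (X : Fin n → C), ∃ Y, Nonempty (E.obj Y ≅ ⨁ fun i => E.obj (X i))) :
    HasFiniteBiproducts C where
  out n :=
    { has_biproduct := fun X => by
        obtain ⟨Y, ⟨e⟩⟩ := h n X
        let b : Bicone X :=
          { pt := Y
            π := fun i => E.preimage (e.hom ≫ biproduct.π _ i)
            ι := fun i => E.preimage (biproduct.ι (fun i => E.obj (X i)) i ≫ e.inv)
            ι_π := fun i j => E.map_injective (by
              by_cases hij : i = j
              · subst hij
                simp
              · simp [hij, biproduct.ι_π_ne _ hij]) }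
        refine hasBiproduct_of_total b (E.map_injective ?_)
        have h1 := congrArg (fun t => e.hom ≫ t ≫ e.inv)
          (biproduct.total (f := fun i => E.obj (X i)))
        simp only [Preadditive.comp_sum, Preadditive.sum_comp, Category.assoc, Category.id_comp,
          Iso.hom_inv_id] at h1
        simpa [b, Functor.map_sum] using h1 }

/-- A summand of a finite direct sum is a retract of the direct sum. -/
lemma IsSummandOfSum.exists_retract [HasFiniteBiproducts C] {W : ObjectProperty C} {Y : C}
    (h : IsSummandOfSum W Y) : ∃ (n : ℕ) (X : Fin n → C) (i : Y ⟶ ⨁ X) (r : ⨁ X ⟶ Y),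
      (∀ j, W (X j)) ∧ i ≫ r = 𝟙 Y := by
  obtain ⟨n, X, f, g, hX, e⟩ := h
  exact ⟨n, X, biproduct.lift f, biproduct.desc g, hX, by rw [biproduct.lift_desc, e]⟩

end CauchyCompleteness

/-! ### A small model of the finitely generated projectives -/

section SmallModel

variable {k : Type u} [Field k] {A : Type u} [SmallCategory A] [Preadditive A] [Linear k A]

lemma fgProj_of_retract {P Q : PSh k A} (hQ : fgProj k A Q) (i : P ⟶ Q) (r : Q ⟶ P)
    (h : i ≫ r = 𝟙 P) : fgProj k A P :=
  fgProj_of_summands (.of_mem i r h hQ)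

lemma fgProj_biproduct {n : ℕ} (P : Fin n → PSh k A) (h : ∀ i, fgProj k A (P i)) :
    fgProj k A (⨁ P) :=
  fgProj_of_summands ⟨n, P, biproduct.π P, biproduct.ι P, h, biproduct.total⟩

variable (k A) in
/-- There is, up to isomorphism, only a set of finitely generated projective presheaves. -/
lemma exists_small_fgProj : ∃ (I : Type u) (r : I → PSh k A), (∀ i, fgProj k A (r i)) ∧
    ∀ P, fgProj k A P → ∃ i, Nonempty (r i ≅ P) := by
  -- Every finitely generated projective splits an idempotent on a finite sum of representables, and
  -- such idempotents form a type in universe `u`.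
  let I : Type u := Σ (n : ℕ) (X : Fin n → A),
    {e : (⨁ fun i => (yo (k := k)).obj (X i)) ⟶ ⨁ fun i => (yo (k := k)).obj (X i) // e ≫ e = e}
  choose r j s h1 h2 using fun t : I => IsIdempotentComplete.idempotents_split _ t.2.2.1 t.2.2.2
  refine ⟨I, r, fun t => fgProj_of_retract (fgProj_biproduct _ fun i => fgProj_yo _) (j t) (s t)
    (h1 t), fun P hP => ?_⟩
  obtain ⟨n, X, a, b, hX, e⟩ := ((fgProj_iff P).1 hP).exists_retract
  choose Z hZ using hX
  obtain rfl : X = fun i => yo.obj (Z i) := funext hZ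
  let t : I := ⟨n, Z, b ≫ a, by simp [reassoc_of% e]⟩
  have h3 : s t ≫ j t = b ≫ a := h2 t
  have h4 : j t ≫ s t = 𝟙 _ := h1 t
  refine ⟨t, ⟨j t ≫ b, a ≫ s t, ?_, ?_⟩⟩
  · simp only [Category.assoc]
    rw [← reassoc_of% h3, h4, Category.comp_id, h4]
  · simp only [Category.assoc]
    rw [reassoc_of% h3, e, Category.comp_id, e]

end SmallModel

/-! ### The action on finitely generated projectives -/

section FGProjModules

variable {k : Type u} [Field k] {S : Type u} [SmallCategory S] [Preadditive S] [Linear k S]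
  {σ : SemigroupStr k S} {U : UnitStr (σ.psh (k := k))}

/-- A right dual `G'` of `G` exists by rigidity, and its adjunction is respected in a monoidal
module category. So `G ⋆ -` is left adjoint to the cocontinuous `G' ⋆ -`, and `fgProj_of_adjunction`
applies. -/
lemma PresheafModule.actsOnFGProj (hσ : IsRigid σ) {N : PresheafModule σ}
    (h : U.IsMonoidalModule N.str) (hc : N.IsCocontinuous) : N.ActsOnFGProj := fun G P hP => by
  obtain ⟨G', ⟨p⟩⟩ := (hσ G).1
  obtain ⟨a, -⟩ := p.respected_restrict h
  have := N.str.restrict.bilinear.additive G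
  have : PreservesColimitsOfSize.{u, u} (N.str.restrict.act.obj G') := hc.1 (yo.obj G')
  exact fgProj_of_adjunction a hP

lemma fgProj_obj_of_isEquivalence {A B : Type u} [SmallCategory A] [Preadditive A] [Linear k A]
    [SmallCategory B] [Preadditive B] [Linear k B] (E : PSh k A ⥤ PSh k B) [E.Additive]
    [E.IsEquivalence] {P : PSh k A} (hP : fgProj k A P) : fgProj k B (E.obj P) :=
  have : E.asEquivalence.functor.Additive := ‹E.Additive›
  fgProj_of_adjunction E.asEquivalence.toAdjunction hP

namespace ModuleFunctor

variable {M : Type u₂} [Category.{v₂} M] [Preadditive M] [Linear k M]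
  {N : Type u₃} [Category.{v₃} N] [Preadditive N] [Linear k N] {μ : ModuleStr σ M}
  {ν : ModuleStr σ N}

/-- A fully faithful module functor is an equivalence onto its essential image. -/
lemma moduleEquivalent_fullSub (Φ : ModuleFunctor μ ν) [Φ.toFunctor.Full] [Φ.toFunctor.Faithful]
    (W : ObjectProperty N) (hW : ∀ (G : S) (X : N), W X → W ((ν.act.obj G).obj X))
    (h : ∀ X, W (Φ.toFunctor.obj X)) (h' : ∀ P, W P → ∃ X, Nonempty (Φ.toFunctor.obj X ≅ P)) :
    ModuleEquivalent μ (ν.fullSub W hW) := by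
  have h1 : (W.lift Φ.toFunctor h).EssSurj := ⟨fun P => by
    obtain ⟨X, ⟨e⟩⟩ := h' P.obj P.property
    exact ⟨X, ⟨W.isoMk e⟩⟩⟩
  exact ⟨Φ.toFullSub W hW h, (show (W.lift Φ.toFunctor h).IsEquivalence from {})⟩

end ModuleFunctor

/-- Equivalent module presheaf categories have equivalent finitely generated projective objects. -/
lemma ModuleEquivalent.fgProjModule {N N' : PresheafModule σ} (h : ModuleEquivalent N.str N'.str)
    (hN : N.ActsOnFGProj) (hN' : N'.ActsOnFGProj) :
    ModuleEquivalent (N.fgProjModule hN) (N'.fgProjModule hN') := by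
  obtain ⟨Φ, hΦ⟩ := h
  let Ψ := (ModuleFunctor.ofFullSub N.str.restrict (fgProj k N.base) hN).comp Φ.restrict
  have : Ψ.toFunctor.Full :=
    inferInstanceAs ((fgProj k N.base).ι ⋙ Φ.toFunctor).Full
  have : Ψ.toFunctor.Faithful :=
    inferInstanceAs ((fgProj k N.base).ι ⋙ Φ.toFunctor).Faithful
  refine Ψ.moduleEquivalent_fullSub _ hN' (fun P => fgProj_obj_of_isEquivalence Φ.toFunctor
    P.property) fun P hP => ?_
  have : Φ.toFunctor.asEquivalence.functor.Additive := Φ.additive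
  have : Φ.toFunctor.inv.Additive := Φ.toFunctor.asEquivalence.inverse_additive
  exact ⟨⟨Φ.toFunctor.inv.obj P, fgProj_obj_of_isEquivalence Φ.toFunctor.inv hP⟩,
    ⟨Φ.toFunctor.asEquivalence.counitIso.app P⟩⟩

/-- A Cauchy complete module category consists of the finitely generated projective presheaves on
it. -/
lemma SmallModule.moduleEquivalent_fgProjModule (M : SmallModule σ)
    (hM : IsCauchyComplete M.carrier) (h : M.presheaves.ActsOnFGProj) :
    ModuleEquivalent M.str (M.presheaves.fgProjModule h) := by
  obtain ⟨_, _⟩ := hM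
  have : M.str.yoFunctor.toFunctor.Full := yo_full
  have : M.str.yoFunctor.toFunctor.Faithful := yo_faithful
  refine M.str.yoFunctor.moduleEquivalent_fullSub _ h (fun X => fgProj_yo X) fun P hP => ?_
  obtain ⟨n, X, a, b, hX, e⟩ := ((fgProj_iff P).1 hP).exists_retract
  choose Z hZ using hX
  obtain rfl : X = fun i => yo.obj (Z i) := funext hZ
  -- `P` is a retract of a finite sum of representables, which is representable because `M` has
  -- direct sums; split idempotents in `M` then make `P` representable.
  have e' := (yo (k := k)).mapBiproduct Z
  exact exists_iso_of_retract yo (a ≫ e'.inv) (e'.hom ≫ b) (by simpa using e)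

lemma SmallModule.presheaves_isCocontinuous (M : SmallModule σ) : M.presheaves.IsCocontinuous :=
  ⟨fun P => Day.preservesColimits_right M.str.bilinear P,
    fun Q => Day.preservesColimits_left M.str.bilinear Q⟩

end FGProjModules

end SemigroupModule

end

noncomputable section

namespace SemigroupModule

open Limits

/-! ### The correspondence up to equivalence -/

section Classification

variable {k : Type u} [Field k] {S : Type u} [SmallCategory S] [Preadditive S] [Linear k S]
  {σ : SemigroupStr k S} {U : UnitStr (σ.psh (k := k))}

lemma isDense_of_fgProj {A B : Type u} [SmallCategory A] [Preadditive A] [Linear k A]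
    [SmallCategory B] [Preadditive B] [Linear k B] (E : B ⥤ PSh k A)
    (h : ∀ P, fgProj k A P → ∃ b, Nonempty (E.obj b ≅ P)) : IsDense E := fun X => by
  obtain ⟨b, ⟨e⟩⟩ := h _ (fgProj_yo X)
  exact .of_mem e.inv e.hom e.inv_hom_id ⟨b, rfl⟩

/-- Finitely generated projectives are closed under finite sums and retracts among presheaves, so
the essential image of `E` is. -/
lemma isCauchyComplete_of_fgProj {A B : Type u} [SmallCategory A] [Preadditive A] [Linear k A]
    [SmallCategory B] [Preadditive B] [Linear k B] (E : B ⥤ PSh k A) [E.Full] [E.Faithful]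
    [E.Additive] (hE : ∀ b, fgProj k A (E.obj b))
    (h : ∀ P, fgProj k A P → ∃ b, Nonempty (E.obj b ≅ P)) : IsCauchyComplete B :=
  ⟨hasFiniteBiproducts_of_fullyFaithful E fun _ X => h _ (fgProj_biproduct _ fun i => hE (X i)),
    isIdempotentComplete_of_fullyFaithful E fun X _ i r e => h _ (fgProj_of_retract (hE X) i r e)⟩

/-- The finitely generated projective objects of a module presheaf category form an essentially
small module category. -/
lemma PresheafModule.exists_smallModule (N : PresheafModule σ) (h : N.ActsOnFGProj) :
    ∃ (M : SmallModule σ) (E : ModuleFunctor M.str N.str.restrict), E.toFunctor.Full ∧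
      E.toFunctor.Faithful ∧ (∀ b, fgProj k N.base (E.toFunctor.obj b)) ∧
        ∀ P, fgProj k N.base P → ∃ b, Nonempty (E.toFunctor.obj b ≅ P) := by
  obtain ⟨I, r, hr, hr'⟩ := exists_small_fgProj k N.base
  -- The chosen representatives are closed under the action only up to isomorphism, so for each `G`
  -- and `b` a representative of `G ⋆ r b` is selected and the module structure is transported.
  choose o θ using fun (G : S) (b : InducedCategory (PSh k N.base) r) =>
    hr' _ (h G (r b) (hr b))
  let E : InducedCategory (PSh k N.base) r ⥤ PSh k N.base := inducedFunctor r
  let θ' : ∀ G b, E.obj (o G b) ≅ (N.str.restrict.act.obj G).obj (E.obj b) := fun G b =>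
    (θ G b).some
  exact ⟨⟨InducedCategory (PSh k N.base) r, N.str.restrict.transport E o θ'⟩,
    ModuleFunctor.ofTransport N.str.restrict E o θ', inferInstanceAs E.Full,
    inferInstanceAs E.Faithful, hr, hr'⟩

namespace ModuleFunctor

variable {F G : S} {adj : DualPair σ F G} {N : PresheafModule σ} {M : SmallModule σ}
  (E : ModuleFunctor M.str N.str.restrict) [E.toFunctor.Full] [E.toFunctor.Faithful]

/-- The unit and counit acting on `N` are reflected along the fully faithful `E`, and together they
give the adjunction on `M`. -/
lemma respected (E : ModuleFunctor M.str N.str.restrict) [E.toFunctor.Full]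
    [E.toFunctor.Faithful] (hN : U.IsMonoidalModule N.str) : adj.Respected M.str := by
  obtain ⟨l, h⟩ := hN
  exact DualPair.respected_of_counitOn (E.counitOn (adj.counitOnRestrict l h))
    (E.unitOn (adj.unitOnRestrict l h))

/-- The counit `(F ⊠ G) ⋆ E X ⟶ E X` is epi and `E X` is projective, so it splits; reflecting the
splitting makes `X` a retract of the single object `(F ⊠ G) ⋆ X`. -/
lemma spans (hs : ∀ X, ∃ s, s ≫ adj.epsR X = 𝟙 X) (hN : U.IsMonoidalModule N.str)
    (hc : N.IsCocontinuous) (hE : ∀ b, fgProj k N.base (E.toFunctor.obj b)) : M.str.Spans :=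
  fun X => by
    obtain ⟨c, -, hepi⟩ := adj.exists_counitOn_epi hs hN hc.2
    have := hepi (E.toFunctor.obj X)
    have := (hE X).2
    let s := Projective.factorThru (𝟙 _) (c.e (E.toFunctor.obj X))
    have hs : s ≫ c.e (E.toFunctor.obj X) = 𝟙 _ := Projective.factorThru_comp _ _
    refine .of_mem (E.toFunctor.preimage (s ≫ (E.iso (σ.prod F G) X).inv)) ((E.counitOn c).e X)
      (E.toFunctor.map_injective ?_) ⟨σ.prod F G, X, rfl⟩
    rw [Functor.map_comp, Functor.map_preimage, map_counitOn, Category.assoc,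
      Iso.inv_hom_id_assoc, hs, CategoryTheory.Functor.map_id]

end ModuleFunctor

/-- A module category is equivalent to the finitely generated projective objects of `N` if and only
if its presheaves are equivalent to `N`. -/
lemma SmallModule.moduleEquivalent_fgProjModule_iff {M : SmallModule σ} {N : PresheafModule σ}
    (hM : IsCauchyComplete M.carrier) (hM' : M.presheaves.ActsOnFGProj) (hN : N.IsCocontinuous)
    (h : N.ActsOnFGProj) :
    ModuleEquivalent M.str (N.fgProjModule h) ↔ ModuleEquivalent M.presheaves.str N.str := by
  refine ⟨fun ⟨Φ, hΦ⟩ => .symm ?_,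
    fun e => (M.moduleEquivalent_fgProjModule hM hM').trans (e.fgProjModule hM' h)⟩
  -- Through `Φ`, `M` becomes a small dense full module subcategory of finitely generated
  -- projectives in `N`, and the nerve along it identifies `N` with the presheaves on `M`.
  let E := Φ.comp (ModuleFunctor.ofFullSub N.str.restrict (fgProj k N.base) h)
  have : E.toFunctor.Full := inferInstanceAs (Φ.toFunctor ⋙ (fgProj k N.base).ι).Full
  have : E.toFunctor.Faithful := inferInstanceAs (Φ.toFunctor ⋙ (fgProj k N.base).ι).Faithful
  refine E.moduleEquivalent_psh (isDense_of_fgProj _ fun P hP => ?_)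
    (fun b => (Φ.toFunctor.obj b).property) hN.1 hN.2
  exact ⟨Φ.toFunctor.objPreimage ⟨P, hP⟩,
    ⟨(fgProj k N.base).ι.mapIso (Φ.toFunctor.objObjPreimageIso ⟨P, hP⟩)⟩⟩

/-- Every monoidal module presheaf category arises from a Cauchy complete module category. -/
lemma PresheafModule.exists_respectingModule {F G : S} (adj : DualPair σ F G)
    (hs : ∀ X, ∃ s, s ≫ adj.epsR X = 𝟙 X) (N : PresheafModule σ)
    (hN : U.IsMonoidalModule N.str) (hc : N.IsCocontinuous) (h : N.ActsOnFGProj) :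
    ∃ M : RespectingModules adj, ModuleEquivalent M.1.str (N.fgProjModule h) := by
  obtain ⟨M, E, _, _, hE, hE'⟩ := N.exists_smallModule h
  exact ⟨⟨M, isCauchyComplete_of_fgProj E.toFunctor hE hE', E.respected hN,
    E.spans (adj := adj) hs hN hc hE⟩, E.moduleEquivalent_fullSub _ h hE hE'⟩

/-- The presheaves on a module category, as a module presheaf category. -/
def RespectingModules.presheaves {F G : S} {adj : DualPair σ F G} (hσ : IsRigid σ)
    (hF : IsLiberal (σ.tensor.obj F)) (U : UnitStr (σ.psh (k := k))) (M : RespectingModules adj) :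
    FaithfulPresheafModules U G :=
  have h := adj.isMonoidalModule_psh hσ hF U M.2.2.2 M.2.2.1
  ⟨M.1.presheaves, h, M.1.presheaves_isCocontinuous,
    adj.faithful_restrict (adj.exists_section_epsR hF) h M.1.presheaves_isCocontinuous.2⟩

lemma RespectingModules.equivalent_fgProj_iff {F G : S} {adj : DualPair σ F G} (hσ : IsRigid σ)
    (hF : IsLiberal (σ.tensor.obj F)) (M : RespectingModules adj)
    (N : FaithfulPresheafModules U G) (h : N.1.ActsOnFGProj) :
    ModuleEquivalent M.1.str (N.1.fgProjModule h) ↔ M.presheaves hσ hF U ≈ N :=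
  SmallModule.moduleEquivalent_fgProjModule_iff M.2.1
    (PresheafModule.actsOnFGProj hσ (M.presheaves hσ hF U).2.1 (M.presheaves hσ hF U).2.2.1)
    N.2.2.1 h

/-- Since `M'` is equivalent to the finitely generated projectives of its own presheaves, this is
`equivalent_fgProj_iff` for that presheaf category. One direction makes the map on classes well
defined, the other makes it injective. -/
lemma RespectingModules.presheaves_equiv_iff {F G : S} {adj : DualPair σ F G} (hσ : IsRigid σ)
    (hF : IsLiberal (σ.tensor.obj F)) (M M' : RespectingModules adj) :
    M ≈ M' ↔ M.presheaves hσ hF U ≈ M'.presheaves hσ hF U := by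
  have h := PresheafModule.actsOnFGProj hσ (M'.presheaves hσ hF U).2.1
    (M'.presheaves hσ hF U).2.2.1
  have h' := M'.1.moduleEquivalent_fgProjModule M'.2.1 h
  refine Iff.trans ?_ (M.equivalent_fgProj_iff hσ hF (M'.presheaves hσ hF U) h)
  exact ⟨fun e => ModuleEquivalent.trans e h', fun e => ModuleEquivalent.trans e h'.symm⟩

end Classification

end SemigroupModule

end

/-! ### The theorem -/

theorem theorem3p13 {k : Type u} [Field k] {S : Type u} [SmallCategory S] [Preadditive S]
    [Linear k S] (σ : SemigroupModule.SemigroupStr k S) (hσ : SemigroupModule.IsRigid σ)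
    {F F' : S} (adj : SemigroupModule.DualPair σ F F')
    (hF : SemigroupModule.IsLiberal (σ.tensor.obj F)) :
    Nonempty (SemigroupModule.UnitStr (σ.psh (k := k))) ∧
    ∀ U : SemigroupModule.UnitStr (σ.psh (k := k)),
      (∀ M : SemigroupModule.SmallModule σ, M.str.Spans → adj.Respected M.str →
        U.IsMonoidalModule M.presheaves.str) ∧
      ∃ e : Quotient (SemigroupModule.RespectingModules.setoid adj) ≃
          Quotient (SemigroupModule.FaithfulPresheafModules.setoid U F'),
        (∀ M : SemigroupModule.RespectingModules adj,
          ∃ N : SemigroupModule.FaithfulPresheafModules U F',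
            N.1 = M.1.presheaves ∧ e (Quotient.mk _ M) = Quotient.mk _ N) ∧
        (∀ N : SemigroupModule.FaithfulPresheafModules U F',
          ∃ h : N.1.ActsOnFGProj, ∀ M : SemigroupModule.RespectingModules adj,
            e.symm (Quotient.mk _ N) = Quotient.mk _ M ↔
              SemigroupModule.ModuleEquivalent M.1.str (N.1.fgProjModule h)) := by
  refine ⟨⟨adj.unitStr hσ hF⟩, fun U => ⟨fun M hM h => adj.isMonoidalModule_psh hσ hF U hM h, ?_⟩⟩
  have hN : ∀ N : SemigroupModule.FaithfulPresheafModules U F', N.1.ActsOnFGProj := fun N =>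
    SemigroupModule.PresheafModule.actsOnFGProj hσ N.2.1 N.2.2.1
  let p : Quotient (SemigroupModule.RespectingModules.setoid adj) →
      Quotient (SemigroupModule.FaithfulPresheafModules.setoid U F') :=
    Quotient.map (SemigroupModule.RespectingModules.presheaves hσ hF U)
      fun M M' h => (M.presheaves_equiv_iff hσ hF M').1 h
  have hp : Function.Bijective p := by
    constructor
    · rintro ⟨M⟩ ⟨M'⟩ h
      exact Quotient.sound ((M.presheaves_equiv_iff hσ hF M').2 (Quotient.exact h))
    · rintro ⟨N⟩
      obtain ⟨M, hM⟩ := N.1.exists_respectingModule adj (adj.exists_section_epsR hF) N.2.1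
        N.2.2.1 (hN N)
      exact ⟨Quotient.mk _ M, Quotient.sound ((M.equivalent_fgProj_iff hσ hF N _).1 hM)⟩
  refine ⟨Equiv.ofBijective p hp, fun M => ⟨M.presheaves hσ hF U, rfl, rfl⟩,
    fun N => ⟨hN N, fun M => ?_⟩⟩
  -- The inverse is described through the forward map: the class of `N` comes from `M` exactly when
  -- the presheaves on `M` are equivalent to `N`, which is equivalence of `M` with the finitely
  -- generated projectives of `N`.
  rw [M.equivalent_fgProj_iff hσ hF N, Equiv.symm_apply_eq, eq_comm]
  exact Quotient.eq
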